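/- **Theorem.** Compositions are written in diagrammatic order. Let $\mathbb X$ be a display tangent category, that is, a tangent category $(\mathbb X,T,p,0,+,\ell,c)$ (with $p:T\to \mathrm{Id}$ admitting finite pullback powers preserved by every $T^k$, additive bundles, vertical lift and canonical flip) together with: * a transverse system $\mathcal Q$: a class of functors $\mathbf 2^n\to\mathbb X$ ($n\ge 0$) sending the squares $(x\wedge y,x,y,x\vee y)$ of $\mathbf 2^n$ to pullbacks, which contains all functors with $n\le 1$, is closed under natural isomorphism and under precomposition with lattice homomorphisms $\mathbf 2^m\to\mathbf 2^n$, and contains a functor with $n\ge 3$ as soon as it contains all its faces; it contains the pullback powers of each $p_M$ and the pullback squares of the universality of the vertical lift, and $T$ preserves it; * a display system $\mathcal D$: a class of maps such that every pullback along a map of $\mathcal D$ exists and is in $\mathcal Q$, which contains all isomorphisms, is closed under pullback along arbitrary maps and is preserved by $T$, and such that for every natural transformation $\alpha:F\to G$ with $F,G:\mathbf 2^n\to\mathbb X$ in $\mathcal Q$, $n\ge 2$, if $\alpha_x\in\mathcal D$ for all $x\neq(0,\dots,0)$ then $\alpha_{(0,\dots,0)}\in\mathcal D$. Let $\mathsf{DBun}_{\mathcal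 D}(\mathbb X)$ be the category whose objects are the differential bundles $\mathsf q=(q:E\to M,\sigma,\zeta,\lambda)$ of $\mathbb X$ with $q\in\mathcal D$ and whose morphisms are the commutative squares between the projections, and let $P:\mathsf{DBun}_{\mathcal D}(\mathbb X)\to\mathbb X$ send $\mathsf q$ to its base $M$. Then: 1. $\mathsf{DBun}_{\mathcal D}(\mathbb X)$ is a tangent category with the pointwise tangent structure, $T(\mathsf q)=(T(q),T(\sigma),T(\zeta),T(\lambda)c)$. 2. $P$ is a tangent fibration: it is a fibration, it is a strict morphism of tangent categories, and the tangent functor of $\mathsf{DBun}_{\mathcal D}(\mathbb X)$ preserves Cartesian arrows. Every map $f:N\to M$ and every $\mathsf q$ over $M$ admit a Cartesian lift $f^*\mathsf q\to\mathsf q$ of $f$ which is linear (i.e. preserves the lifts $\lambda$). 3. For every choice of linear Cartesian lifts, the tangent fibration $P$ is differential: for each object $M$, the fibre $P^{-1}(M)$, with its vertical tangent structure ($T_M(\mathsf q)=(0_M)^*(T(\mathsf q))$, with $p,0,+,\ell,c$ obtained by substitution along the Cartesian arrows $T_M(\mathsf q)\to T(\mathsf q)$ over $0_M:M\to T(M)$),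 is a tangent category with finite products preserved by $T_M$, and it has coherent differential structure. That is, every object $A$ of the fibre has an associated structure $(\zeta_A,\sigma_A,\lambda_A)$ of a differential bundle over the final object $1$, such that, for suitable chosen products and up to the canonical isomorphisms $T_M(1)\cong 1$ and $T_M(A\times B)\cong T_M(A)\times T_M(B)$, $$\zeta_{A\times B}=\langle\zeta_A,\zeta_B\rangle,\quad \sigma_{A\times B}=\mathsf{ex}(\sigma_A\times\sigma_B),\quad \lambda_{A\times B}=\langle\pi_0\lambda_A,\pi_1\lambda_B\rangle,$$ $$\zeta_{T_M(A)}=T_M(\zeta_A),\quad \sigma_{T_M(A)}=T_M(\sigma_A),\quad \lambda_{T_M(A)}=T_M(\lambda_A)c,$$ where $\mathsf{ex}$ interchanges the two middle factors. 4. Hence each fibre $P^{-1}(M)$ is a Cartesian differential category, with $f+g=\langle f,g\rangle\sigma_B$ and $0=\,!\,\zeta_B$ for $f,g:A\to B$, and with $D[f]:A\times A\to B$ the unique map such that $\langle D[f],\pi_1 f\rangle\mu_B=\mu_A T_M(f)$, where $\mu_A=\langle\pi_0\lambda_A,\pi_1 0_A\rangle T_M(\sigma_A):A\times A\to T_M(A)$.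 -/

import Mathlib

open CategoryTheory CategoryTheory.Limits

universe v v₁ v₂ u u₁ u₂

namespace TangentCat

noncomputable section

/-! ### Finite pullback powers of a map -/

section Powers

variable {C : Type u₁} [Category.{v₁} C] {B : Type u₂} [Category.{v₂} B]

/-- The diagram consisting of `n` copies of `q : E ⟶ M`; its limit is the `n`-fold pullback
power of `q` along itself. -/
abbrev powerDiagram {E M : C} (q : E ⟶ M) (n : ℕ) : WidePullbackShape (Fin n) ⥤ C :=
  WidePullbackShape.wideCospan M (fun _ : Fin n => E) (fun _ => q)

/-- `q` admits all finite pullback powers along itself. -/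
class HasPullbackPowers {E M : C} (q : E ⟶ M) : Prop where
  hasLimit : ∀ n : ℕ, HasLimit (powerDiagram q n)

/-- `F` preserves all finite pullback powers of `q` along itself. -/
class PreservesPullbackPowers (F : C ⥤ B) {E M : C} (q : E ⟶ M) : Prop where
  preserves : ∀ n : ℕ, PreservesLimit (powerDiagram q n) F

/-- Iterates of an endofunctor. -/
def iter (T : C ⥤ C) : ℕ → (C ⥤ C)
  | 0 => 𝟭 C
  | k + 1 => iter T k ⋙ T

/-- All finite pullback powers of `q` along itself are preserved by every iterate of `T`. -/
class PreservedByIterates (T : C ⥤ C) {E M : C} (q : E ⟶ M) : Prop where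
  preserves : ∀ k : ℕ, PreservesPullbackPowers (iter T k) q

instance (T : C ⥤ C) {E M : C} (q : E ⟶ M) [h : PreservedByIterates T q] :
    PreservesPullbackPowers T q :=
  h.preserves 1

/-- The limit of two maps with a common codomain is a pullback square. -/
theorem isPullback_of_isLimit_two (D : WidePullbackShape (Fin 2) ⥤ C) (s : Cone D)
    (hs : IsLimit s) :
    IsPullback (s.π.app (some 0)) (s.π.app (some 1))
      (D.map (WidePullbackShape.Hom.term 0)) (D.map (WidePullbackShape.Hom.term 1)) := by
  have w : ∀ i : Fin 2, s.π.app (some i) ≫ D.map (WidePullbackShape.Hom.term i) =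
      s.π.app none := fun i => s.w (WidePullbackShape.Hom.term i)
  let cn : ∀ t : PullbackCone (D.map (WidePullbackShape.Hom.term 0))
      (D.map (WidePullbackShape.Hom.term 1)), Cone D := fun t =>
    WidePullbackShape.mkCone (t.fst ≫ D.map (WidePullbackShape.Hom.term 0))
      (fun j => match j with
        | 0 => t.fst
        | 1 => t.snd)
      (fun j => by
        match j with
        | 0 => rfl
        | 1 => exact t.condition.symm)
  refine ⟨⟨(w 0).trans (w 1).symm⟩, ⟨PullbackCone.IsLimit.mk _
    (fun t => hs.lift (cn t)) (fun t => hs.fac (cn t) (some 0))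
    (fun t => hs.fac (cn t) (some 1)) ?_⟩⟩
  intro t m h0 h1
  refine hs.uniq (cn t) m ?_
  rintro (_ | j)
  · calc m ≫ s.π.app none = m ≫ s.π.app (some 0) ≫ D.map (WidePullbackShape.Hom.term 0) :=
          congrArg (fun k => m ≫ k) (w 0).symm
      _ = (m ≫ s.π.app (some 0)) ≫ D.map (WidePullbackShape.Hom.term 0) :=
          (Category.assoc _ _ _).symm
      _ = t.fst ≫ D.map (WidePullbackShape.Hom.term 0) :=
          congrArg (fun k => k ≫ D.map (WidePullbackShape.Hom.term 0)) h0
  · match j with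
    | 0 => exact h0
    | 1 => exact h1

instance {E M : C} (q : E ⟶ M) [h : HasPullbackPowers q] : HasPullback q q := by
  have := h.hasLimit 2
  exact (isPullback_of_isLimit_two _ _ (limit.isLimit (powerDiagram q 2))).hasPullback

/-- A functor preserving the pullback powers of `q` preserves the pullback of `q` with itself. -/
theorem isPullback_map (F : C ⥤ B) {E M : C} (q : E ⟶ M) [h : HasPullbackPowers q]
    [hF : PreservesPullbackPowers F q] :
    IsPullback (F.map (pullback.fst q q)) (F.map (pullback.snd q q)) (F.map q) (F.map q) := by
  have := h.hasLimit 2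
  have := hF.preserves 2
  have h1 : IsPullback _ _ q q :=
    isPullback_of_isLimit_two _ _ (limit.isLimit (powerDiagram q 2))
  have h2 : IsPullback _ _ (F.map q) (F.map q) :=
    isPullback_of_isLimit_two _ _ (isLimitOfPreserves F (limit.isLimit (powerDiagram q 2)))
  have e0 : F.map h1.isoPullback.hom ≫ F.map (pullback.fst q q) =
      F.map (limit.π (powerDiagram q 2) (some 0)) := by
    rw [← F.map_comp]
    exact congrArg F.map h1.isoPullback_hom_fst
  have e1 : F.map h1.isoPullback.hom ≫ F.map (pullback.snd q q) =
      F.map (limit.π (powerDiagram q 2) (some 1)) := by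
    rw [← F.map_comp]
    exact congrArg F.map h1.isoPullback_hom_snd
  exact IsPullback.of_iso h2 (F.mapIso h1.isoPullback) (Iso.refl _) (Iso.refl _) (Iso.refl _)
    ((Category.comp_id _).trans e0.symm) ((Category.comp_id _).trans e1.symm)
    ((Category.comp_id _).trans (Category.id_comp _).symm)
    ((Category.comp_id _).trans (Category.id_comp _).symm)

/-- The image of a map whose pullback powers exist and are preserved has pullback powers. -/
theorem hasPullbackPowers_map (F : C ⥤ B) {E M : C} (q : E ⟶ M) [h : HasPullbackPowers q]
    [hF : PreservesPullbackPowers F q] : HasPullbackPowers (F.map q) where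
  hasLimit n := by
    have := h.hasLimit n
    have := hF.preserves n
    exact hasLimit_of_iso (F := powerDiagram q n ⋙ F)
      (WidePullbackShape.diagramIsoWideCospan (powerDiagram q n ⋙ F))

end Powers

/-! ### Additive bundles -/

/-- An additive bundle: a map `q : E ⟶ M` with finite pullback powers along itself, which is a
commutative monoid in the slice over `M`.  The laws are written for generalized elements
`a : Z ⟶ E`. -/
structure AdditiveBundle {C : Type u} [Category.{v} C] {E M : C} (q : E ⟶ M) where
  [powers : HasPullbackPowers q]
  /-- The addition `σ : E₂ ⟶ E`. -/
  add : pullback q q ⟶ E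
  /-- The zero section `ζ : M ⟶ E`. -/
  zero : M ⟶ E
  add_proj : add ≫ q = pullback.fst q q ≫ q
  zero_proj : zero ≫ q = 𝟙 M
  zero_add : ∀ {Z : C} (a : Z ⟶ E),
    pullback.lift (a ≫ q ≫ zero) a (by simp [zero_proj]) ≫ add = a
  add_comm : ∀ {Z : C} (a b : Z ⟶ E) (h : a ≫ q = b ≫ q),
    pullback.lift a b h ≫ add = pullback.lift b a h.symm ≫ add
  add_assoc : ∀ {Z : C} (a b c : Z ⟶ E) (h : a ≫ q = b ≫ q) (h' : b ≫ q = c ≫ q),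
    pullback.lift (pullback.lift a b h ≫ add) c (by
      rw [Category.assoc, add_proj, pullback.lift_fst_assoc, h, h']) ≫ add =
      pullback.lift a (pullback.lift b c h' ≫ add) (by
        rw [Category.assoc, add_proj, pullback.lift_fst_assoc, h]) ≫ add

namespace AdditiveBundle

variable {C : Type u₁} [Category.{v₁} C] {B : Type u₂} [Category.{v₂} B]
  {E M : C} {q : E ⟶ M} (S : AdditiveBundle q)

/-- The second pullback power `E₂`. -/
def E₂ : C :=
  haveI := S.powers
  pullback q q

/-- The projection `π₀ : E₂ ⟶ E`. -/
def π₀ : S.E₂ ⟶ E :=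
  haveI := S.powers
  pullback.fst q q

/-- The projection `π₁ : E₂ ⟶ E`. -/
def π₁ : S.E₂ ⟶ E :=
  haveI := S.powers
  pullback.snd q q

/-- The addition `σ : E₂ ⟶ E`. -/
def σ : S.E₂ ⟶ E := S.add

theorem isPullback : IsPullback S.π₀ S.π₁ q q :=
  haveI := S.powers
  IsPullback.of_hasPullback q q

theorem σ_proj : S.σ ≫ q = S.π₀ ≫ q := S.add_proj

/-- The pairing `⟨a, b⟩ : Z ⟶ E₂`. -/
def pair {Z : C} (a b : Z ⟶ E) (h : a ≫ q = b ≫ q) : Z ⟶ S.E₂ :=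
  S.isPullback.lift a b h

/-- The sum `⟨a, b⟩ ≫ σ` of two generalized elements of the same fibre. -/
def sum {Z : C} (a b : Z ⟶ E) (h : a ≫ q = b ≫ q) : Z ⟶ E :=
  S.pair a b h ≫ S.σ

theorem sum_proj {Z : C} (a b : Z ⟶ E) (h : a ≫ q = b ≫ q) : S.sum a b h ≫ q = a ≫ q := by
  rw [sum, pair, Category.assoc, σ_proj, IsPullback.lift_fst_assoc]

theorem comp_sum {W Z : C} (f : W ⟶ Z) (a b : Z ⟶ E) (h : a ≫ q = b ≫ q)
    (h' : (f ≫ a) ≫ q = (f ≫ b) ≫ q) : f ≫ S.sum a b h = S.sum (f ≫ a) (f ≫ b) h' := by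
  rw [sum, sum, ← Category.assoc]
  congr 1
  apply S.isPullback.hom_ext <;> simp [pair]

theorem lift_add_eq_sum {Z : C} (a b : Z ⟶ E) (h : a ≫ q = b ≫ q) [HasPullback q q] :
    pullback.lift a b h ≫ S.add = S.sum a b h := by
  rw [sum, σ]
  congr 1
  apply S.isPullback.hom_ext
  · exact (pullback.lift_fst a b h).trans (S.isPullback.lift_fst a b h).symm
  · exact (pullback.lift_snd a b h).trans (S.isPullback.lift_snd a b h).symm

section Functor

variable (F : C ⥤ B) [hF : PreservesPullbackPowers F q]

theorem isPullback_map : IsPullback (F.map S.π₀) (F.map S.π₁) (F.map q) (F.map q) :=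
  haveI := S.powers
  TangentCat.isPullback_map F q

/-- The pairing `⟨a, b⟩ : Z ⟶ F E₂`, where `F E₂` is the pullback of `F q` along itself. -/
def mapPair {Z : B} (a b : Z ⟶ F.obj E) (h : a ≫ F.map q = b ≫ F.map q) : Z ⟶ F.obj S.E₂ :=
  (S.isPullback_map F).lift a b h

theorem comp_mapPair {W Z : B} (f : W ⟶ Z) (a b : Z ⟶ F.obj E) (h : a ≫ F.map q = b ≫ F.map q)
    (h' : (f ≫ a) ≫ F.map q = (f ≫ b) ≫ F.map q) :
    f ≫ S.mapPair F a b h = S.mapPair F (f ≫ a) (f ≫ b) h' := by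
  apply (S.isPullback_map F).hom_ext <;> simp [mapPair]

theorem mapPair_map_σ {W : C} {Z : B} (x : Z ⟶ F.obj W) (a b : W ⟶ E) (h : a ≫ q = b ≫ q)
    (a' b' : Z ⟶ F.obj E) (h' : a' ≫ F.map q = b' ≫ F.map q)
    (ha : a' = x ≫ F.map a) (hb : b' = x ≫ F.map b) :
    S.mapPair F a' b' h' ≫ F.map S.σ = x ≫ F.map (S.sum a b h) := by
  subst ha hb
  rw [sum, F.map_comp, ← Category.assoc x]
  congr 1
  apply (S.isPullback_map F).hom_ext <;> simp [mapPair, pair, ← F.map_comp]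

theorem exists_triple (S : AdditiveBundle q) (F : C ⥤ B) [hF : PreservesPullbackPowers F q] {Z : B} (a b c : Z ⟶ F.obj E) (h : a ≫ F.map q = b ≫ F.map q)
    (h' : b ≫ F.map q = c ≫ F.map q) :
    ∃ (W : C) (x : Z ⟶ F.obj W) (a' b' c' : W ⟶ E), a' ≫ q = b' ≫ q ∧ b' ≫ q = c' ≫ q ∧
      a = x ≫ F.map a' ∧ b = x ≫ F.map b' ∧ c = x ≫ F.map c' := by
  have hp := S.powers
  have := hp.hasLimit 3
  have := hF.preserves 3
  have w : ∀ i : Fin 3, limit.π (powerDiagram q 3) (some i) ≫ q =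
      limit.π (powerDiagram q 3) none := fun i =>
    limit.w (powerDiagram q 3) (WidePullbackShape.Hom.term i)
  have hl := isLimitOfPreserves F (limit.isLimit (powerDiagram q 3))
  let cn : Cone (powerDiagram q 3 ⋙ F) :=
    WidePullbackShape.mkCone (a ≫ F.map q)
      (fun j => match j with
        | 0 => a
        | 1 => b
        | 2 => c)
      (fun j => by
        match j with
        | 0 => rfl
        | 1 => exact h.symm
        | 2 => exact (h.trans h').symm)
  exact ⟨limit (powerDiagram q 3), hl.lift cn, limit.π (powerDiagram q 3) (some 0),
    limit.π (powerDiagram q 3) (some 1), limit.π (powerDiagram q 3) (some 2),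
    (w 0).trans (w 1).symm, (w 1).trans (w 2).symm, (hl.fac cn (some 0)).symm,
    (hl.fac cn (some 1)).symm, (hl.fac cn (some 2)).symm⟩

/-- The image `(F q, F σ, F ζ)` of an additive bundle under a functor which preserves the pullback
powers of `q`; the identification of `F E₂` with the pullback of `F q` along itself is
understood. -/
def map : AdditiveBundle (F.map q) :=
  haveI := hasPullbackPowers_map F q (h := S.powers)
  have key : ∀ {Z : B} (a b : Z ⟶ F.obj E) (h : a ≫ F.map q = b ≫ F.map q),
      pullback.lift a b h ≫ S.mapPair F (pullback.fst _ _) (pullback.snd _ _)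
        pullback.condition ≫ F.map S.σ = S.mapPair F a b h ≫ F.map S.σ := by
    intro Z a b h
    rw [← Category.assoc]
    congr 1
    apply (S.isPullback_map F).hom_ext
    · rw [Category.assoc, mapPair, mapPair, IsPullback.lift_fst, IsPullback.lift_fst]
      exact pullback.lift_fst a b h
    · rw [Category.assoc, mapPair, mapPair, IsPullback.lift_snd, IsPullback.lift_snd]
      exact pullback.lift_snd a b h
  { add := S.mapPair F (pullback.fst _ _) (pullback.snd _ _) pullback.condition ≫ F.map S.σ
    zero := F.map S.zero
    add_proj := by
      rw [Category.assoc, ← F.map_comp, σ_proj, F.map_comp, ← Category.assoc]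
      congr 1
      exact (S.isPullback_map F).lift_fst _ _ _
    zero_proj := by rw [← F.map_comp, S.zero_proj, F.map_id]
    zero_add := by
      intro Z a
      rw [key, S.mapPair_map_σ F a (q ≫ S.zero) (𝟙 E) (by simp [S.zero_proj]) _ _ _
        (by simp) (by simp)]
      have := S.zero_add (𝟙 E)
      rw [S.lift_add_eq_sum] at this
      simp only [Category.id_comp] at this
      rw [this, F.map_id, Category.comp_id]
    add_comm := by
      intro Z a b h
      rw [key, key]
      obtain ⟨W, x, a', b', c', h1, h2, rfl, rfl, -⟩ := S.exists_triple F a b b h rfl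
      rw [S.mapPair_map_σ F x a' b' h1 _ _ _ rfl rfl,
        S.mapPair_map_σ F x b' a' h1.symm _ _ _ rfl rfl]
      have := S.add_comm a' b' h1
      rw [S.lift_add_eq_sum, S.lift_add_eq_sum] at this
      rw [this]
    add_assoc := by
      intro Z a b c h h'
      obtain ⟨W, x, a', b', c', h1, h2, rfl, rfl, rfl⟩ := S.exists_triple F a b c h h'
      have := S.add_assoc a' b' c' h1 h2
      simp only [S.lift_add_eq_sum] at this
      refine (key _ _ _).trans (Eq.trans ?_ (key _ _ _).symm)
      refine (S.mapPair_map_σ F x (S.sum a' b' h1) c' ((S.sum_proj a' b' h1).trans (h1.trans h2))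
          _ _ _ ((key _ _ _).trans (S.mapPair_map_σ F x a' b' h1 _ _ _ rfl rfl)) rfl).trans
        (Eq.trans ?_ (S.mapPair_map_σ F x a' (S.sum b' c' h2)
          (h1.trans (S.sum_proj b' c' h2).symm) _ _ _ rfl
          ((key _ _ _).trans (S.mapPair_map_σ F x b' c' h2 _ _ _ rfl rfl))).symm)
      rw [this] }

end Functor

/-- `μ := ⟨π₀ λ, π₁ z⟩ T(σ) : E₂ ⟶ T E`, where `z` is the zero `0_E : E ⟶ T E`. -/
def mu {C : Type u} [Category.{v} C] {E M : C} {q : E ⟶ M} (S : AdditiveBundle q)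
    (T : C ⥤ C) [PreservesPullbackPowers T q] (l z : E ⟶ T.obj E)
    (h : S.π₀ ≫ l ≫ T.map q = S.π₁ ≫ z ≫ T.map q) : S.E₂ ⟶ T.obj E :=
  S.mapPair T (S.π₀ ≫ l) (S.π₁ ≫ z) (by rw [Category.assoc, Category.assoc, h]) ≫ T.map S.σ

end AdditiveBundle

/-- `(e, b)` is an additive bundle morphism: a commutative square which preserves addition and
zero. -/
structure IsAdditiveMorphism {C : Type u} [Category.{v} C] {E M E' M' : C} {q : E ⟶ M}
    {q' : E' ⟶ M'} (S : AdditiveBundle q) (S' : AdditiveBundle q') (e : E ⟶ E') (b : M ⟶ M') :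
    Prop where
  comm : e ≫ q' = q ≫ b
  add : S.σ ≫ e = S'.pair (S.π₀ ≫ e) (S.π₁ ≫ e) (by
    rw [Category.assoc, Category.assoc, comm, ← Category.assoc, ← Category.assoc,
      S.isPullback.w]) ≫ S'.σ
  zero : S.zero ≫ e = b ≫ S'.zero

/-! ### Tangent structure -/

/-- Tangent structure `(T, p, 0, +, ℓ, c)` on a category.  The natural transformations are given by
their components; `+` and `0` are the addition and the zero of the additive bundles `bundle M`. -/
structure TangentStructure (C : Type u) [Category.{v} C] where
  /-- The tangent functor. -/
  T : C ⥤ C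
  /-- The projection `p_M : T M ⟶ M`. -/
  p : ∀ M : C, T.obj M ⟶ M
  /-- Pullback powers of `p_M` (which exist, by `bundle`) are preserved by each `Tᵏ`. -/
  [preserved : ∀ M : C, PreservedByIterates T (p M)]
  /-- The additive bundle `(p_M, +_M, 0_M)`. -/
  bundle : ∀ M : C, AdditiveBundle (p M)
  /-- Naturality of `p`, `+` and `0`. -/
  natural : ∀ {M N : C} (f : M ⟶ N), IsAdditiveMorphism (bundle M) (bundle N) (T.map f) f
  /-- The vertical lift. -/
  ell : ∀ M : C, T.obj M ⟶ T.obj (T.obj M)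
  ell_natural : ∀ {M N : C} (f : M ⟶ N), T.map f ≫ ell N = ell M ≫ T.map (T.map f)
  ell_additive : ∀ M : C,
    IsAdditiveMorphism (bundle M) ((bundle M).map T) (ell M) (bundle M).zero
  /-- The canonical flip. -/
  flip : ∀ M : C, T.obj (T.obj M) ⟶ T.obj (T.obj M)
  flip_natural : ∀ {M N : C} (f : M ⟶ N),
    T.map (T.map f) ≫ flip N = flip M ≫ T.map (T.map f)
  flip_additive : ∀ M : C,
    IsAdditiveMorphism ((bundle M).map T) (bundle (T.obj M)) (flip M) (𝟙 (T.obj M))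
  flip_flip : ∀ M : C, flip M ≫ flip M = 𝟙 (T.obj (T.obj M))
  ell_flip : ∀ M : C, ell M ≫ flip M = ell M
  ell_map_ell : ∀ M : C, ell M ≫ T.map (ell M) = ell M ≫ ell (T.obj M)
  flip_hexagon : ∀ M : C,
    T.map (flip M) ≫ flip (T.obj M) ≫ T.map (flip M) =
      flip (T.obj M) ≫ T.map (flip M) ≫ flip (T.obj M)
  ell_flip_flip : ∀ M : C,
    ell (T.obj M) ≫ T.map (flip M) ≫ flip (T.obj M) = flip M ≫ T.map (ell M)
  /-- Universality of the vertical lift: the square of `v := ⟨π₀ ℓ, π₁ 0_T⟩ T(+)` is a pullback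
  (`k = 0`) which is preserved by each `Tᵏ`. -/
  universal : ∀ (M : C) (k : ℕ), IsPullback
    ((iter T k).map ((bundle M).mu T (ell M) (bundle (T.obj M)).zero (by
      rw [(ell_additive M).comm, (natural (p M)).zero, ← Category.assoc, ← Category.assoc,
        (bundle M).isPullback.w])))
    ((iter T k).map ((bundle M).π₀ ≫ p M))
    ((iter T k).map (T.map (p M)))
    ((iter T k).map (bundle M).zero)

attribute [instance] TangentStructure.preserved

namespace TangentStructure

variable {C : Type u} [Category.{v} C] (𝕋 : TangentStructure C)

/-- The zero `0_M : M ⟶ T M`. -/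
def zero (M : C) : M ⟶ 𝕋.T.obj M := (𝕋.bundle M).zero

/-- The map `v := ⟨π₀ ℓ, π₁ 0_T⟩ T(+) : T₂ M ⟶ T² M`. -/
def vert (M : C) : (𝕋.bundle M).E₂ ⟶ 𝕋.T.obj (𝕋.T.obj M) :=
  (𝕋.bundle M).mu 𝕋.T (𝕋.ell M) (𝕋.zero (𝕋.T.obj M)) (by
    rw [(𝕋.ell_additive M).comm, zero, (𝕋.natural (𝕋.p M)).zero, ← Category.assoc,
      ← Category.assoc, (𝕋.bundle M).isPullback.w])

end TangentStructure

/-! ### Differential bundles -/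

/-- A differential bundle structure `(σ, ζ, λ)` on `q : E ⟶ M` in a tangent category. -/
structure DifferentialBundle {C : Type u} [Category.{v} C] (𝕋 : TangentStructure C) {E M : C}
    (q : E ⟶ M) extends AdditiveBundle q where
  /-- Pullback powers of `q` are preserved by each `Tᵏ`. -/
  [preserved : PreservedByIterates 𝕋.T q]
  /-- The lift `λ`. -/
  lift : E ⟶ 𝕋.T.obj E
  /-- `(λ, 0) : (q, σ, ζ) ⟶ (T q, T σ, T ζ)` is additive. -/
  lift_additive_map : IsAdditiveMorphism toAdditiveBundle (toAdditiveBundle.map 𝕋.T) lift (𝕋.zero M)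
  /-- `(λ, ζ) : (q, σ, ζ) ⟶ (p, +, 0)` is additive. -/
  lift_additive_p : IsAdditiveMorphism toAdditiveBundle (𝕋.bundle E) lift zero
  /-- Universality of the lift: the square of `μ := ⟨π₀ λ, π₁ 0⟩ T(σ)` is a pullback (`k = 0`) which
  is preserved by each `Tᵏ`. -/
  universal : ∀ k : ℕ, IsPullback
    ((iter 𝕋.T k).map (toAdditiveBundle.mu 𝕋.T lift (𝕋.zero E) (by
      rw [lift_additive_map.comm, TangentStructure.zero, TangentStructure.zero,
        (𝕋.natural q).zero, ← Category.assoc, ← Category.assoc, toAdditiveBundle.isPullback.w])))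
    ((iter 𝕋.T k).map (toAdditiveBundle.π₀ ≫ q))
    ((iter 𝕋.T k).map (𝕋.T.map q))
    ((iter 𝕋.T k).map (𝕋.zero M))
  lift_ell : lift ≫ 𝕋.ell E = lift ≫ 𝕋.T.map lift

namespace DifferentialBundle

variable {C : Type u} [Category.{v} C] {𝕋 : TangentStructure C} {E M : C} {q : E ⟶ M}

/-- The map `μ := ⟨π₀ λ, π₁ 0⟩ T(σ) : E₂ ⟶ T E`. -/
def μ (s : DifferentialBundle 𝕋 q) : s.E₂ ⟶ 𝕋.T.obj E :=
  haveI := s.preserved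
  s.toAdditiveBundle.mu 𝕋.T s.lift (𝕋.zero E) (by
    rw [s.lift_additive_map.comm, TangentStructure.zero, TangentStructure.zero,
      (𝕋.natural q).zero, ← Category.assoc, ← Category.assoc, s.isPullback.w])

/-- `s'` is the structure `T(q) = (T q, T σ, T ζ, (T λ) c)` on `T q`. -/
structure IsTangentOf (s' : DifferentialBundle 𝕋 (𝕋.T.map q)) (s : DifferentialBundle 𝕋 q) :
    Prop where
  add : s'.pair (𝕋.T.map s.π₀) (𝕋.T.map s.π₁)
    (by rw [← Functor.map_comp, ← Functor.map_comp, s.isPullback.w]) ≫ s'.σ = 𝕋.T.map s.σ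
  zero : s'.zero = 𝕋.T.map s.zero
  lift : s'.lift = 𝕋.T.map s.lift ≫ 𝕋.flip E

end DifferentialBundle

/-! ### Transverse systems and display systems -/

/-- The category `𝟐ⁿ`, with `𝟐 = (false < true)`. -/
def Cube (n : ℕ) : Type := Fin n → Bool

instance (n : ℕ) : DistribLattice (Cube n) := inferInstanceAs (DistribLattice (Fin n → Bool))

instance (n : ℕ) : BoundedOrder (Cube n) := inferInstanceAs (BoundedOrder (Fin n → Bool))

/-- The face inclusion `𝟐ⁿ ⥤ 𝟐ⁿ⁺¹` which inserts the constant `b` as `i`-th coordinate. -/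
def face {n : ℕ} (i : Fin (n + 1)) (b : Bool) : Cube n ⥤ Cube (n + 1) :=
  Monotone.functor (f := fun w : Cube n => (Fin.insertNth (α := fun _ => Bool) i b w : Cube (n + 1))) (by
    intro w w' h j
    rcases Fin.eq_self_or_eq_succAbove i j with rfl | ⟨k, rfl⟩
    · exact le_of_eq ((Fin.insertNth_apply_same (α := fun _ => Bool) _ _ _).trans
        (Fin.insertNth_apply_same (α := fun _ => Bool) _ _ _).symm)
    · have e : ∀ z : Cube n, Fin.insertNth (α := fun _ => Bool) i b z (i.succAbove k) = z k :=
        fun z => Fin.insertNth_apply_succAbove (α := fun _ => Bool) i b z k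
      exact (e w).trans_le ((h k).trans_eq (e w').symm))

/-- The vertex of `𝟐ⁿ` whose only vanishing coordinate is the `i`-th. -/
def leg {n : ℕ} (i : Fin n) : Cube n := Function.update (fun _ : Fin n => true) i false

section Transverse

variable {C : Type u} [Category.{v} C]

/-- A cube is pullback preserving if it sends the pullback squares `x ⊓ y, x, y, x ⊔ y` of `𝟐ⁿ` to
pullbacks.  It then is the cube of the multiple pullback of its legs: the base is `F ⊤`, the apex
is `F ⊥`. -/
def IsPullbackPreserving {n : ℕ} (F : Cube n ⥤ C) : Prop :=
  ∀ x y : Cube n, IsPullback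
    (F.map (homOfLE (inf_le_left : x ⊓ y ≤ x))) (F.map (homOfLE (inf_le_right : x ⊓ y ≤ y)))
    (F.map (homOfLE (le_sup_left : x ≤ x ⊔ y))) (F.map (homOfLE (le_sup_right : y ≤ x ⊔ y)))

variable (C) in
/-- A transverse system on a category. -/
structure TransverseSystem where
  /-- The `n`-dimensional transverses. -/
  mem : ∀ {n : ℕ}, (Cube n ⥤ C) → Prop
  isPullbackPreserving : ∀ {n : ℕ} (F : Cube n ⥤ C), mem F → IsPullbackPreserving F
  mem_zero : ∀ F : Cube 0 ⥤ C, mem F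
  mem_one : ∀ F : Cube 1 ⥤ C, mem F
  reindex : ∀ {m n : ℕ} (r : LatticeHom (Cube m) (Cube n)) (F : Cube n ⥤ C), mem F →
    mem (Monotone.functor (OrderHomClass.mono r) ⋙ F)
  of_iso : ∀ {n : ℕ} {F G : Cube n ⥤ C}, (F ≅ G) → mem F → mem G
  of_faces : ∀ {n : ℕ} (F : Cube (n + 1) ⥤ C), 3 ≤ n + 1 →
    (∀ (i : Fin (n + 1)) (b : Bool), mem (face i b ⋙ F)) → mem F

namespace TransverseSystem

variable (𝒬 : TransverseSystem C)

/-- The commutative square `f ≫ h = g ≫ k` (with apex `P`) is, up to isomorphism, a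
two-dimensional transverse. -/
def Square {P X Y Z : C} (f : P ⟶ X) (g : P ⟶ Y) (h : X ⟶ Z) (k : Y ⟶ Z) : Prop :=
  ∃ F : Cube 2 ⥤ C, 𝒬.mem F ∧
    ∃ (eP : F.obj ⊥ ≅ P) (eX : F.obj (leg 0) ≅ X) (eY : F.obj (leg 1) ≅ Y) (eZ : F.obj ⊤ ≅ Z),
      F.map (homOfLE bot_le) ≫ eX.hom = eP.hom ≫ f ∧
      F.map (homOfLE bot_le) ≫ eY.hom = eP.hom ≫ g ∧
      F.map (homOfLE le_top) ≫ eZ.hom = eX.hom ≫ h ∧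
      F.map (homOfLE le_top) ≫ eZ.hom = eY.hom ≫ k

/-- The `n`-fold pullback power of `q` along itself is transverse. -/
def Power {E M : C} (q : E ⟶ M) (n : ℕ) : Prop :=
  ∃ F : Cube n ⥤ C, 𝒬.mem F ∧ ∃ (eM : F.obj ⊤ ≅ M) (eE : ∀ i : Fin n, F.obj (leg i) ≅ E),
    ∀ i : Fin n, F.map (homOfLE le_top) ≫ eM.hom = (eE i).hom ≫ q

/-- `f` is `𝒬`-quarrable: all pullbacks along `f` exist and are transverse. -/
def Quarrable {X Y : C} (f : X ⟶ Y) : Prop :=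
  ∀ {Z : C} (g : Z ⟶ Y), ∃ (P : C) (a : P ⟶ X) (b : P ⟶ Z), IsPullback a b f g ∧
    𝒬.Square a b f g

end TransverseSystem

variable (C) in
/-- A display tangent category: tangent structure with a compatible transverse system and a
compatible display system on it. -/
structure DisplayTangentStructure extends TangentStructure C where
  /-- The transverse system. -/
  𝒬 : TransverseSystem C
  power_transverse : ∀ (M : C) (n : ℕ), 𝒬.Power (p M) n
  universal_transverse : ∀ M : C, 𝒬.Square (toTangentStructure.vert M)
    ((bundle M).π₀ ≫ p M) (T.map (p M)) (toTangentStructure.zero M)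
  map_transverse : ∀ {n : ℕ} (F : Cube n ⥤ C), 𝒬.mem F → 𝒬.mem (F ⋙ T)
  /-- The display maps. -/
  𝒟 : MorphismProperty C
  display_quarrable : ∀ {X Y : C} (f : X ⟶ Y), 𝒟 f → 𝒬.Quarrable f
  display_iso : ∀ {X Y : C} (f : X ⟶ Y), IsIso f → 𝒟 f
  display_baseChange : 𝒟.IsStableUnderBaseChange
  /-- A transformation of (at least two-dimensional) transverses which is a display map at each
  vertex other than the apex is a display map at the apex. -/
  display_apex : ∀ {n : ℕ}, 2 ≤ n → ∀ {F G : Cube n ⥤ C}, 𝒬.mem F → 𝒬.mem G → ∀ α : F ⟶ G,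
    (∀ x : Cube n, x ≠ ⊥ → 𝒟 (α.app x)) → 𝒟 (α.app ⊥)
  map_display : ∀ {X Y : C} (f : X ⟶ Y), 𝒟 f → 𝒟 (T.map f)

end Transverse

/-! ### The category of display differential bundles -/

section DBun

variable {C : Type u} [Category.{v} C] (X : DisplayTangentStructure C)

/-- A display differential bundle. -/
structure DBun where
  /-- The base. -/
  base : C
  /-- The total object. -/
  total : C
  /-- The projection. -/
  proj : total ⟶ base
  /-- The differential bundle structure. -/
  str : DifferentialBundle X.toTangentStructure proj
  display : X.𝒟 proj

variable {X}

/-- A morphism of differential bundles: a commutative square. -/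
@[ext]
structure DBun.Hom (q q' : DBun X) where
  /-- The map of total objects. -/
  total : q.total ⟶ q'.total
  /-- The map of bases. -/
  base : q.base ⟶ q'.base
  w : total ≫ q'.proj = q.proj ≫ base

instance : Category (DBun X) where
  Hom q q' := DBun.Hom q q'
  id q := ⟨𝟙 _, 𝟙 _, by simp⟩
  comp f g := ⟨f.total ≫ g.total, f.base ≫ g.base, by
    rw [Category.assoc, g.w, ← Category.assoc, f.w, Category.assoc]⟩
  id_comp f := by ext <;> simp
  comp_id f := by ext <;> simp
  assoc f g h := by ext <;> simp

/-- A morphism of differential bundles is linear if it preserves the lift. -/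
def DBun.IsLinear {q q' : DBun X} (f : q ⟶ q') : Prop :=
  f.total ≫ q'.str.lift = q.str.lift ≫ X.T.map f.total

variable (X)

/-- The projection `P : DBun_𝒟(X) ⥤ X` which sends a bundle to its base. -/
@[simps]
def DBun.P : DBun X ⥤ C where
  obj q := q.base
  map f := f.base

/-- The functor which sends a bundle to its total object. -/
@[simps]
def DBun.totalFunctor : DBun X ⥤ C where
  obj q := q.total
  map f := f.total

end DBun

/-! ### Tangent fibrations and their vertical tangent structure -/

section Fibration

variable {E : Type u₁} [Category.{v₁} E] {B : Type u₂} [Category.{v₂} B]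

/-- `F` is a strict morphism of tangent categories: it sends the pullback powers of `p` and the
pullback of the universality of the vertical lift to pullbacks, and it carries the tangent structure
of `E` to that of `B`, on the nose.  Here `F.IsHomLift g f` says that `F f = g`, up to
the equalities between the domains and between the codomains. -/
structure IsStrictTangentMorphism (𝔼 : TangentStructure E) (𝔹 : TangentStructure B) (F : E ⥤ B) :
    Prop where
  obj : ∀ A : E, F.obj (𝔼.T.obj A) = 𝔹.T.obj (F.obj A)
  map : ∀ {A A' : E} (f : A ⟶ A'), F.IsHomLift (𝔹.T.map (F.map f)) (𝔼.T.map f)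
  p : ∀ A : E, F.IsHomLift (𝔹.p (F.obj A)) (𝔼.p A)
  zero : ∀ A : E, F.IsHomLift (𝔹.zero (F.obj A)) (𝔼.zero A)
  add : ∀ {Z A : E} (a b : Z ⟶ 𝔼.T.obj A) (h : a ≫ 𝔼.p A = b ≫ 𝔼.p A)
    (a' b' : F.obj Z ⟶ 𝔹.T.obj (F.obj A)) (h' : a' ≫ 𝔹.p (F.obj A) = b' ≫ 𝔹.p (F.obj A)),
    F.IsHomLift a' a → F.IsHomLift b' b →
      F.IsHomLift ((𝔹.bundle (F.obj A)).sum a' b' h') ((𝔼.bundle A).sum a b h)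
  ell : ∀ A : E, F.IsHomLift (𝔹.ell (F.obj A)) (𝔼.ell A)
  flip : ∀ A : E, F.IsHomLift (𝔹.flip (F.obj A)) (𝔼.flip A)
  preserves_powers : ∀ A : E, PreservesPullbackPowers F (𝔼.p A)
  preserves_universal : ∀ A : E, IsPullback (F.map (𝔼.vert A))
    (F.map ((𝔼.bundle A).π₀ ≫ 𝔼.p A)) (F.map (𝔼.T.map (𝔼.p A))) (F.map (𝔼.zero A))

/-- `P` is a tangent fibration: a fibration which is a strict morphism of tangent categories, such
that the pair of tangent functors is a morphism of fibrations, that is, the tangent functor of the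
total category preserves Cartesian arrows. -/
structure IsTangentFibration (𝔼 : TangentStructure E) (𝔹 : TangentStructure B) (P : E ⥤ B) :
    Prop where
  isFibered : P.IsFibered
  strict : IsStrictTangentMorphism 𝔼 𝔹 P
  cartesian : ∀ {R S : B} {A A' : E} (f : R ⟶ S) (φ : A ⟶ A'), P.IsStronglyCartesian f φ →
    P.IsStronglyCartesian (𝔹.T.map f) (𝔼.T.map φ)

/-- A cleavage: a choice of a Cartesian arrow `f^* A ⟶ A` over each `f : N ⟶ M`, for each `A` in
the fibre over `M`. -/
structure Cleavage (P : E ⥤ B) where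
  /-- The substituted object `f^* A`. -/
  obj : ∀ {N M : B} (_ : N ⟶ M) (_ : P.Fiber M), P.Fiber N
  /-- The Cartesian arrow `f^* A ⟶ A`. -/
  map : ∀ {N M : B} (f : N ⟶ M) (A : P.Fiber M),
    Functor.Fiber.fiberInclusion.obj (obj f A) ⟶ Functor.Fiber.fiberInclusion.obj A
  cartesian : ∀ {N M : B} (f : N ⟶ M) (A : P.Fiber M), P.IsStronglyCartesian f (map f A)

variable {𝔼 : TangentStructure E} {𝔹 : TangentStructure B} {P : E ⥤ B}

/-- For `A` in the fibre over `M`, the object `T A` lies in the fibre over `T M`. -/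
def IsStrictTangentMorphism.fiberT (hP : IsStrictTangentMorphism 𝔼 𝔹 P) {M : B}
    (A : P.Fiber M) : P.Fiber (𝔹.T.obj M) :=
  ⟨𝔼.T.obj A.1, (hP.obj A.1).trans (congrArg 𝔹.T.obj A.2)⟩

open Functor.Fiber in
/-- Given arrows `ι A : T_M A ⟶ T A` (which are to be Cartesian over `0_M`), the tangent structure
`V` on the fibre over `M` is obtained from that of the total category by substitution along `ι`. -/
structure IsSubstituted (𝔼 : TangentStructure E) {M : B} (V : TangentStructure (P.Fiber M))
    (ι : ∀ A : P.Fiber M, fiberInclusion.obj (V.T.obj A) ⟶ 𝔼.T.obj (fiberInclusion.obj A)) :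
    Prop where
  map : ∀ {A A' : P.Fiber M} (f : A ⟶ A'),
    fiberInclusion.map (V.T.map f) ≫ ι A' = ι A ≫ 𝔼.T.map (fiberInclusion.map f)
  p : ∀ A : P.Fiber M, fiberInclusion.map (V.p A) = ι A ≫ 𝔼.p (fiberInclusion.obj A)
  zero : ∀ A : P.Fiber M, fiberInclusion.map (V.zero A) ≫ ι A = 𝔼.zero (fiberInclusion.obj A)
  add : ∀ {Z A : P.Fiber M} (a b : Z ⟶ V.T.obj A) (h : a ≫ V.p A = b ≫ V.p A),
    fiberInclusion.map ((V.bundle A).sum a b h) ≫ ι A =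
      (𝔼.bundle (fiberInclusion.obj A)).sum (fiberInclusion.map a ≫ ι A)
        (fiberInclusion.map b ≫ ι A) (by
          rw [Category.assoc, Category.assoc, ← p, ← Functor.map_comp, ← Functor.map_comp, h])
  ell : ∀ A : P.Fiber M,
    fiberInclusion.map (V.ell A) ≫ ι (V.T.obj A) ≫ 𝔼.T.map (ι A) =
      ι A ≫ 𝔼.ell (fiberInclusion.obj A)
  flip : ∀ A : P.Fiber M,
    fiberInclusion.map (V.flip A) ≫ ι (V.T.obj A) ≫ 𝔼.T.map (ι A) =
      (ι (V.T.obj A) ≫ 𝔼.T.map (ι A)) ≫ 𝔼.flip (fiberInclusion.obj A)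

open Functor.Fiber in
/-- `V` is the vertical tangent structure on the fibre over `M`, for the cleavage `κ`: one has
`T_M A = (0_M)^* (T A)`, and the rest of the structure is obtained by substitution along the
Cartesian arrows `(0_M)^* (T A) ⟶ T A`. -/
def IsVertical (hP : IsStrictTangentMorphism 𝔼 𝔹 P) (κ : Cleavage P) (M : B)
    (V : TangentStructure (P.Fiber M)) : Prop :=
  ∃ h : ∀ A : P.Fiber M, V.T.obj A = κ.obj (𝔹.zero M) (hP.fiberT A),
    IsSubstituted 𝔼 V (fun A => eqToHom (congrArg fiberInclusion.obj (h A)) ≫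
      κ.map (𝔹.zero M) (hP.fiberT A))

end Fibration

/-! ### Coherent differential structure and Cartesian differential categories -/

section Coherent

open MonoidalCategory CartesianMonoidalCategory

variable {F : Type u} [Category.{v} F]

/-- Coherent differential structure on a Cartesian tangent category `F`, with the chosen finite
products of `F`: every object has an associated structure of differential bundle over the final
object, compatibly with products and with the tangent functor. -/
structure CoherentDifferentialStructure (V : TangentStructure F) [CartesianMonoidalCategory F]
    [PreservesFiniteProducts V.T] where
  /-- The canonical differential structure on `A`. -/
  str : ∀ A : F, DifferentialBundle V (toUnit A)
  /-- `ζ_{A × B} = ⟨ζ_A, ζ_B⟩`. -/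
  zero_prod : ∀ A B : F, (str (A ⊗ B)).zero = lift (str A).zero (str B).zero
  /-- `σ_{A × B} = ex (σ_A × σ_B)`: addition is componentwise. -/
  add_prod : ∀ A B : F, (str (A ⊗ B)).σ = lift
    ((str A).sum ((str (A ⊗ B)).π₀ ≫ fst A B) ((str (A ⊗ B)).π₁ ≫ fst A B) (toUnit_unique _ _))
    ((str B).sum ((str (A ⊗ B)).π₀ ≫ snd A B) ((str (A ⊗ B)).π₁ ≫ snd A B) (toUnit_unique _ _))
  /-- `λ_{A × B} = ⟨λ_A, λ_B⟩`, under the identification of `T (A × B)` with `T A × T B`. -/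
  lift_prod_fst : ∀ A B : F, (str (A ⊗ B)).lift ≫ V.T.map (fst A B) = fst A B ≫ (str A).lift
  lift_prod_snd : ∀ A B : F, (str (A ⊗ B)).lift ≫ V.T.map (snd A B) = snd A B ≫ (str B).lift
  /-- `ζ_{T A} = T(ζ_A)`, under the identification of `1` with `T 1`. -/
  zero_tangent : ∀ A : F, toUnit (V.T.obj (𝟙_ F)) ≫ (str (V.T.obj A)).zero = V.T.map (str A).zero
  /-- `σ_{T A} = T(σ_A)`, under the identification of `T A × T A` with `T (A × A)`. -/
  add_tangent : ∀ A : F, (str (V.T.obj A)).sum (V.T.map (str A).π₀) (V.T.map (str A).π₁)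
    (toUnit_unique _ _) = V.T.map (str A).σ
  /-- `λ_{T A} = T(λ_A) c`. -/
  lift_tangent : ∀ A : F, (str (V.T.obj A)).lift = V.T.map (str A).lift ≫ V.flip A

/-- A tangent category has coherent differential structure: it has finite products, these are
preserved by the tangent functor, and there is a coherent choice of differential structure. -/
def HasCoherentDifferentialStructure (V : TangentStructure F) : Prop :=
  ∃ (_ : CartesianMonoidalCategory F) (_ : PreservesFiniteProducts V.T),
    Nonempty (CoherentDifferentialStructure V)

variable (F) in
/-- The structure of a Cartesian differential category on a category with finite products. -/
structure CartesianDifferentialStructure [CartesianMonoidalCategory F] where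
  /-- Each hom-set is a commutative monoid. -/
  [homAdd : ∀ A B : F, AddCommMonoid (A ⟶ B)]
  comp_add : ∀ {A B C : F} (f : A ⟶ B) (g h : B ⟶ C), f ≫ (g + h) = f ≫ g + f ≫ h
  comp_zero : ∀ {A B C : F} (f : A ⟶ B), f ≫ (0 : B ⟶ C) = 0
  add_fst : ∀ {Z A B : F} (f g : Z ⟶ A ⊗ B), (f + g) ≫ fst A B = f ≫ fst A B + g ≫ fst A B
  add_snd : ∀ {Z A B : F} (f g : Z ⟶ A ⊗ B), (f + g) ≫ snd A B = f ≫ snd A B + g ≫ snd A B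
  zero_fst : ∀ {Z A B : F}, (0 : Z ⟶ A ⊗ B) ≫ fst A B = 0
  zero_snd : ∀ {Z A B : F}, (0 : Z ⟶ A ⊗ B) ≫ snd A B = 0
  /-- The differential combinator; the first argument of `D f` is the linear one. -/
  D : ∀ {A B : F}, (A ⟶ B) → (A ⊗ A ⟶ B)
  D_add : ∀ {A B : F} (f g : A ⟶ B), D (f + g) = D f + D g
  D_zero : ∀ {A B : F}, D (0 : A ⟶ B) = 0
  add_D : ∀ {Z A B : F} (a b c : Z ⟶ A) (f : A ⟶ B),
    lift (a + b) c ≫ D f = lift a c ≫ D f + lift b c ≫ D f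
  zero_D : ∀ {Z A B : F} (a : Z ⟶ A) (f : A ⟶ B), lift 0 a ≫ D f = 0
  D_id : ∀ A : F, D (𝟙 A) = fst A A
  D_fst : ∀ A B : F, D (fst A B) = fst (A ⊗ B) (A ⊗ B) ≫ fst A B
  D_snd : ∀ A B : F, D (snd A B) = fst (A ⊗ B) (A ⊗ B) ≫ snd A B
  D_lift : ∀ {Z A B : F} (f : Z ⟶ A) (g : Z ⟶ B), D (lift f g) = lift (D f) (D g)
  D_comp : ∀ {A B C : F} (f : A ⟶ B) (g : B ⟶ C),
    D (f ≫ g) = lift (D f) (snd A A ≫ f) ≫ D g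
  D_D_linear : ∀ {Z A B : F} (a d : Z ⟶ A) (f : A ⟶ B),
    lift (lift a 0) (lift 0 d) ≫ D (D f) = lift a d ≫ D f
  D_D_symm : ∀ {Z A B : F} (a b c d : Z ⟶ A) (f : A ⟶ B),
    lift (lift a b) (lift c d) ≫ D (D f) =
      lift (lift a c) (lift b d) ≫ D (D f)

/-- The Cartesian differential structure is the one determined by the coherent differential
structure: hom-sets are added through the canonical monoid structures, and `D f` is determined by
`⟨D f, π₁ f⟩ μ_B = μ_A T(f)`. -/
structure CartesianDifferentialStructure.IsInducedBy {V : TangentStructure F}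
    [CartesianMonoidalCategory F] [PreservesFiniteProducts V.T]
    (𝒟 : CartesianDifferentialStructure F) (S : CoherentDifferentialStructure V) : Prop where
  add : ∀ {A B : F} (f g : A ⟶ B),
    haveI := 𝒟.homAdd
    f + g = (S.str B).sum f g (toUnit_unique _ _)
  zero : ∀ A B : F,
    haveI := 𝒟.homAdd
    (0 : A ⟶ B) = toUnit A ≫ (S.str B).zero
  D : ∀ {A B : F} (f : A ⟶ B),
    (S.str B).pair (𝒟.D f) (snd A A ≫ f) (toUnit_unique _ _) ≫ (S.str B).μ =
      (S.str A).pair (fst A A) (snd A A) (toUnit_unique _ _) ≫ (S.str A).μ ≫ V.T.map f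

end Coherent

/-! ### Differential fibrations -/

section DifferentialFibration

variable {E : Type u₁} [Category.{v₁} E] {B : Type u₂} [Category.{v₂} B]

/-- A tangent fibration (with a cleavage) is differential if each of its fibres, with the vertical
tangent structure, has coherent differential structure. -/
structure IsDifferentialTangentFibration (𝔼 : TangentStructure E) (𝔹 : TangentStructure B)
    (P : E ⥤ B) (κ : Cleavage P) : Prop extends IsTangentFibration 𝔼 𝔹 P where
  fibre : ∀ M : B, ∃ V : TangentStructure (P.Fiber M), IsVertical strict κ M V ∧
    HasCoherentDifferentialStructure V

variable {C : Type u} [Category.{v} C]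

/-- A tangent structure on display differential bundles is the pointwise one: `T` sends a bundle `q`
to `T(q)`, and on morphisms `T` and all the structure maps are computed on total objects and on
bases. -/
structure IsPointwise (X : DisplayTangentStructure C) (𝕋 : TangentStructure (DBun X)) : Prop where
  obj : ∀ q : DBun X, ∃ (s : DifferentialBundle X.toTangentStructure (X.T.map q.proj))
    (hs : X.𝒟 (X.T.map q.proj)), s.IsTangentOf q.str ∧ 𝕋.T.obj q = ⟨_, _, X.T.map q.proj, s, hs⟩
  base : IsStrictTangentMorphism 𝕋 X.toTangentStructure (DBun.P X)
  total : IsStrictTangentMorphism 𝕋 X.toTangentStructure (DBun.totalFunctor X)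

/-- A cleavage of `P : DBun_𝒟(X) ⥤ X` by linear morphisms: `f^* q` is the pullback of the bundle `q`
along `f`, with the lift (and hence the addition and the zero) of `q` pulled back. -/
def IsLinearCleavage {X : DisplayTangentStructure C} (κ : Cleavage (DBun.P X)) : Prop :=
  ∀ {N M : C} (f : N ⟶ M) (q : (DBun.P X).Fiber M), DBun.IsLinear (κ.map f q)

end DifferentialFibration

end

end TangentCat

open TangentCat

/-! Equations and limits are handled separately. Both tangent structures that have to be built, the
pointwise one on bundles and the vertical one on each fibre, are reflected along a faithful functor
`U` to the base category, equipped with a comparison `ι : U T ⟶ T U` such that `ι`, `T ι` and `T² ι`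
are monic (`PreTangent.Map.IsReflecting`). Every equational axiom may then be checked after `U`,
where it holds. For bundles `U` takes total objects and `ι` is an identity. For the fibre over `M`,
`ι` is the Cartesian arrow `T_M A ⟶ T A`, which is monic as a base change of the split monomorphism
`0_M`.

The limits of bundles come from one construction, `TransverseCospan`: a cospan of linear morphisms
whose total objects and bases have transverse pullbacks has a pullback which is again a display
differential bundle. Its projection is a display map by the apex axiom, its operations are
componentwise, and its lift is universal because linear maps commute with the maps `μ`, which are
monic. Pulling back along morphisms of trivial bundles gives substitution with linear Cartesian
arrows, pulling back over a trivial bundle gives the products of the fibres, and pulling back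
tangent projections, which are linear, gives the pullback powers of `p`. A morphism is Cartesian
exactly when its square is a pullback, and `T` preserves pullbacks along display maps, so `P` is a
tangent fibration.

In a fibre, universality of the lift of `A` says that `μ` identifies `T_M A` with `A × A`, the
projection `p` being the second factor (`isProduct_tProj`). Pullbacks along product projections
exist and are preserved by every product-preserving functor, which settles the limit conditions
there. Each bundle over `M` becomes a differential bundle over the final object of its fibre, its
lift being factored through `ι`. Linearity of the cleavage is what gives `λ_{T A} = T(λ_A) c`.

The last part works in any category with coherent differential structure. A tangent vector is
uniquely `vec v x = λ(v) + 0(x)`, and `D f` is the vector part of `T f`. The chain rule is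
functoriality of `T`, additivity is that of `T f`, and the two axioms on second derivatives are
naturality of `ell` and `flip`. The latter are computed on vectors of vectors, which is possible
because all structure maps are linear for the canonical lifts. -/

namespace TangentCat

noncomputable section

/-! ### Calculus of additive bundles -/

namespace AdditiveBundle

variable {C : Type u₁} [Category.{v₁} C] {B : Type u₂} [Category.{v₂} B]
  {E M : C} {q : E ⟶ M} (S : AdditiveBundle q)

@[simp]
theorem pair_π₀ {Z : C} (a b : Z ⟶ E) (h : a ≫ q = b ≫ q) : S.pair a b h ≫ S.π₀ = a :=
  S.isPullback.lift_fst a b h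

@[simp]
theorem pair_π₁ {Z : C} (a b : Z ⟶ E) (h : a ≫ q = b ≫ q) : S.pair a b h ≫ S.π₁ = b :=
  S.isPullback.lift_snd a b h

@[simp]
theorem pair_π₀_assoc {Z W : C} (a b : Z ⟶ E) (h : a ≫ q = b ≫ q) (k : E ⟶ W) :
    S.pair a b h ≫ S.π₀ ≫ k = a ≫ k := by
  rw [← Category.assoc, pair_π₀]

@[simp]
theorem pair_π₁_assoc {Z W : C} (a b : Z ⟶ E) (h : a ≫ q = b ≫ q) (k : E ⟶ W) :
    S.pair a b h ≫ S.π₁ ≫ k = b ≫ k := by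
  rw [← Category.assoc, pair_π₁]

theorem E₂_ext {Z : C} {x y : Z ⟶ S.E₂} (h₀ : x ≫ S.π₀ = y ≫ S.π₀)
    (h₁ : x ≫ S.π₁ = y ≫ S.π₁) : x = y :=
  S.isPullback.hom_ext h₀ h₁

theorem comp_pair {W Z : C} (f : W ⟶ Z) (a b : Z ⟶ E) (h : a ≫ q = b ≫ q) :
    f ≫ S.pair a b h = S.pair (f ≫ a) (f ≫ b) (by simp [h]) :=
  S.E₂_ext (by simp) (by simp)

theorem pair_congr {Z : C} {a b a' b' : Z ⟶ E} (ha : a = a') (hb : b = b') (h : a ≫ q = b ≫ q) :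
    S.pair a b h = S.pair a' b' (by rw [← ha, ← hb, h]) := by
  subst ha hb; rfl

theorem pair_π₀_π₁ : S.pair S.π₀ S.π₁ S.isPullback.w = 𝟙 _ :=
  S.E₂_ext (by simp) (by simp)

theorem sum_congr {Z : C} {a b a' b' : Z ⟶ E} (ha : a = a') (hb : b = b') (h : a ≫ q = b ≫ q) :
    S.sum a b h = S.sum a' b' (by rw [← ha, ← hb, h]) := by
  subst ha hb; rfl

theorem comp_sum' {W Z : C} (f : W ⟶ Z) (a b : Z ⟶ E) (h : a ≫ q = b ≫ q) :
    f ≫ S.sum a b h = S.sum (f ≫ a) (f ≫ b) (by simp [h]) :=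
  S.comp_sum f a b h _

theorem pair_σ {Z : C} (a b : Z ⟶ E) (h : a ≫ q = b ≫ q) : S.pair a b h ≫ S.σ = S.sum a b h :=
  rfl

theorem sum_π₀_π₁ : S.sum S.π₀ S.π₁ S.isPullback.w = S.σ := by
  rw [sum, pair_π₀_π₁, Category.id_comp]

theorem zero_sum {Z : C} (z : Z ⟶ M) (a : Z ⟶ E) (h : (z ≫ S.zero) ≫ q = a ≫ q) :
    S.sum (z ≫ S.zero) a h = a := by
  have := S.powers
  have hz : z = a ≫ q := by rw [← h, Category.assoc, S.zero_proj, Category.comp_id]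
  subst hz
  have := S.zero_add a
  rw [S.lift_add_eq_sum] at this
  simpa using this

theorem sum_comm {Z : C} (a b : Z ⟶ E) (h : a ≫ q = b ≫ q) :
    S.sum a b h = S.sum b a h.symm := by
  have := S.powers
  have := S.add_comm a b h
  rwa [S.lift_add_eq_sum, S.lift_add_eq_sum] at this

theorem sum_zero {Z : C} (z : Z ⟶ M) (a : Z ⟶ E) (h : a ≫ q = (z ≫ S.zero) ≫ q) :
    S.sum a (z ≫ S.zero) h = a := by
  rw [sum_comm, zero_sum]

theorem sum_assoc {Z : C} (a b c : Z ⟶ E) (h : a ≫ q = b ≫ q) (h' : b ≫ q = c ≫ q) :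
    S.sum (S.sum a b h) c ((S.sum_proj a b h).trans (h.trans h')) =
      S.sum a (S.sum b c h') (h.trans (S.sum_proj b c h').symm) := by
  have := S.powers
  have := S.add_assoc a b c h h'
  simpa only [S.lift_add_eq_sum] using this

/-- Middle-four interchange. It adds tangent vectors that are themselves sums, and it exchanges the
two middle terms under the flip. -/
theorem sum_sum_sum_comm {Z : C} (a b c d : Z ⟶ E) (hab : a ≫ q = b ≫ q) (hbc : b ≫ q = c ≫ q)
    (hcd : c ≫ q = d ≫ q) :
    S.sum (S.sum a b hab) (S.sum c d hcd) (by rw [sum_proj, sum_proj, hab, hbc]) =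
      S.sum (S.sum a c (hab.trans hbc)) (S.sum b d (hbc.trans hcd))
        (by rw [sum_proj, sum_proj, hab]) := by
  rw [S.sum_assoc a b (S.sum c d hcd) hab (by rw [sum_proj, hbc]),
    S.sum_assoc a c (S.sum b d (hbc.trans hcd)) (hab.trans hbc) (by rw [sum_proj, hbc])]
  refine S.sum_congr rfl ?_ _
  rw [← S.sum_assoc b c d hbc hcd, ← S.sum_assoc c b d hbc.symm (hbc.trans hcd)]
  exact S.sum_congr (S.sum_comm _ _ _) rfl _

section Map

variable (F : C ⥤ B) [hF : PreservesPullbackPowers F q]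

@[simp]
theorem mapPair_map_π₀ {Z : B} (a b : Z ⟶ F.obj E) (h : a ≫ F.map q = b ≫ F.map q) :
    S.mapPair F a b h ≫ F.map S.π₀ = a :=
  (S.isPullback_map F).lift_fst a b h

@[simp]
theorem mapPair_map_π₁ {Z : B} (a b : Z ⟶ F.obj E) (h : a ≫ F.map q = b ≫ F.map q) :
    S.mapPair F a b h ≫ F.map S.π₁ = b :=
  (S.isPullback_map F).lift_snd a b h

@[simp]
theorem mapPair_map_π₀_assoc {Z W : B} (a b : Z ⟶ F.obj E) (h : a ≫ F.map q = b ≫ F.map q)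
    (k : F.obj E ⟶ W) : S.mapPair F a b h ≫ F.map S.π₀ ≫ k = a ≫ k := by
  rw [← Category.assoc, mapPair_map_π₀]

@[simp]
theorem mapPair_map_π₁_assoc {Z W : B} (a b : Z ⟶ F.obj E) (h : a ≫ F.map q = b ≫ F.map q)
    (k : F.obj E ⟶ W) : S.mapPair F a b h ≫ F.map S.π₁ ≫ k = b ≫ k := by
  rw [← Category.assoc, mapPair_map_π₁]

theorem map_E₂_ext {Z : B} {x y : Z ⟶ F.obj S.E₂} (h₀ : x ≫ F.map S.π₀ = y ≫ F.map S.π₀)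
    (h₁ : x ≫ F.map S.π₁ = y ≫ F.map S.π₁) : x = y :=
  (S.isPullback_map F).hom_ext h₀ h₁

theorem map_sum {Z : B} (a b : Z ⟶ F.obj E) (h : a ≫ F.map q = b ≫ F.map q) :
    (S.map F).sum a b h = S.mapPair F a b h ≫ F.map S.σ := by
  change (S.map F).pair a b h ≫ S.mapPair F (S.map F).π₀ (S.map F).π₁ (S.map F).isPullback.w ≫
    F.map S.σ = _
  rw [← Category.assoc]
  congr 1
  apply S.map_E₂_ext F <;> simp

@[simp]
theorem map_zero : (S.map F).zero = F.map S.zero := rfl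

/-- The addition of `S.map F` can be evaluated inside `C` as soon as both summands factor through
the image of `F` along the same `x`. -/
theorem comp_map_sum {W : C} {Z : B} (x : Z ⟶ F.obj W) (a b : W ⟶ E) (h : a ≫ q = b ≫ q) :
    x ≫ F.map (S.sum a b h) = (S.map F).sum (x ≫ F.map a) (x ≫ F.map b)
      (by simp only [Category.assoc, ← F.map_comp, h]) := by
  rw [map_sum]
  exact (S.mapPair_map_σ F x a b h _ _ _ rfl rfl).symm

theorem map_map_sum {W : C} (a b : W ⟶ E) (h : a ≫ q = b ≫ q) :
    F.map (S.sum a b h) = (S.map F).sum (F.map a) (F.map b)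
      (by simp only [← F.map_comp, h]) := by
  have := S.comp_map_sum F (𝟙 _) a b h
  simpa using this

theorem map_map_σ : F.map S.σ = (S.map F).sum (F.map S.π₀) (F.map S.π₁)
    (by simp only [← F.map_comp, S.isPullback.w]) := by
  rw [← sum_π₀_π₁, map_map_sum]

end Map

/-- Evaluates `μ` on generalized elements as `λ(a) + 0(b)`, the sum being that of `T q`. Later
arguments about universality use this formula instead of the object `E₂`. -/
theorem pair_mu {C : Type u} [Category.{v} C] {E M : C} {q : E ⟶ M} (S : AdditiveBundle q)
    (T : C ⥤ C) [PreservesPullbackPowers T q] (l z : E ⟶ T.obj E)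
    (h : S.π₀ ≫ l ≫ T.map q = S.π₁ ≫ z ≫ T.map q) {Z : C} (a b : Z ⟶ E) (hab : a ≫ q = b ≫ q) :
    S.pair a b hab ≫ S.mu T l z h = (S.map T).sum (a ≫ l) (b ≫ z) (by
      have := congrArg (fun k => S.pair a b hab ≫ k) h
      simpa using this) := by
  rw [map_sum, mu, ← Category.assoc]
  congr 1
  apply S.map_E₂_ext T <;> simp

/-- An additive bundle structure on `q : E ⟶ M` reflected from additive bundles `S i`, through
functors `U i` and squares `(e i, b i)` for which the `e i` are jointly monic relative to `q`. -/
def ofJointlyMonic {D : Type u} [Category.{v} D] {E M : D} (q : E ⟶ M) [HasPullbackPowers q]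
    {I : Type} (U : I → D ⥤ C) {E' M' : I → C} {q' : ∀ i, E' i ⟶ M' i}
    (S : ∀ i, AdditiveBundle (q' i)) (e : ∀ i, (U i).obj E ⟶ E' i) (b : ∀ i, (U i).obj M ⟶ M' i)
    (comm : ∀ i, e i ≫ q' i = (U i).map q ≫ b i)
    (ext : ∀ {Z : D} (x y : Z ⟶ E), x ≫ q = y ≫ q →
      (∀ i, (U i).map x ≫ e i = (U i).map y ≫ e i) → x = y)
    (add : pullback q q ⟶ E) (zero : M ⟶ E)
    (add_proj : add ≫ q = pullback.fst q q ≫ q)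
    (zero_proj : zero ≫ q = 𝟙 M)
    (map_add : ∀ i, (U i).map add ≫ e i =
      (S i).sum ((U i).map (pullback.fst q q) ≫ e i) ((U i).map (pullback.snd q q) ≫ e i) (by
        simp only [Category.assoc, comm, ← Functor.map_comp_assoc, pullback.condition]))
    (map_zero : ∀ i, (U i).map zero ≫ e i = b i ≫ (S i).zero) : AdditiveBundle q :=
  have hU : ∀ (i : I) {Z : D} (x y : Z ⟶ E), x ≫ q = y ≫ q →
      ((U i).map x ≫ e i) ≫ q' i = ((U i).map y ≫ e i) ≫ q' i := fun i Z x y h => by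
    simp only [Category.assoc, comm, ← Functor.map_comp_assoc, h]
  -- Seen through `U i` and `e i`, the candidate sum is the sum of `S i`. Each law relates two maps
  -- with the same projection, so `ext` transfers it from the `S i`.
  have key : ∀ (i : I) {Z : D} (x y : Z ⟶ E) (h : x ≫ q = y ≫ q),
      (U i).map (pullback.lift x y h ≫ add) ≫ e i =
        (S i).sum ((U i).map x ≫ e i) ((U i).map y ≫ e i) (hU i x y h) := fun i Z x y h => by
    rw [Functor.map_comp, Category.assoc, map_add, comp_sum']
    refine (S i).sum_congr ?_ ?_ _
    · rw [← Category.assoc, ← Functor.map_comp, pullback.lift_fst]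
    · rw [← Category.assoc, ← Functor.map_comp, pullback.lift_snd]
  have proj : ∀ {Z : D} (x y : Z ⟶ E) (h : x ≫ q = y ≫ q),
      (pullback.lift x y h ≫ add) ≫ q = x ≫ q := fun x y h => by
    rw [Category.assoc, add_proj, pullback.lift_fst_assoc]
  { add := add
    zero := zero
    add_proj := add_proj
    zero_proj := zero_proj
    zero_add := fun a => ext _ _ (by rw [proj]; simp [zero_proj]) fun i => by
      rw [key]
      refine ((S i).sum_congr (a' := (U i).map (a ≫ q) ≫ b i ≫ (S i).zero) ?_ rfl _).trans ?_
      · simp [map_zero]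
      · simp only [← Category.assoc]
        exact (S i).zero_sum _ _ _
    add_comm := fun a b h => ext _ _ (by rw [proj, proj, h]) fun i => by
      rw [key, key, sum_comm]
    add_assoc := fun a b c h h' => ext _ _ (by rw [proj, proj, proj]) fun i => by
      refine (key i (pullback.lift a b h ≫ add) c (by rw [proj, h, h'])).trans
        (Eq.trans ?_ (key i a (pullback.lift b c h' ≫ add) (by rw [proj, h])).symm)
      exact ((S i).sum_congr (key _ _ _ _) rfl _).trans
        (((S i).sum_assoc _ _ _ (hU i a b h) (hU i b c h')).trans
          ((S i).sum_congr rfl (key _ _ _ _) _).symm) }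

end AdditiveBundle

/-! ### Additive morphisms on generalized elements -/

namespace IsAdditiveMorphism

variable {C : Type u} [Category.{v} C] {B : Type u₂} [Category.{v} B]
  {E M E' M' E'' M'' : C} {q : E ⟶ M} {q' : E' ⟶ M'} {q'' : E'' ⟶ M''}
  {S : AdditiveBundle q} {S' : AdditiveBundle q'} {S'' : AdditiveBundle q''}
  {e : E ⟶ E'} {b : M ⟶ M'} {e' : E' ⟶ E''} {b' : M' ⟶ M''}

theorem comm_of_comm (h : e ≫ q' = q ≫ b) {Z : C} {x y : Z ⟶ E} (hxy : x ≫ q = y ≫ q) :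
    (x ≫ e) ≫ q' = (y ≫ e) ≫ q' := by
  rw [Category.assoc, h, ← Category.assoc, hxy, Category.assoc, Category.assoc, h]

theorem sum_comp (h : IsAdditiveMorphism S S' e b) {Z : C} (x y : Z ⟶ E) (hxy : x ≫ q = y ≫ q) :
    S.sum x y hxy ≫ e = S'.sum (x ≫ e) (y ≫ e) (comm_of_comm h.comm hxy) := by
  rw [AdditiveBundle.sum, Category.assoc, h.add, AdditiveBundle.pair_σ, S'.comp_sum']
  exact S'.sum_congr (by simp) (by simp) _

theorem of_sum (comm : e ≫ q' = q ≫ b)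
    (add : S.σ ≫ e = S'.sum (S.π₀ ≫ e) (S.π₁ ≫ e) (comm_of_comm comm S.isPullback.w))
    (zero : S.zero ≫ e = b ≫ S'.zero) : IsAdditiveMorphism S S' e b :=
  ⟨comm, add, zero⟩

theorem comp (h : IsAdditiveMorphism S S' e b) (h' : IsAdditiveMorphism S' S'' e' b') :
    IsAdditiveMorphism S S'' (e ≫ e') (b ≫ b') := by
  refine of_sum (by rw [Category.assoc, h'.comm, ← Category.assoc, h.comm, Category.assoc]) ?_
    (by rw [← Category.assoc, h.zero, Category.assoc, h'.zero, Category.assoc])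
  rw [← Category.assoc, h.add, AdditiveBundle.pair_σ, h'.sum_comp]
  exact S''.sum_congr (by simp) (by simp) _

theorem map (h : IsAdditiveMorphism S S' e b) (F : C ⥤ B) [PreservesPullbackPowers F q]
    [PreservesPullbackPowers F q'] :
    IsAdditiveMorphism (S.map F) (S'.map F) (F.map e) (F.map b) := by
  refine of_sum (by simp only [← F.map_comp, h.comm]) ?_
    (by simp only [AdditiveBundle.map_zero, ← F.map_comp, h.zero])
  rw [← (S.map F).sum_π₀_π₁, AdditiveBundle.map_sum, Category.assoc, ← F.map_comp, h.add,
    AdditiveBundle.pair_σ, AdditiveBundle.comp_map_sum]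
  exact (S'.map F).sum_congr (by simp) (by simp) _

end IsAdditiveMorphism


/-! ### Recognizing pullback powers -/

section Power

variable {C : Type u₁} [Category.{v₁} C] {B : Type u₂} [Category.{v₂} B]

/-- `w : W ⟶ M`, with the projections `π i : W ⟶ E`, is the `n`-fold pullback power of
`p : E ⟶ M`. -/
structure IsPower {E M : C} (p : E ⟶ M) {n : ℕ} {W : C} (w : W ⟶ M) (π : Fin n → (W ⟶ E)) :
    Prop where
  comm : ∀ i, π i ≫ p = w
  existsUnique : ∀ {Z : C} (z : Z ⟶ M) (a : Fin n → (Z ⟶ E)), (∀ i, a i ≫ p = z) →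
    ∃! l : Z ⟶ W, l ≫ w = z ∧ ∀ i, l ≫ π i = a i

namespace IsPower

variable {E M : C} {p : E ⟶ M} {n : ℕ} {W : C} {w : W ⟶ M} {π : Fin n → (W ⟶ E)}

theorem hom_ext (h : IsPower p w π) {Z : C} {x y : Z ⟶ W} (hw : x ≫ w = y ≫ w)
    (hπ : ∀ i, x ≫ π i = y ≫ π i) : x = y :=
  (h.existsUnique (y ≫ w) (fun i => y ≫ π i) (fun i => by rw [Category.assoc, h.comm])).unique
    ⟨hw, hπ⟩ ⟨rfl, fun _ => rfl⟩

theorem congr (h : IsPower p w π) {w' : W ⟶ M} {π' : Fin n → (W ⟶ E)} (hw : w = w')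
    (hπ : ∀ i, π i = π' i) : IsPower p w' π' := by
  obtain rfl : π = π' := funext hπ
  exact hw ▸ h

theorem of_iso (h : IsPower p w π) {E' M' W' : C} {p' : E' ⟶ M'} {w' : W' ⟶ M'}
    {π' : Fin n → (W' ⟶ E')} (eE : E ≅ E') (eM : M ≅ M') (eW : W ≅ W')
    (hp : p ≫ eM.hom = eE.hom ≫ p') (hw : w ≫ eM.hom = eW.hom ≫ w')
    (hπ : ∀ i, π i ≫ eE.hom = eW.hom ≫ π' i) : IsPower p' w' π' := by
  have hp' : p' ≫ eM.inv = eE.inv ≫ p := by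
    rw [Iso.comp_inv_eq, Category.assoc, hp, Iso.inv_hom_id_assoc]
  have hw' : ∀ {Z : C} (l : Z ⟶ W), (l ≫ eW.hom) ≫ w' = (l ≫ w) ≫ eM.hom := fun l => by
    rw [Category.assoc, ← hw, Category.assoc]
  have hπ' : ∀ {Z : C} (l : Z ⟶ W) (i), (l ≫ eW.hom) ≫ π' i = (l ≫ π i) ≫ eE.hom :=
    fun l i => by rw [Category.assoc, ← hπ, Category.assoc]
  refine ⟨fun i => ?_, fun {Z} z a ha => ?_⟩
  · rw [← cancel_epi eW.hom, ← Category.assoc, ← hπ, Category.assoc, ← hp, ← Category.assoc,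
      h.comm, hw]
  · obtain ⟨l, ⟨hl, hl'⟩, -⟩ := h.existsUnique (z ≫ eM.inv) (fun i => a i ≫ eE.inv) fun i => by
      rw [Category.assoc, ← hp', ← Category.assoc, ha]
    refine ⟨l ≫ eW.hom, ⟨by rw [hw', hl]; simp, fun i => by rw [hπ', hl']; simp⟩, ?_⟩
    rintro m ⟨hm, hm'⟩
    rw [← Iso.comp_inv_eq]
    have e : m = (m ≫ eW.inv) ≫ eW.hom := by simp
    apply h.hom_ext
    · rw [← cancel_mono eM.hom, ← hw', ← e, hm, hl]; simp
    · intro i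
      rw [← cancel_mono eE.hom, ← hπ', ← e, hm', hl']; simp

theorem isoOver (h : IsPower p w π) {W' : C} {w' : W' ⟶ M} {π' : Fin n → (W' ⟶ E)}
    (h' : IsPower p w' π') : ∃ e : W ≅ W', e.hom ≫ w' = w := by
  obtain ⟨l, ⟨hl, hl'⟩, -⟩ := h'.existsUnique w π h.comm
  obtain ⟨m, ⟨hm, hm'⟩, -⟩ := h.existsUnique w' π' h'.comm
  exact ⟨⟨l, m, h.hom_ext (by simp [hl, hm]) (by simp [hl', hm']),
    h'.hom_ext (by simp [hl, hm]) (by simp [hl', hm'])⟩, hl⟩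

/-- A pullback power is a limit. -/
def isLimit (h : IsPower p w π) : IsLimit (WidePullbackShape.mkCone (F := powerDiagram p n) w π
    h.comm) where
  lift s := (h.existsUnique (s.π.app none) (fun i => s.π.app (some i))
    (fun i => s.w (WidePullbackShape.Hom.term i))).choose
  fac s j := by
    have := (h.existsUnique (s.π.app none) (fun i => s.π.app (some i))
      (fun i => s.w (WidePullbackShape.Hom.term i))).choose_spec.1
    rcases j with _ | j
    · exact this.1
    · exact this.2 j
  uniq s m hm := by
    have := (h.existsUnique (s.π.app none) (fun i => s.π.app (some i))
      (fun i => s.w (WidePullbackShape.Hom.term i))).choose_spec.1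
    exact h.hom_ext ((hm none).trans this.1.symm) fun i => (hm (some i)).trans (this.2 i).symm

theorem hasLimit (h : IsPower p w π) : HasLimit (powerDiagram p n) :=
  ⟨⟨⟨_, h.isLimit⟩⟩⟩

theorem preservesLimit (h : IsPower p w π) (F : C ⥤ B)
    (hF : IsPower (F.map p) (F.map w) (fun i => F.map (π i))) :
    PreservesLimit (powerDiagram p n) F := by
  have key : ∀ s : Cone (powerDiagram p n ⋙ F),
      ∃! l, l ≫ F.map w = s.π.app none ∧ ∀ i, l ≫ F.map (π i) = s.π.app (some i) := fun s =>
    hF.existsUnique (s.π.app none) (fun i => s.π.app (some i))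
      (fun i => s.w (WidePullbackShape.Hom.term i))
  refine preservesLimit_of_preserves_limit_cone h.isLimit
    ⟨fun s => (key s).choose, fun s j => ?_, fun s m hm => ?_⟩
  · rcases j with _ | j
    · exact (key s).choose_spec.1.1
    · exact (key s).choose_spec.1.2 j
  · exact (key s).choose_spec.2 m ⟨hm none, fun i => hm (some i)⟩

theorem map (h : IsPower p w π) (F : C ⥤ B) [hF : PreservesPullbackPowers F p] :
    IsPower (F.map p) (F.map w) (fun i => F.map (π i)) := by
  have := hF.preserves n
  have hl := isLimitOfPreserves F h.isLimit
  refine ⟨fun i => by rw [← F.map_comp, h.comm], fun {Z} z a ha => ?_⟩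
  let cn : Cone (powerDiagram p n ⋙ F) := WidePullbackShape.mkCone z a ha
  refine ⟨hl.lift cn, ⟨hl.fac cn none, fun i => hl.fac cn (some i)⟩, ?_⟩
  rintro m ⟨hm, hm'⟩
  refine hl.uniq cn m ?_
  rintro (_ | j)
  · exact hm
  · exact hm' j

theorem zero (p : E ⟶ M) (π : Fin 0 → (M ⟶ E)) : IsPower p (𝟙 M) π :=
  ⟨fun i => i.elim0, fun z _ _ => ⟨z, ⟨Category.comp_id z, fun i => i.elim0⟩,
    fun m hm => by rw [← hm.1, Category.comp_id]⟩⟩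

/-- A power with one more factor is the base change of `p` along the previous power. This is the
induction step that reduces all powers to pullbacks along `p`. -/
theorem succ (h : IsPower p w π) {W' : C} {a : W' ⟶ E} {b : W' ⟶ W} (hp : IsPullback a b p w) :
    IsPower p (b ≫ w) (Fin.cons a (fun i => b ≫ π i) : Fin (n + 1) → (W' ⟶ E)) := by
  refine ⟨fun i => ?_, fun {Z} z c hc => ?_⟩
  · refine Fin.cases ?_ (fun j => ?_) i
    · exact hp.w
    · simp [h.comm]
  · obtain ⟨l, ⟨hl, hl'⟩, -⟩ := h.existsUnique z (fun i => c i.succ) (fun i => hc i.succ)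
    refine ⟨hp.lift (c 0) l ((hc 0).trans hl.symm), ⟨by simp [hl], fun i => ?_⟩, ?_⟩
    · refine Fin.cases ?_ (fun j => ?_) i
      · simp
      · simp [hl']
    · rintro m ⟨hm, hm'⟩
      apply hp.hom_ext
      · simpa using hm' 0
      · apply h.hom_ext
        · simp [hm, hl]
        · intro i
          simpa [hl'] using hm' i.succ

end IsPower

/-- `F` preserves the pullbacks along `p`, all of which exist. -/
def PreservesPullbacksAlong (F : C ⥤ B) {E M : C} (p : E ⟶ M) : Prop :=
  ∀ (Z : C) (g : Z ⟶ M), ∃ (P : C) (a : P ⟶ E) (b : P ⟶ Z), IsPullback a b p g ∧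
    IsPullback (F.map a) (F.map b) (F.map p) (F.map g)

namespace PreservesPullbacksAlong

variable {F : C ⥤ B} {E M : C} {p : E ⟶ M}

/-- The power and its image under `F` are built together, one pullback along `p` at a time, so that
a single induction yields existence and preservation. -/
theorem exists_isPower (h : PreservesPullbacksAlong F p) (n : ℕ) :
    ∃ (W : C) (w : W ⟶ M) (π : Fin n → (W ⟶ E)), IsPower p w π ∧
      IsPower (F.map p) (F.map w) (fun i => F.map (π i)) := by
  induction n with
  | zero =>
    exact ⟨M, 𝟙 M, fun i => i.elim0, IsPower.zero _ _,
      (IsPower.zero (F.map p) (fun i => i.elim0)).congr (F.map_id M).symm fun i => i.elim0⟩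
  | succ n ih =>
    obtain ⟨W, w, π, hw, hFw⟩ := ih
    obtain ⟨P, a, b, hP, hFP⟩ := h W w
    refine ⟨P, _, _, hw.succ hP, (hFw.succ hFP).congr (F.map_comp _ _).symm fun i => ?_⟩
    refine Fin.cases ?_ (fun j => ?_) i <;> simp

theorem hasPullbackPowers (h : PreservesPullbacksAlong F p) : HasPullbackPowers p :=
  ⟨fun n => by
    obtain ⟨W, w, π, hw, -⟩ := h.exists_isPower n
    exact hw.hasLimit⟩

theorem preservesPullbackPowers (h : PreservesPullbacksAlong F p) : PreservesPullbackPowers F p :=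
  ⟨fun n => by
    obtain ⟨W, w, π, hw, hFw⟩ := h.exists_isPower n
    exact hw.preservesLimit F hFw⟩

end PreservesPullbacksAlong

/-- Compatible functors remain compatible with iterated endofunctors. -/
def iterIso {F : Type u₁} [Category.{v₁} F] (T' : F ⥤ F) {D : Type u₂} [Category.{v₂} D]
    (T : D ⥤ D) (U : F ⥤ D) (ι : T' ⋙ U ≅ U ⋙ T) : ∀ k : ℕ, iter T' k ⋙ U ≅ U ⋙ iter T k
  | 0 => Iso.refl _
  | k + 1 => Functor.isoWhiskerLeft (iter T' k) ι ≪≫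
      Functor.isoWhiskerRight (iterIso T' T U ι k) T

theorem isPullback_of_natIso {F G : C ⥤ B} (α : F ≅ G) {P X Y Z : C} {f : P ⟶ X} {g : P ⟶ Y}
    {h : X ⟶ Z} {k : Y ⟶ Z} (sq : IsPullback (F.map f) (F.map g) (F.map h) (F.map k)) :
    IsPullback (G.map f) (G.map g) (G.map h) (G.map k) :=
  sq.of_iso (α.app P) (α.app X) (α.app Y) (α.app Z) (by simp) (by simp) (by simp) (by simp)

theorem IsPower.of_natIso {F G : C ⥤ B} (α : F ≅ G) {E M W : C} {p : E ⟶ M} {n : ℕ} {w : W ⟶ M}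
    {π : Fin n → (W ⟶ E)} (h : IsPower (F.map p) (F.map w) (fun i => F.map (π i))) :
    IsPower (G.map p) (G.map w) (fun i => G.map (π i)) :=
  h.of_iso (α.app E) (α.app M) (α.app W) (by simp) (by simp) (by simp)

end Power

/-! ### Transverse squares -/

section Square

variable {C : Type u} [Category.{v} C]

/-- The meet and the join are free vertices with propositional equations, so the square can be read
at vertices that are not literally of the form `x ⊓ y` and `x ⊔ y`. -/
theorem IsPullbackPreserving.isPullback {n : ℕ} {F : Cube n ⥤ C} (hF : IsPullbackPreserving F)
    {x y z w : Cube n} (hzx : z ≤ x) (hzy : z ≤ y) (hxw : x ≤ w) (hyw : y ≤ w)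
    (hz : x ⊓ y = z) (hw : x ⊔ y = w) :
    IsPullback (F.map (homOfLE hzx)) (F.map (homOfLE hzy)) (F.map (homOfLE hxw))
      (F.map (homOfLE hyw)) := by
  subst hz hw
  exact hF x y

theorem leg_inf_leg : leg (0 : Fin 2) ⊓ leg 1 = (⊥ : Cube 2) := by
  funext i; fin_cases i <;> rfl

theorem leg_sup_leg : leg (0 : Fin 2) ⊔ leg 1 = (⊤ : Cube 2) := by
  funext i; fin_cases i <;> rfl

namespace TransverseSystem

variable {𝒬 : TransverseSystem C} {P X Y Z : C} {f : P ⟶ X} {g : P ⟶ Y} {h : X ⟶ Z} {k : Y ⟶ Z}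

theorem Square.of_iso (s : 𝒬.Square f g h k) {P' X' Y' Z' : C} {f' : P' ⟶ X'} {g' : P' ⟶ Y'}
    {h' : X' ⟶ Z'} {k' : Y' ⟶ Z'} (eP : P ≅ P') (eX : X ≅ X') (eY : Y ≅ Y') (eZ : Z ≅ Z')
    (hf : f ≫ eX.hom = eP.hom ≫ f') (hg : g ≫ eY.hom = eP.hom ≫ g')
    (hh : h ≫ eZ.hom = eX.hom ≫ h') (hk : k ≫ eZ.hom = eY.hom ≫ k') :
    𝒬.Square f' g' h' k' := by
  obtain ⟨F, hF, iP, iX, iY, iZ, e₁, e₂, e₃, e₄⟩ := s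
  refine ⟨F, hF, iP ≪≫ eP, iX ≪≫ eX, iY ≪≫ eY, iZ ≪≫ eZ, ?_, ?_, ?_, ?_⟩
  · simp only [Iso.trans_hom, ← Category.assoc, e₁]; simp only [Category.assoc, hf]
  · simp only [Iso.trans_hom, ← Category.assoc, e₂]; simp only [Category.assoc, hg]
  · simp only [Iso.trans_hom, ← Category.assoc, e₃]; simp only [Category.assoc, hh]
  · simp only [Iso.trans_hom, ← Category.assoc, e₄]; simp only [Category.assoc, hk]

theorem Square.isPullback (s : 𝒬.Square f g h k) : IsPullback f g h k := by
  obtain ⟨F, hF, iP, iX, iY, iZ, e₁, e₂, e₃, e₄⟩ := s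
  exact ((𝒬.isPullbackPreserving F hF).isPullback bot_le bot_le le_top le_top leg_inf_leg
    leg_sup_leg).of_iso iP iX iY iZ e₁ e₂ e₃ e₄

theorem Square.of_isPullback (s : 𝒬.Square f g h k) {P' : C} {f' : P' ⟶ X} {g' : P' ⟶ Y}
    (hp : IsPullback f' g' h k) : 𝒬.Square f' g' h k :=
  s.of_iso (s.isPullback.isoIsPullback _ _ hp) (Iso.refl _) (Iso.refl _) (Iso.refl _)
    (by simp) (by simp) (by simp) (by simp)

/-- Extracts a transverse square from a higher cube. The images of the four corners under `r` are
variables, since in the applications they are only computed propositionally. -/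
theorem square_reindex {m : ℕ} (r : LatticeHom (Cube 2) (Cube m)) {F : Cube m ⥤ C}
    (hF : 𝒬.mem F) {x y z w : Cube m} (hz : r ⊥ = z) (hx : r (leg 0) = x) (hy : r (leg 1) = y)
    (hw : r ⊤ = w) (hzx : z ≤ x) (hzy : z ≤ y) (hxw : x ≤ w) (hyw : y ≤ w) :
    𝒬.Square (F.map (homOfLE hzx)) (F.map (homOfLE hzy)) (F.map (homOfLE hxw))
      (F.map (homOfLE hyw)) := by
  subst hz hx hy hw
  exact ⟨_, 𝒬.reindex r F hF, Iso.refl _, Iso.refl _, Iso.refl _, Iso.refl _,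
    (Category.comp_id _).trans (Category.id_comp _).symm,
    (Category.comp_id _).trans (Category.id_comp _).symm,
    (Category.comp_id _).trans (Category.id_comp _).symm,
    (Category.comp_id _).trans (Category.id_comp _).symm⟩

theorem Square.flip (s : 𝒬.Square f g h k) : 𝒬.Square g f k h := by
  obtain ⟨F, hF, iP, iX, iY, iZ, e₁, e₂, e₃, e₄⟩ := s
  -- Exchanging the two coordinates is a lattice homomorphism, and transverses are closed under
  -- reindexing along it.
  let r : LatticeHom (Cube 2) (Cube 2) :=
    { toFun := fun w i => w (Equiv.swap 0 1 i)
      map_sup' := fun _ _ => rfl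
      map_inf' := fun _ _ => rfl }
  have r₀ : r (leg 0) = leg 1 := by funext i; fin_cases i <;> rfl
  have r₁ : r (leg 1) = leg 0 := by funext i; fin_cases i <;> rfl
  exact (square_reindex r hF (rfl : _ = ⊥) r₀ r₁ (rfl : _ = ⊤) bot_le bot_le le_top le_top).of_iso
    iP iY iX iZ e₂ e₁ e₄ e₃

end TransverseSystem

end Square


/-! ### Display maps -/

section Cube

variable {C : Type u} [Category.{v} C]

/-- The vertices of `𝟐²`. -/
def vertex : Bool → Bool → Cube 2
  | false, false => ⊥
  | false, true => leg 0
  | true, false => leg 1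
  | true, true => ⊤

theorem vertex_apply (x : Cube 2) : vertex (x 0) (x 1) = x := by
  funext i
  rcases h₀ : x 0 <;> rcases h₁ : x 1 <;> fin_cases i <;>
    first | exact h₀.symm | exact h₁.symm

theorem vertex_le (a b a' b' : Bool) : vertex a b ≤ vertex a' b' ↔ a ≤ a' ∧ b ≤ b' := by
  have h : ∀ a b : Bool, vertex a b 0 = a ∧ vertex a b 1 = b := by
    intro a b
    cases a <;> cases b <;> exact ⟨rfl, rfl⟩
  constructor
  · intro hl
    have h₀ := hl 0
    have h₁ := hl 1
    rw [(h a b).1, (h a' b').1] at h₀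
    rw [(h a b).2, (h a' b').2] at h₁
    exact ⟨h₀, h₁⟩
  · rintro ⟨h₀, h₁⟩ i
    fin_cases i
    · exact (h a b).1.trans_le (h₀.trans_eq (h a' b').1.symm)
    · exact (h a b).2.trans_le (h₁.trans_eq (h a' b').2.symm)

theorem exists_cube_natTrans {F G : Cube 2 ⥤ C} (t : F.obj ⊥ ⟶ G.obj ⊥)
    (t₀ : F.obj (leg 0) ⟶ G.obj (leg 0)) (t₁ : F.obj (leg 1) ⟶ G.obj (leg 1))
    (t' : F.obj ⊤ ⟶ G.obj ⊤)
    (h₀ : F.map (homOfLE bot_le) ≫ t₀ = t ≫ G.map (homOfLE bot_le))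
    (h₁ : F.map (homOfLE bot_le) ≫ t₁ = t ≫ G.map (homOfLE bot_le))
    (h₂ : F.map (homOfLE le_top) ≫ t' = t₀ ≫ G.map (homOfLE le_top))
    (h₃ : F.map (homOfLE le_top) ≫ t' = t₁ ≫ G.map (homOfLE le_top)) :
    ∃ α : F ⟶ G, α.app ⊥ = t ∧ α.app (leg 0) = t₀ ∧ α.app (leg 1) = t₁ ∧ α.app ⊤ = t' := by
  let τ : ∀ a b : Bool, F.obj (vertex a b) ⟶ G.obj (vertex a b) := fun a b =>
    match a, b with
    | false, false => t
    | false, true => t₀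
    | true, false => t₁
    | true, true => t'
  have hid : ∀ {K : Cube 2 ⥤ C} {x : Cube 2} (h : x ≤ x), K.map (homOfLE h) = 𝟙 _ :=
    fun {K x} h => K.map_id x
  have hτ : ∀ (a b a' b' : Bool) (h : vertex a b ≤ vertex a' b'),
      F.map (homOfLE h) ≫ τ a' b' = τ a b ≫ G.map (homOfLE h) := by
    have h₄ : F.map (homOfLE bot_le) ≫ t' = t ≫ G.map (homOfLE (bot_le : (⊥ : Cube 2) ≤ ⊤)) := by
      have e : ∀ K : Cube 2 ⥤ C, K.map (homOfLE (bot_le : (⊥ : Cube 2) ≤ ⊤)) =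
          K.map (homOfLE (bot_le : ⊥ ≤ leg 0)) ≫ K.map (homOfLE le_top) := fun K => by
        rw [← K.map_comp]; rfl
      rw [e, e, Category.assoc, h₂, ← Category.assoc, h₀, Category.assoc]
    intro a b a' b' h
    obtain ⟨ha, hb⟩ := (vertex_le a b a' b').1 h
    cases a <;> cases b <;> cases a' <;> cases b' <;>
      first
      | exact absurd ha (by decide)
      | exact absurd hb (by decide)
      | exact h₀
      | exact h₁
      | exact h₂
      | exact h₃
      | exact h₄
      | (rw [hid, hid, Category.id_comp, Category.comp_id])
  have hv : ∀ x : Cube 2, x ≤ vertex (x 0) (x 1) := fun x => (vertex_apply x).ge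
  have hv' : ∀ x : Cube 2, vertex (x 0) (x 1) ≤ x := fun x => (vertex_apply x).le
  have hvv : ∀ {x y : Cube 2}, x ≤ y → vertex (x 0) (x 1) ≤ vertex (y 0) (y 1) :=
    fun {x y} h => (hv' x).trans (h.trans (hv y))
  have hc : ∀ {K : Cube 2 ⥤ C} {x y z : Cube 2} (h : x ≤ y) (h' : y ≤ z),
      K.map (homOfLE h) ≫ K.map (homOfLE h') = K.map (homOfLE (h.trans h')) :=
    fun {K x y z} h h' => (K.map_comp _ _).symm
  -- A vertex `x` is only propositionally equal to `vertex (x 0) (x 1)`, so `τ` is composed with the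
  -- images of the two inequalities between them, which replaces a cast.
  let α : F ⟶ G :=
    { app := fun x => F.map (homOfLE (hv x)) ≫ τ (x 0) (x 1) ≫ G.map (homOfLE (hv' x))
      naturality := fun x y φ => by
        rw [show φ = homOfLE φ.le from rfl]
        have e := hτ _ _ _ _ (hvv φ.le)
        calc F.map (homOfLE φ.le) ≫ F.map (homOfLE (hv y)) ≫ τ (y 0) (y 1) ≫ G.map (homOfLE (hv' y))
            = F.map (homOfLE (hv x)) ≫ (F.map (homOfLE (hvv φ.le)) ≫ τ (y 0) (y 1)) ≫
                G.map (homOfLE (hv' y)) := by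
              simp only [← Category.assoc, hc]
          _ = _ := by
              rw [e]
              simp only [Category.assoc, hc] }
  have hα : ∀ a b : Bool, α.app (vertex a b) = τ a b := by
    intro a b
    cases a <;> cases b <;>
      exact (congrArg₂ (fun m n => m ≫ _ ≫ n) (hid _) (hid _)).trans
        ((Category.id_comp _).trans (Category.comp_id _))
  exact ⟨α, hα false false, hα false true, hα true false, hα true true⟩

end Cube

variable {C : Type u} [Category.{v} C] (X : DisplayTangentStructure C)

namespace DisplayTangentStructure

theorem respectsIso : X.𝒟.RespectsIso :=
  have := X.display_baseChange
  inferInstance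

variable {X}

/-- The apex axiom for `n = 2`, moved along the isomorphisms hidden in `Square`. Away from the apex
only the three vertices carrying `a`, `b` and `m` remain. -/
theorem display_of_square {P A B M P' A' B' M' : C} {f : P ⟶ A} {g : P ⟶ B} {h : A ⟶ M}
    {k : B ⟶ M} {f' : P' ⟶ A'} {g' : P' ⟶ B'} {h' : A' ⟶ M'} {k' : B' ⟶ M'}
    (s : X.𝒬.Square f g h k) (s' : X.𝒬.Square f' g' h' k') {t : P ⟶ P'} {a : A ⟶ A'}
    {b : B ⟶ B'} {m : M ⟶ M'} (hf : f ≫ a = t ≫ f') (hg : g ≫ b = t ≫ g')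
    (hh : h ≫ m = a ≫ h') (hk : k ≫ m = b ≫ k') (ha : X.𝒟 a) (hb : X.𝒟 b) (hm : X.𝒟 m) :
    X.𝒟 t := by
  have := X.respectsIso
  obtain ⟨F, hF, iP, iX, iY, iZ, e₁, e₂, e₃, e₄⟩ := s
  obtain ⟨G, hG, jP, jX, jY, jZ, d₁, d₂, d₃, d₄⟩ := s'
  have key : ∀ {A₁ A₂ B₁ B₂ A₁' A₂' B₁' B₂' : C} (i : A₁ ≅ A₂) (j : B₁ ≅ B₂) (i' : A₁' ≅ A₂')
      (j' : B₁' ≅ B₂') {r : A₁ ⟶ B₁} {w : A₂ ⟶ B₂} {r' : A₁' ⟶ B₁'} {w' : A₂' ⟶ B₂'}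
      {y : A₂ ⟶ A₂'} {z : B₂ ⟶ B₂'}, r ≫ j.hom = i.hom ≫ w → r' ≫ j'.hom = i'.hom ≫ w' →
      w ≫ z = y ≫ w' → r ≫ j.hom ≫ z ≫ j'.inv = (i.hom ≫ y ≫ i'.inv) ≫ r' := by
    intro A₁ A₂ B₁ B₂ A₁' A₂' B₁' B₂' i j i' j' r w r' w' y z h₁ h₂ h₃
    have h₂' : i'.inv ≫ r' = w' ≫ j'.inv := by
      rw [Iso.inv_comp_eq, ← Category.assoc, ← h₂]; simp
    rw [← Category.assoc, h₁]
    simp only [Category.assoc, h₂']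
    rw [← Category.assoc w, h₃, Category.assoc]
  obtain ⟨α, h₁, h₂, h₃, h₄⟩ := exists_cube_natTrans (F := F) (G := G) (iP.hom ≫ t ≫ jP.inv)
    (iX.hom ≫ a ≫ jX.inv) (iY.hom ≫ b ≫ jY.inv) (iZ.hom ≫ m ≫ jZ.inv)
    (key iP iX jP jX e₁ d₁ hf) (key iP iY jP jY e₂ d₂ hg)
    (key iX iZ jX jZ e₃ d₃ hh) (key iY iZ jY jZ e₄ d₄ hk)
  -- Display maps are stable under base change, hence under composition with isomorphisms on either
  -- side.
  have hD : ∀ {A₁ B₁ A₂ B₂ : C} (i : A₁ ≅ A₂) (j : B₁ ≅ B₂) (y : A₂ ⟶ B₂),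
      X.𝒟 (i.hom ≫ y ≫ j.inv) ↔ X.𝒟 y := fun i j y => by
    rw [X.𝒟.cancel_left_of_respectsIso, X.𝒟.cancel_right_of_respectsIso]
  rw [← hD iP jP, ← h₁]
  refine X.display_apex le_rfl hF hG α fun x hx => ?_
  rw [← vertex_apply x] at hx ⊢
  generalize x 0 = c, x 1 = d at hx ⊢
  rcases c <;> rcases d
  · exact (hx rfl).elim
  · exact h₂ ▸ (hD iX jX a).2 ha
  · exact h₃ ▸ (hD iY jY b).2 hb
  · exact h₄ ▸ (hD iZ jZ m).2 hm

theorem iter_mem {n : ℕ} {F : Cube n ⥤ C} (hF : X.𝒬.mem F) (k : ℕ) :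
    X.𝒬.mem (F ⋙ iter X.T k) := by
  induction k with
  | zero => exact hF
  | succ k ih => exact X.map_transverse _ ih

theorem square_iter {P A B M : C} {f : P ⟶ A} {g : P ⟶ B} {h : A ⟶ M} {k : B ⟶ M}
    (s : X.𝒬.Square f g h k) (n : ℕ) : X.𝒬.Square ((iter X.T n).map f) ((iter X.T n).map g)
      ((iter X.T n).map h) ((iter X.T n).map k) := by
  obtain ⟨F, hF, iP, iX, iY, iZ, e₁, e₂, e₃, e₄⟩ := s
  refine ⟨F ⋙ iter X.T n, iter_mem hF n, (iter X.T n).mapIso iP, (iter X.T n).mapIso iX,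
    (iter X.T n).mapIso iY, (iter X.T n).mapIso iZ, ?_, ?_, ?_, ?_⟩
  all_goals simp only [Functor.mapIso_hom, Functor.comp_map, ← Functor.map_comp, e₁, e₂, e₃, e₄]

theorem square_map {P A B M : C} {f : P ⟶ A} {g : P ⟶ B} {h : A ⟶ M} {k : B ⟶ M}
    (s : X.𝒬.Square f g h k) : X.𝒬.Square (X.T.map f) (X.T.map g) (X.T.map h) (X.T.map k) :=
  square_iter s 1

theorem square_of_isPullback {E M : C} {q : E ⟶ M} (hq : X.𝒟 q) {P Z : C} {a : P ⟶ E}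
    {b : P ⟶ Z} {g : Z ⟶ M} (h : IsPullback a b q g) : X.𝒬.Square a b q g := by
  obtain ⟨_, _, _, -, s⟩ := X.display_quarrable q hq g
  exact s.of_isPullback h

theorem isPullback_iter {E M : C} {q : E ⟶ M} (hq : X.𝒟 q) {P Z : C} {a : P ⟶ E}
    {b : P ⟶ Z} {g : Z ⟶ M} (h : IsPullback a b q g) (k : ℕ) :
    IsPullback ((iter X.T k).map a) ((iter X.T k).map b) ((iter X.T k).map q)
      ((iter X.T k).map g) :=
  (square_iter (square_of_isPullback hq h) k).isPullback

/-- Transverse squares stay transverse under `T` and transverse squares are pullbacks, so pullbacks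
along display maps survive every iterate of `T`. This makes all preservation conditions in the
definition of a differential bundle automatic for display maps. -/
theorem preservesPullbacksAlong {E M : C} {q : E ⟶ M} (hq : X.𝒟 q) (k : ℕ) :
    PreservesPullbacksAlong (iter X.T k) q := fun _ g => by
  obtain ⟨P, a, b, h, s⟩ := X.display_quarrable q hq g
  exact ⟨P, a, b, h, (square_iter s k).isPullback⟩

theorem hasPullbackPowers {E M : C} {q : E ⟶ M} (hq : X.𝒟 q) : HasPullbackPowers q :=
  (preservesPullbacksAlong hq 0).hasPullbackPowers

theorem preservedByIterates {E M : C} {q : E ⟶ M} (hq : X.𝒟 q) : PreservedByIterates X.T q :=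
  ⟨fun k => (preservesPullbacksAlong hq k).preservesPullbackPowers⟩

theorem display_id (M : C) : X.𝒟 (𝟙 M) := X.display_iso _ inferInstance

theorem square_id_id {N M : C} (f : N ⟶ M) : X.𝒬.Square (𝟙 N) f f (𝟙 M) :=
  (square_of_isPullback (display_id M) (IsPullback.of_vert_isIso ⟨by simp⟩ :
    IsPullback f (𝟙 N) (𝟙 M) f)).flip

/-- The partial powers of a transverse power of `p`, with the transverse squares relating them. -/
theorem exists_isPower_square (M : C) (n : ℕ) : ∀ k : ℕ, k ≤ n →
    ∃ (W : C) (w : W ⟶ M) (π : Fin k → (W ⟶ X.T.obj M)), IsPower (X.p M) w π ∧ (k < n →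
      ∃ (W' : C) (a : W' ⟶ X.T.obj M) (b : W' ⟶ W), X.𝒬.Square a b (X.p M) w) := by
  obtain ⟨F, hF, eM, eE, hE⟩ := X.power_transverse M n
  -- The vertex whose first `k` coordinates vanish; `F` sends it to the `k`-fold partial power.
  let v : ℕ → Cube n := fun k i => decide (k ≤ i.1)
  -- Collapses the first `k` coordinates to one and keeps the `k`-th as the other. The square it
  -- cuts out has corners `v (k + 1)`, `v k`, `leg k` and `⊤`, and it exhibits one power as the base
  -- change of `p` along the preceding one.
  let r : ℕ → LatticeHom (Cube 2) (Cube n) := fun k =>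
    { toFun := fun w i => if i.1 < k then w 0 else if i.1 = k then w 1 else true
      map_sup' := fun x y => by
        funext i
        change _ = _ ⊔ _
        beta_reduce
        split_ifs <;> rfl
      map_inf' := fun x y => by
        funext i
        change _ = _ ⊓ _
        beta_reduce
        split_ifs <;> rfl }
  have r₀ : ∀ (k : ℕ) (hk : k < n), r k (leg 0) = v k := fun k hk => by
    funext i
    change (if i.1 < k then false else if i.1 = k then true else true) = decide (k ≤ i.1)
    split_ifs <;> simp <;> omega
  have r₁ : ∀ (k : ℕ) (hk : k < n), r k (leg 1) = leg ⟨k, hk⟩ := fun k hk => by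
    funext i
    change (if i.1 < k then true else if i.1 = k then false else true) =
      Function.update (fun _ => true) _ false i
    rw [Function.update_apply]
    simp only [Fin.ext_iff]
    split_ifs <;> first | rfl | omega
  have rb : ∀ (k : ℕ) (hk : k < n), r k ⊥ = v (k + 1) := fun k hk => by
    funext i
    change (if i.1 < k then false else if i.1 = k then false else true) = decide (k + 1 ≤ i.1)
    split_ifs <;> simp <;> omega
  have rt : ∀ (k : ℕ) (hk : k < n), r k ⊤ = ⊤ := fun k hk => by
    funext i
    change (if i.1 < k then true else if i.1 = k then true else true) = true
    split_ifs <;> rfl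
  have v₀ : v 0 = ⊤ := by
    funext i
    exact decide_eq_true (Nat.zero_le _)
  have sq : ∀ (k : ℕ) (hk : k < n), ∃ (a : _) (hle : v (k + 1) ≤ v k),
      X.𝒬.Square a (F.map (homOfLE hle)) (X.p M) (F.map (homOfLE le_top) ≫ eM.hom) := fun k hk => by
    have hle : v (k + 1) ≤ v k := fun i => by
      change decide (k + 1 ≤ i.1) ≤ decide (k ≤ i.1)
      by_cases h : k + 1 ≤ i.1
      · simp [h, show k ≤ i.1 by omega]
      · simp [h]
    have hle' : v (k + 1) ≤ leg ⟨k, hk⟩ := by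
      rw [← rb k hk, ← r₁ k hk]
      exact OrderHomClass.mono (r k) bot_le
    have s := TransverseSystem.square_reindex (r k) hF (rb k hk) (r₀ k hk) (r₁ k hk) (rt k hk) hle
      hle' le_top le_top
    exact ⟨F.map (homOfLE hle') ≫ (eE ⟨k, hk⟩).hom, hle, s.flip.of_iso (Iso.refl _) (eE ⟨k, hk⟩) (Iso.refl _) eM (by simp) (by simp)
      (hE ⟨k, hk⟩) (by simp)⟩
  have pw : ∀ k : ℕ, k ≤ n → ∃ π : Fin k → (F.obj (v k) ⟶ X.T.obj M),
      IsPower (X.p M) (F.map (homOfLE le_top) ≫ eM.hom) π := by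
    intro k
    induction k with
    | zero =>
      intro _
      refine ⟨fun i => i.elim0, ?_⟩
      have : ∀ (x : Cube n) (hx : x = ⊤), IsPower (X.p M) (F.map (homOfLE (le_top : x ≤ ⊤)) ≫ eM.hom)
          (fun i => i.elim0 : Fin 0 → (F.obj x ⟶ X.T.obj M)) := by
        rintro x rfl
        refine (IsPower.zero (X.p M) fun i => i.elim0).of_iso (Iso.refl _) (Iso.refl _) eM.symm
          (by simp) ?_ fun i => i.elim0
        rw [show homOfLE (le_top : (⊤ : Cube n) ≤ ⊤) = 𝟙 _ from rfl, F.map_id]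
        simp
      exact this _ v₀
    | succ k ih =>
      intro hk
      obtain ⟨π, h⟩ := ih (by omega)
      obtain ⟨a, hle, s⟩ := sq k (by omega)
      exact ⟨_, (h.succ s.isPullback).congr (by rw [← Category.assoc, ← F.map_comp]; rfl) fun _ => rfl⟩
  intro k hk
  obtain ⟨π, h⟩ := pw k hk
  exact ⟨_, _, π, h, fun hk' => by
    obtain ⟨a, _, s⟩ := sq k hk'
    exact ⟨_, a, _, s⟩⟩

/-- Powers are unique up to isomorphism over `M`, so the given one may be replaced by the `k`-fold
partial power inside the transverse power with `k + 1` factors. The extra factor provides the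
square. -/
theorem exists_square_of_isPower {M W : C} {k : ℕ} {w : W ⟶ M} {π : Fin k → (W ⟶ X.T.obj M)}
    (h : IsPower (X.p M) w π) :
    ∃ (W' : C) (a : W' ⟶ X.T.obj M) (b : W' ⟶ W), X.𝒬.Square a b (X.p M) w := by
  obtain ⟨W₀, w₀, π₀, h₀, hs⟩ := exists_isPower_square (X := X) M (k + 1) k (by omega)
  obtain ⟨W', a, b, s⟩ := hs (by omega)
  obtain ⟨e, he⟩ := h₀.isoOver h
  exact ⟨W', a, b ≫ e.hom, s.of_iso (Iso.refl _) (Iso.refl _) e (Iso.refl _) (by simp) (by simp)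
    (by simp) (by simp [he])⟩

end DisplayTangentStructure


/-! ### Calculus of tangent categories and differential bundles -/

/-- Since `0_M` is split by `p_M`, this makes `v`, `μ` and the Cartesian arrows over `0_M` monic. -/
theorem mono_fst_of_isPullback {C : Type u} [Category.{v} C] {P X Y Z : C} {f : P ⟶ X} {g : P ⟶ Y}
    {h : X ⟶ Z} {k : Y ⟶ Z} (sq : IsPullback f g h k) [Mono k] : Mono f :=
  ⟨fun x y e => sq.hom_ext e (by
    rw [← cancel_mono k, Category.assoc, Category.assoc, ← sq.w, ← Category.assoc, e,
      Category.assoc])⟩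

namespace TangentStructure

variable {C : Type u} [Category.{v} C] (𝕋 : TangentStructure C)

@[simp]
theorem zero_p (M : C) : 𝕋.zero M ≫ 𝕋.p M = 𝟙 M := (𝕋.bundle M).zero_proj

theorem zero_natural {M N : C} (f : M ⟶ N) : 𝕋.zero M ≫ 𝕋.T.map f = f ≫ 𝕋.zero N :=
  (𝕋.natural f).zero

theorem p_natural {M N : C} (f : M ⟶ N) : 𝕋.T.map f ≫ 𝕋.p N = 𝕋.p M ≫ f :=
  (𝕋.natural f).comm

theorem zero_flip (M : C) : 𝕋.T.map (𝕋.zero M) ≫ 𝕋.flip M = 𝕋.zero (𝕋.T.obj M) :=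
  (𝕋.flip_additive M).zero.trans (Category.id_comp _)

theorem zero_flip' (M : C) : 𝕋.zero (𝕋.T.obj M) ≫ 𝕋.flip M = 𝕋.T.map (𝕋.zero M) := by
  rw [← zero_flip, Category.assoc, 𝕋.flip_flip, Category.comp_id]

theorem flip_p (M : C) : 𝕋.flip M ≫ 𝕋.p (𝕋.T.obj M) = 𝕋.T.map (𝕋.p M) :=
  (𝕋.flip_additive M).comm.trans (Category.comp_id _)

theorem flip_map_p (M : C) : 𝕋.flip M ≫ 𝕋.T.map (𝕋.p M) = 𝕋.p (𝕋.T.obj M) := by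
  rw [← flip_p, ← Category.assoc, 𝕋.flip_flip, Category.id_comp]

/-- The axiom `ell_flip_flip` conjugated by the involutions `flip`, in the form needed for the lift
`T(λ) c` of a tangent bundle. -/
theorem flip_ell (M : C) : 𝕋.flip M ≫ 𝕋.ell (𝕋.T.obj M) =
    𝕋.T.map (𝕋.ell M) ≫ 𝕋.flip (𝕋.T.obj M) ≫ 𝕋.T.map (𝕋.flip M) := by
  have h := congrArg (fun k => 𝕋.flip M ≫ k ≫ 𝕋.flip (𝕋.T.obj M) ≫ 𝕋.T.map (𝕋.flip M))
    (𝕋.ell_flip_flip M)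
  have h₁ : ∀ {Z : C} (x : 𝕋.T.obj (𝕋.T.obj M) ⟶ Z), 𝕋.flip M ≫ 𝕋.flip M ≫ x = x := fun x => by
    rw [← Category.assoc, 𝕋.flip_flip, Category.id_comp]
  have h₂ : ∀ {Z : C} (x : 𝕋.T.obj (𝕋.T.obj (𝕋.T.obj M)) ⟶ Z),
      𝕋.flip (𝕋.T.obj M) ≫ 𝕋.flip (𝕋.T.obj M) ≫ x = x := fun x => by
    rw [← Category.assoc, 𝕋.flip_flip, Category.id_comp]
  simp only [Category.assoc, h₁, h₂] at h
  rw [← h, ← 𝕋.T.map_comp, 𝕋.flip_flip, 𝕋.T.map_id, Category.comp_id]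

instance (M : C) : Mono (𝕋.zero M) := ⟨fun x y h => by
  have := congrArg (fun k => k ≫ 𝕋.p M) h
  simpa using this⟩

theorem isPullback_vert (M : C) : IsPullback (𝕋.vert M) ((𝕋.bundle M).π₀ ≫ 𝕋.p M)
    (𝕋.T.map (𝕋.p M)) (𝕋.zero M) :=
  𝕋.universal M 0

instance (M : C) : Mono (𝕋.vert M) := mono_fst_of_isPullback (𝕋.isPullback_vert M)

end TangentStructure

namespace AdditiveBundle

variable {C : Type u} [Category.{v} C] (𝕋 : TangentStructure C) {E M : C} {q : E ⟶ M}
  (S : AdditiveBundle q)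

/-- The addition of `T² q` is `T²(σ)` up to the identification of pullbacks, so the claim is
naturality of the flip at `σ`. -/
theorem flip_additive_map_map [PreservesPullbackPowers 𝕋.T q]
    [PreservesPullbackPowers 𝕋.T (𝕋.T.map q)] :
    IsAdditiveMorphism ((S.map 𝕋.T).map 𝕋.T) ((S.map 𝕋.T).map 𝕋.T) (𝕋.flip E) (𝕋.flip M) := by
  refine IsAdditiveMorphism.of_sum (𝕋.flip_natural q).symm ?_
    (by simp only [AdditiveBundle.map_zero, 𝕋.flip_natural])
  -- The comparison `y` from the pullback of `T² q` with itself to `T² E₂` presents the two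
  -- projections as images under `T²`, which lets sums be rewritten as `T²(σ)`.
  obtain ⟨y, h₀, h₁⟩ : ∃ y : ((S.map 𝕋.T).map 𝕋.T).E₂ ⟶ 𝕋.T.obj (𝕋.T.obj S.E₂),
      y ≫ 𝕋.T.map (𝕋.T.map S.π₀) = ((S.map 𝕋.T).map 𝕋.T).π₀ ∧
      y ≫ 𝕋.T.map (𝕋.T.map S.π₁) = ((S.map 𝕋.T).map 𝕋.T).π₁ :=
    ⟨(S.map 𝕋.T).mapPair 𝕋.T _ _ ((S.map 𝕋.T).map 𝕋.T).isPullback.w ≫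
      𝕋.T.map (S.mapPair 𝕋.T _ _ (S.map 𝕋.T).isPullback.w), by simp [← 𝕋.T.map_comp],
      by simp [← 𝕋.T.map_comp]⟩
  rw [← ((S.map 𝕋.T).map 𝕋.T).sum_π₀_π₁]
  have e := (S.map 𝕋.T).comp_map_sum 𝕋.T y (𝕋.T.map S.π₀) (𝕋.T.map S.π₁)
    (by simp only [← Functor.map_comp, S.isPullback.w])
  have e' := (S.map 𝕋.T).comp_map_sum 𝕋.T (y ≫ 𝕋.flip _) (𝕋.T.map S.π₀) (𝕋.T.map S.π₁)
    (by simp only [← Functor.map_comp, S.isPullback.w])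
  rw [← S.map_map_sum 𝕋.T _ _ S.isPullback.w, sum_π₀_π₁] at e e'
  refine (congrArg (fun k => k ≫ 𝕋.flip E) ((AdditiveBundle.sum_congr _ h₀.symm h₁.symm _).trans
    e.symm)).trans (Eq.trans ?_ (e'.trans (AdditiveBundle.sum_congr _ ?_ ?_ _)))
  · simp only [Category.assoc, 𝕋.flip_natural]
  · rw [Category.assoc, ← 𝕋.flip_natural, ← Category.assoc, h₀]
  · rw [Category.assoc, ← 𝕋.flip_natural, ← Category.assoc, h₁]

end AdditiveBundle

namespace DifferentialBundle

variable {C : Type u} [Category.{v} C] {𝕋 : TangentStructure C} {E M : C} {q : E ⟶ M}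
  (s : DifferentialBundle 𝕋 q)

theorem lift_p : s.lift ≫ 𝕋.p E = q ≫ s.zero := s.lift_additive_p.comm

theorem lift_map_proj : s.lift ≫ 𝕋.T.map q = q ≫ 𝕋.zero M := s.lift_additive_map.comm

theorem lift_zero_comm {Z : C} {a b : Z ⟶ E} (h : a ≫ q = b ≫ q) :
    (a ≫ s.lift) ≫ 𝕋.T.map q = (b ≫ 𝕋.zero E) ≫ 𝕋.T.map q := by
  rw [Category.assoc, lift_map_proj, Category.assoc, 𝕋.zero_natural, ← Category.assoc, h,
    Category.assoc]

theorem pair_μ {Z : C} (a b : Z ⟶ E) (h : a ≫ q = b ≫ q) :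
    haveI := s.preserved
    s.pair a b h ≫ s.μ = (s.map 𝕋.T).sum (a ≫ s.lift) (b ≫ 𝕋.zero E) (s.lift_zero_comm h) :=
  have := s.preserved
  s.toAdditiveBundle.pair_mu _ _ _ _ _ _ _

theorem isPullback_μ : IsPullback s.μ (s.π₀ ≫ q) (𝕋.T.map q) (𝕋.zero M) := s.universal 0

instance : Mono s.μ := mono_fst_of_isPullback s.isPullback_μ

/-- Since `λ(a) = μ(a, 0)`, the lift inherits from `μ` the property of being monic. -/
theorem lift_eq : s.lift = s.pair (𝟙 E) (q ≫ s.zero) (by simp [s.zero_proj]) ≫ s.μ := by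
  have := s.preserved
  rw [pair_μ]
  have e : (q ≫ s.zero) ≫ 𝕋.zero E = (q ≫ 𝕋.zero M) ≫ (s.map 𝕋.T).zero := by
    simp only [Category.assoc, AdditiveBundle.map_zero, 𝕋.zero_natural]
  rw [AdditiveBundle.sum_congr _ (Category.id_comp _) e, AdditiveBundle.sum_zero]

instance : Mono s.lift := by
  have : Mono (s.pair (𝟙 E) (q ≫ s.zero) (by simp [s.zero_proj])) := by
    refine ⟨fun x y h => ?_⟩
    have := congrArg (fun k => k ≫ s.π₀) h
    simpa using this
  rw [lift_eq]
  infer_instance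

/-- A morphism of differential bundles which preserves the lift is additive. -/
theorem additive_of_linear {E' M' : C} {q' : E' ⟶ M'} {s : DifferentialBundle 𝕋 q}
    {s' : DifferentialBundle 𝕋 q'} {f : E ⟶ E'} {b : M ⟶ M'} (comm : f ≫ q' = q ≫ b)
    (lin : f ≫ s'.lift = s.lift ≫ 𝕋.T.map f) :
    IsAdditiveMorphism s.toAdditiveBundle s'.toAdditiveBundle f b := by
  refine IsAdditiveMorphism.of_sum comm ?_ ?_
  -- The lift of the target is monic and turns `σ` into the addition of `p`, for which `T f` is
  -- additive by naturality.
  · rw [← cancel_mono s'.lift, Category.assoc, lin, ← Category.assoc, s.lift_additive_p.add,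
      AdditiveBundle.pair_σ, (𝕋.natural f).sum_comp, s'.lift_additive_p.sum_comp]
    exact AdditiveBundle.sum_congr _ (by simp only [Category.assoc, lin])
      (by simp only [Category.assoc, lin]) _
  -- The zero section is recovered from the lift through `λ p = q ζ`; the projection `q` is then
  -- cancelled by its section `ζ`.
  · have h : q ≫ s.zero ≫ f = q ≫ b ≫ s'.zero := by
      rw [← Category.assoc, ← lift_p, Category.assoc, ← 𝕋.p_natural, ← Category.assoc, ← lin,
        Category.assoc, lift_p, ← Category.assoc, comm, Category.assoc]
    have := congrArg (fun k => s.zero ≫ k) h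
    simpa only [← Category.assoc, s.zero_proj, Category.id_comp] using this

theorem pair_μ_map {E' M' : C} {q' : E' ⟶ M'} {s : DifferentialBundle 𝕋 q}
    {s' : DifferentialBundle 𝕋 q'} {f : E ⟶ E'} {b : M ⟶ M'} (comm : f ≫ q' = q ≫ b)
    (lin : f ≫ s'.lift = s.lift ≫ 𝕋.T.map f) {Z : C} (x y : Z ⟶ E) (h : x ≫ q = y ≫ q) :
    (s.pair x y h ≫ s.μ) ≫ 𝕋.T.map f = s'.pair (x ≫ f) (y ≫ f)
      (IsAdditiveMorphism.comm_of_comm comm h) ≫ s'.μ := by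
  have := s.preserved
  have := s'.preserved
  rw [pair_μ, pair_μ, ((additive_of_linear comm lin).map 𝕋.T).sum_comp]
  exact AdditiveBundle.sum_congr _ (by simp only [Category.assoc, lin])
    (by simp only [Category.assoc, 𝕋.zero_natural]) _

/-- The existence half of universality on generalized elements; the uniqueness half is `pair_μ_inj`.
-/
theorem exists_pair {Z : C} (x : Z ⟶ 𝕋.T.obj E) (y : Z ⟶ M)
    (h : x ≫ 𝕋.T.map q = y ≫ 𝕋.zero M) : ∃ (a b : Z ⟶ E) (hab : a ≫ q = b ≫ q),
      a ≫ q = y ∧ s.pair a b hab ≫ s.μ = x := by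
  refine ⟨s.isPullback_μ.lift x y h ≫ s.π₀, s.isPullback_μ.lift x y h ≫ s.π₁,
    by simp only [Category.assoc, s.isPullback.w], ?_, ?_⟩
  · rw [Category.assoc, s.isPullback_μ.lift_snd]
  · rw [← s.comp_pair _ _ _ s.isPullback.w, s.pair_π₀_π₁, Category.comp_id,
      s.isPullback_μ.lift_fst]

theorem pair_μ_inj {Z : C} {a b a' b' : Z ⟶ E} {h : a ≫ q = b ≫ q} {h' : a' ≫ q = b' ≫ q}
    (e : s.pair a b h ≫ s.μ = s.pair a' b' h' ≫ s.μ) : a = a' ∧ b = b' := by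
  have e' := (cancel_mono s.μ).1 e
  exact ⟨by simpa using congrArg (fun k => k ≫ s.π₀) e',
    by simpa using congrArg (fun k => k ≫ s.π₁) e'⟩

/-- The base point of `λ(a)` is a zero and that of `0(b)` is `b`. Naturality of `p` at `σ` adds
them. -/
theorem pair_μ_p {Z : C} (a b : Z ⟶ E) (h : a ≫ q = b ≫ q) :
    (s.pair a b h ≫ s.μ) ≫ 𝕋.p E = b := by
  have := s.preserved
  rw [μ, AdditiveBundle.mu, Category.assoc, Category.assoc, 𝕋.p_natural, ← Category.assoc,
    ← Category.assoc]
  have e : (s.pair a b h ≫ s.mapPair 𝕋.T (s.π₀ ≫ s.lift) (s.π₁ ≫ 𝕋.zero E)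
      (s.lift_zero_comm s.isPullback.w)) ≫ 𝕋.p s.E₂ =
      s.pair ((a ≫ q) ≫ s.zero) b (by simp [s.zero_proj, h]) := by
    apply s.E₂_ext
    · rw [Category.assoc, ← 𝕋.p_natural]
      simp [lift_p]
    · rw [Category.assoc, ← 𝕋.p_natural]
      simp
  exact (congrArg (fun k => k ≫ s.σ) e).trans (s.zero_sum _ _ _)

end DifferentialBundle

/-! ### Display differential bundles -/

section Display

variable {C : Type u} [Category.{v} C] {X : DisplayTangentStructure C}

open DisplayTangentStructure

/-- A differential bundle structure on a display map; the preservation of limits is automatic. -/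
def DifferentialBundle.ofDisplay {E M : C} {q : E ⟶ M} (hq : X.𝒟 q) (S : AdditiveBundle q)
    (lift : E ⟶ X.T.obj E)
    (lift_additive_map : haveI := preservedByIterates hq
      IsAdditiveMorphism S (S.map X.T) lift (X.zero M))
    (lift_additive_p : IsAdditiveMorphism S (X.bundle E) lift S.zero)
    (universal : haveI := preservedByIterates hq
      ∀ h : S.π₀ ≫ lift ≫ X.T.map q = S.π₁ ≫ X.zero E ≫ X.T.map q,
        IsPullback (S.mu X.T lift (X.zero E) h) (S.π₀ ≫ q) (X.T.map q) (X.zero M))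
    (lift_ell : lift ≫ X.ell E = lift ≫ X.T.map lift) :
    DifferentialBundle X.toTangentStructure q :=
  haveI := preservedByIterates hq
  { toAdditiveBundle := S
    lift := lift
    lift_additive_map := lift_additive_map
    lift_additive_p := lift_additive_p
    -- The square is a pullback along `T q`, a display map, so the case `k = 0` implies the others.
    universal := fun k => isPullback_iter (X.map_display q hq)
      (universal _) k
    lift_ell := lift_ell }

/-- The differential bundle `T(q)`. -/
def DifferentialBundle.tangent {E M : C} {q : E ⟶ M} (hq : X.𝒟 q)
    (s : DifferentialBundle X.toTangentStructure q) :
    DifferentialBundle X.toTangentStructure (X.T.map q) :=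
  haveI := preservedByIterates hq
  haveI := preservedByIterates (X.map_display q hq)
  .ofDisplay (X.map_display q hq) (s.map X.T) (X.T.map s.lift ≫ X.flip E)
    (by
      have h := (s.lift_additive_map.map X.T).comp
        (s.toAdditiveBundle.flip_additive_map_map X.toTangentStructure)
      rwa [X.zero_flip] at h)
    (by
      have h := (s.lift_additive_p.map X.T).comp (X.flip_additive E)
      rwa [Category.comp_id] at h)
    (by
      intro h
      -- The universality square of `T(q)` is the image under `T` of that of `q`, conjugated by the
      -- flips of `E` and of `M`.
      have hp : IsPullback (X.T.map s.μ) (X.T.map (s.π₀ ≫ q)) (X.T.map (X.T.map q))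
          (X.T.map (X.zero M)) := isPullback_iter (X.map_display q hq) s.isPullback_μ 1
      let e : X.T.obj s.E₂ ≅ (s.map X.T).E₂ :=
        (s.isPullback_map X.T).isoIsPullback _ _ (s.map X.T).isPullback
      have e₀ : e.hom ≫ (s.map X.T).π₀ = X.T.map s.π₀ :=
        IsPullback.isoIsPullback_hom_fst _ _ _ _
      have e₁ : e.hom ≫ (s.map X.T).π₁ = X.T.map s.π₁ :=
        IsPullback.isoIsPullback_hom_snd _ _ _ _
      let c : ∀ M, X.T.obj (X.T.obj M) ≅ X.T.obj (X.T.obj M) := fun M =>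
        ⟨X.flip M, X.flip M, X.flip_flip M, X.flip_flip M⟩
      refine hp.of_iso e (c E) (Iso.refl _) (c M) ?_ ?_ (X.flip_natural q) ?_
      · have w : X.T.map s.π₀ ≫ X.T.map q = X.T.map s.π₁ ≫ X.T.map q := by
          rw [← X.T.map_comp, s.isPullback.w, X.T.map_comp]
        have he : e.hom = (s.map X.T).pair (X.T.map s.π₀) (X.T.map s.π₁) w :=
          (s.map X.T).E₂_ext (by simp [e₀]) (by simp [e₁])
        have hμ : s.μ = (s.map X.T).sum (s.π₀ ≫ s.lift) (s.π₁ ≫ X.zero E)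
            (s.lift_zero_comm s.isPullback.w) := by
          rw [← s.pair_μ _ _ s.isPullback.w, s.pair_π₀_π₁, Category.id_comp]
        rw [he, AdditiveBundle.pair_mu]
        rw [hμ, AdditiveBundle.map_map_sum,
          (s.toAdditiveBundle.flip_additive_map_map X.toTangentStructure).sum_comp]
        refine AdditiveBundle.sum_congr _ ?_ ?_ _
        · simp
        · simp [X.zero_flip]
      · rw [← Category.assoc, e₀, Iso.refl_hom, Category.comp_id, X.T.map_comp]
      · exact (X.zero_flip M).trans (Category.id_comp _).symm)
    (by
      -- Moving `ell` past the flip leaves `T(λ) T(ell) = T(λ) T²(λ)`, and naturality of the flip at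
      -- `λ` restores the required order.
      rw [Category.assoc, X.flip_ell, ← Category.assoc, ← X.T.map_comp, s.lift_ell, X.T.map_comp,
        Category.assoc, ← Category.assoc (X.T.map (X.T.map s.lift)), X.flip_natural]
      simp)

theorem DifferentialBundle.tangent_isTangentOf {E M : C} {q : E ⟶ M} (hq : X.𝒟 q)
    (s : DifferentialBundle X.toTangentStructure q) : (s.tangent hq).IsTangentOf s where
  add := by
    have := preservedByIterates hq
    exact (s.map_map_σ X.T).symm
  zero := rfl
  lift := rfl

end Display


theorem isPullback_of_exists {C : Type u} [Category.{v} C] {P X Y Z : C} {f : P ⟶ X} {g : P ⟶ Y}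
    {h : X ⟶ Z} {k : Y ⟶ Z} (w : f ≫ h = g ≫ k)
    (ex : ∀ {W : C} (x : W ⟶ X) (y : W ⟶ Y), x ≫ h = y ≫ k → ∃ l, l ≫ f = x ∧ l ≫ g = y)
    (ext : ∀ {W : C} (l l' : W ⟶ P), l ≫ f = l' ≫ f → l ≫ g = l' ≫ g → l = l') :
    IsPullback f g h k :=
  ⟨⟨w⟩, ⟨PullbackCone.IsLimit.mk w
    (fun s => (ex s.fst s.snd s.condition).choose)
    (fun s => (ex s.fst s.snd s.condition).choose_spec.1)
    (fun s => (ex s.fst s.snd s.condition).choose_spec.2)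
    (fun s _ h₁ h₂ => ext _ _
      (h₁.trans (ex s.fst s.snd s.condition).choose_spec.1.symm)
      (h₂.trans (ex s.fst s.snd s.condition).choose_spec.2.symm))⟩⟩

theorem AdditiveBundle.mu_map_proj {C : Type u} [Category.{v} C] {E M : C} {q : E ⟶ M}
    (S : AdditiveBundle q) (T : C ⥤ C) [PreservesPullbackPowers T q] (l z : E ⟶ T.obj E)
    (h : S.π₀ ≫ l ≫ T.map q = S.π₁ ≫ z ≫ T.map q) :
    S.mu T l z h ≫ T.map q = S.π₀ ≫ l ≫ T.map q := by
  rw [AdditiveBundle.mu, Category.assoc, ← T.map_comp, S.σ_proj, T.map_comp,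
    AdditiveBundle.mapPair_map_π₀_assoc, Category.assoc]

/-- The source `S` carries only a candidate lift whose universality is not yet known; the target is
a genuine differential bundle. This is how universality is tested after projecting to known bundles.
-/
theorem AdditiveBundle.pair_mu_map {C : Type u} [Category.{v} C] {𝕋 : TangentStructure C}
    {E M E' M' : C} {q : E ⟶ M} {q' : E' ⟶ M'} (S : AdditiveBundle q)
    [PreservesPullbackPowers 𝕋.T q] {s' : DifferentialBundle 𝕋 q'} {l : E ⟶ 𝕋.T.obj E}
    (h : S.π₀ ≫ l ≫ 𝕋.T.map q = S.π₁ ≫ 𝕋.zero E ≫ 𝕋.T.map q) {e : E ⟶ E'} {b : M ⟶ M'}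
    (he : IsAdditiveMorphism S s'.toAdditiveBundle e b) (hl : l ≫ 𝕋.T.map e = e ≫ s'.lift)
    {Z : C} (x y : Z ⟶ E) (hxy : x ≫ q = y ≫ q) :
    (S.pair x y hxy ≫ S.mu 𝕋.T l (𝕋.zero E) h) ≫ 𝕋.T.map e =
      s'.pair (x ≫ e) (y ≫ e) (IsAdditiveMorphism.comm_of_comm he.comm hxy) ≫ s'.μ := by
  have := s'.preserved
  rw [AdditiveBundle.pair_mu, s'.pair_μ, (he.map 𝕋.T).sum_comp]
  exact AdditiveBundle.sum_congr _ (by simp only [Category.assoc, hl])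
    (by simp only [Category.assoc, 𝕋.zero_natural]) _

open DisplayTangentStructure

/-! ### Morphisms of bundles and limits computed on total objects and bases -/

namespace DBun

variable {C : Type u} [Category.{v} C] {X : DisplayTangentStructure C}

@[simp]
theorem comp_base {q q' q'' : DBun X} (f : q ⟶ q') (g : q' ⟶ q'') :
    (f ≫ g).base = f.base ≫ g.base := rfl

theorem hom_w {q q' : DBun X} (f : q ⟶ q') : f.total ≫ q'.proj = q.proj ≫ f.base := Hom.w f

theorem hom_ext' {q q' : DBun X} {f g : q ⟶ q'} (h : f.total = g.total) (h' : f.base = g.base) :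
    f = g :=
  Hom.ext h h'

/-- A morphism of bundles is determined by its action on total objects. -/
theorem hom_ext {q q' : DBun X} {f g : q ⟶ q'} (h : f.total = g.total) : f = g := by
  refine hom_ext' h ?_
  have e : ∀ k : q ⟶ q', k.base = q.str.zero ≫ k.total ≫ q'.proj := fun k => by
    rw [hom_w, ← Category.assoc, q.str.zero_proj, Category.id_comp]
  rw [e f, e g, h]

instance : (totalFunctor X).Faithful := ⟨fun h => hom_ext h⟩

theorem IsLinear.additive {q q' : DBun X} {f : q ⟶ q'} (h : IsLinear f) :
    IsAdditiveMorphism q.str.toAdditiveBundle q'.str.toAdditiveBundle f.total f.base :=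
  DifferentialBundle.additive_of_linear (hom_w f) h

/-- Limits of bundles are computed on total objects and on bases. -/
theorem isPullback_of_total_of_base {P A B D : DBun X} {f : P ⟶ A} {g : P ⟶ B} {h : A ⟶ D}
    {k : B ⟶ D} (ht : IsPullback f.total g.total h.total k.total)
    (hb : IsPullback f.base g.base h.base k.base) : IsPullback f g h k :=
  isPullback_of_exists (hom_ext' ht.w hb.w)
    (fun {W} x y e => by
      have et : x.total ≫ h.total = y.total ≫ k.total := congrArg Hom.total e
      have eb : x.base ≫ h.base = y.base ≫ k.base := congrArg Hom.base e
      refine ⟨⟨ht.lift _ _ et, hb.lift _ _ eb, hb.hom_ext ?_ ?_⟩, hom_ext' ?_ ?_, hom_ext' ?_ ?_⟩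
      · rw [Category.assoc, ← hom_w f, IsPullback.lift_fst_assoc, hom_w, Category.assoc,
          hb.lift_fst]
      · rw [Category.assoc, ← hom_w g, IsPullback.lift_snd_assoc, hom_w, Category.assoc,
          hb.lift_snd]
      · exact ht.lift_fst _ _ _
      · exact hb.lift_fst _ _ _
      · exact ht.lift_snd _ _ _
      · exact hb.lift_snd _ _ _)
    (fun l l' h₁ h₂ => hom_ext (ht.hom_ext (congrArg Hom.total h₁) (congrArg Hom.total h₂)))

theorem isPower_of_total_of_base {A D W : DBun X} {p : A ⟶ D} {n : ℕ} {w : W ⟶ D}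
    {π : Fin n → (W ⟶ A)} (ht : IsPower p.total w.total (fun i => (π i).total))
    (hb : IsPower p.base w.base (fun i => (π i).base)) : IsPower p w π := by
  refine ⟨fun i => hom_ext' (ht.comm i) (hb.comm i), fun {Z} z a ha => ?_⟩
  obtain ⟨l, ⟨hl, hl'⟩, ul⟩ := ht.existsUnique z.total (fun i => (a i).total)
    (fun i => congrArg Hom.total (ha i))
  obtain ⟨m, ⟨hm, hm'⟩, um⟩ := hb.existsUnique z.base (fun i => (a i).base)
    (fun i => congrArg Hom.base (ha i))
  -- The map induced on total objects and the one induced on bases form a square because the power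
  -- of the bases is jointly monic.
  refine ⟨⟨l, m, hb.hom_ext ?_ fun i => ?_⟩, ⟨hom_ext' hl hm, fun i => hom_ext' (hl' i) (hm' i)⟩,
    fun k hk => hom_ext (ul _ ⟨congrArg Hom.total hk.1, fun i => congrArg Hom.total (hk.2 i)⟩)⟩
  · rw [Category.assoc, ← hom_w w, ← Category.assoc, hl, Category.assoc, hm, hom_w]
  · rw [Category.assoc, ← hom_w (π i), ← Category.assoc, hl', Category.assoc, hm', hom_w]

/-! ### Pullbacks of linear morphisms of bundles -/

variable (X) in
/-- A cospan of linear morphisms of bundles, with transverse pullbacks of its total objects and of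
its bases. -/
structure TransverseCospan where
  {A : DBun X}
  {B : DBun X}
  {D : DBun X}
  {f : A ⟶ D}
  {g : B ⟶ D}
  linear_f : IsLinear f
  linear_g : IsLinear g
  {W : C}
  {e₀ : W ⟶ A.total}
  {e₁ : W ⟶ B.total}
  total_square : X.𝒬.Square e₀ e₁ f.total g.total
  {N : C}
  {b₀ : N ⟶ A.base}
  {b₁ : N ⟶ B.base}
  base_square : X.𝒬.Square b₀ b₁ f.base g.base

namespace TransverseCospan

variable (d : TransverseCospan X)

theorem total_isPullback : IsPullback d.e₀ d.e₁ d.f.total d.g.total := d.total_square.isPullback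

theorem base_isPullback : IsPullback d.b₀ d.b₁ d.f.base d.g.base := d.base_square.isPullback

theorem map_total_isPullback : IsPullback (X.T.map d.e₀) (X.T.map d.e₁) (X.T.map d.f.total)
    (X.T.map d.g.total) :=
  (square_map d.total_square).isPullback

theorem map_base_isPullback : IsPullback (X.T.map d.b₀) (X.T.map d.b₁) (X.T.map d.f.base)
    (X.T.map d.g.base) :=
  (square_map d.base_square).isPullback

/-- The projection of the pullback. -/
def proj : d.W ⟶ d.N :=
  d.base_isPullback.lift (d.e₀ ≫ d.A.proj) (d.e₁ ≫ d.B.proj) (by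
    rw [Category.assoc, ← hom_w, Category.assoc, ← hom_w, ← Category.assoc, d.total_isPullback.w,
      Category.assoc])

theorem proj_b₀ : d.proj ≫ d.b₀ = d.e₀ ≫ d.A.proj := d.base_isPullback.lift_fst _ _ _

theorem proj_b₁ : d.proj ≫ d.b₁ = d.e₁ ≫ d.B.proj := d.base_isPullback.lift_snd _ _ _

/-- The projections of `A`, `B` and `D` form a transformation from the square of total objects to
that of bases. The apex axiom applies because both squares are transverse, and this is why the
cospan carries transversality rather than bare pullbacks. -/
theorem display : X.𝒟 d.proj :=
  display_of_square d.total_square d.base_square d.proj_b₀.symm d.proj_b₁.symm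
    (hom_w d.f) (hom_w d.g) d.A.display d.B.display d.D.display

theorem comm₀ {Z : C} {x y : Z ⟶ d.W} (h : x ≫ d.proj = y ≫ d.proj) :
    (x ≫ d.e₀) ≫ d.A.proj = (y ≫ d.e₀) ≫ d.A.proj :=
  IsAdditiveMorphism.comm_of_comm d.proj_b₀.symm h

theorem comm₁ {Z : C} {x y : Z ⟶ d.W} (h : x ≫ d.proj = y ≫ d.proj) :
    (x ≫ d.e₁) ≫ d.B.proj = (y ≫ d.e₁) ≫ d.B.proj :=
  IsAdditiveMorphism.comm_of_comm d.proj_b₁.symm h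

/-- The sum of generalized elements of the pullback. -/
def sum {Z : C} (x y : Z ⟶ d.W) (h : x ≫ d.proj = y ≫ d.proj) : Z ⟶ d.W :=
  d.total_isPullback.lift (d.A.str.sum (x ≫ d.e₀) (y ≫ d.e₀) (d.comm₀ h))
    (d.B.str.sum (x ≫ d.e₁) (y ≫ d.e₁) (d.comm₁ h)) (by
      rw [d.linear_f.additive.sum_comp, d.linear_g.additive.sum_comp]
      exact AdditiveBundle.sum_congr _ (by simp only [Category.assoc, d.total_isPullback.w])
        (by simp only [Category.assoc, d.total_isPullback.w]) _)

theorem sum_e₀ {Z : C} (x y : Z ⟶ d.W) (h : x ≫ d.proj = y ≫ d.proj) :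
    d.sum x y h ≫ d.e₀ = d.A.str.sum (x ≫ d.e₀) (y ≫ d.e₀) (d.comm₀ h) :=
  d.total_isPullback.lift_fst _ _ _

theorem sum_e₁ {Z : C} (x y : Z ⟶ d.W) (h : x ≫ d.proj = y ≫ d.proj) :
    d.sum x y h ≫ d.e₁ = d.B.str.sum (x ≫ d.e₁) (y ≫ d.e₁) (d.comm₁ h) :=
  d.total_isPullback.lift_snd _ _ _

/-- The zero section of the pullback. -/
def zero : d.N ⟶ d.W :=
  d.total_isPullback.lift (d.b₀ ≫ d.A.str.zero) (d.b₁ ≫ d.B.str.zero) (by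
    rw [Category.assoc, d.linear_f.additive.zero, Category.assoc, d.linear_g.additive.zero,
      ← Category.assoc, d.base_isPullback.w, Category.assoc])

theorem zero_e₀ : d.zero ≫ d.e₀ = d.b₀ ≫ d.A.str.zero := d.total_isPullback.lift_fst _ _ _

theorem zero_e₁ : d.zero ≫ d.e₁ = d.b₁ ≫ d.B.str.zero := d.total_isPullback.lift_snd _ _ _

/-- The lift of the pullback. -/
def lift : d.W ⟶ X.T.obj d.W :=
  d.map_total_isPullback.lift (d.e₀ ≫ d.A.str.lift) (d.e₁ ≫ d.B.str.lift) (by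
    rw [Category.assoc, ← d.linear_f, Category.assoc, ← d.linear_g, ← Category.assoc,
      d.total_isPullback.w, Category.assoc])

theorem lift_e₀ : d.lift ≫ X.T.map d.e₀ = d.e₀ ≫ d.A.str.lift :=
  d.map_total_isPullback.lift_fst _ _ _

theorem lift_e₁ : d.lift ≫ X.T.map d.e₁ = d.e₁ ≫ d.B.str.lift :=
  d.map_total_isPullback.lift_snd _ _ _

/-- The additive bundle structure of the pullback. -/
def additiveBundle : AdditiveBundle d.proj :=
  haveI := hasPullbackPowers d.display
  -- The two projections of the pullback serve as the jointly monic family along which the laws are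
  -- reflected.
  let Q : Bool → DBun X := fun i => match i with
    | false => d.A
    | true => d.B
  .ofJointlyMonic d.proj (fun _ : Bool => 𝟭 C) (q' := fun i => (Q i).proj)
    (fun i => (Q i).str.toAdditiveBundle)
    (fun i => match i with
      | false => d.e₀
      | true => d.e₁)
    (fun i => match i with
      | false => d.b₀
      | true => d.b₁)
    (fun i => match i with
      | false => d.proj_b₀.symm
      | true => d.proj_b₁.symm)
    (fun _ _ _ h => d.total_isPullback.hom_ext (h false) (h true))
    (d.sum (pullback.fst _ _) (pullback.snd _ _) pullback.condition) d.zero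
    (d.base_isPullback.hom_ext
      (by rw [Category.assoc, proj_b₀, ← Category.assoc, sum_e₀, AdditiveBundle.sum_proj,
        Category.assoc, ← proj_b₀, Category.assoc])
      (by rw [Category.assoc, proj_b₁, ← Category.assoc, sum_e₁, AdditiveBundle.sum_proj,
        Category.assoc, ← proj_b₁, Category.assoc]))
    (d.base_isPullback.hom_ext
      (by rw [Category.assoc, proj_b₀, ← Category.assoc, zero_e₀, Category.assoc,
        d.A.str.zero_proj, Category.comp_id, Category.id_comp])
      (by rw [Category.assoc, proj_b₁, ← Category.assoc, zero_e₁, Category.assoc,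
        d.B.str.zero_proj, Category.comp_id, Category.id_comp]))
    (fun i => match i with
      | false => d.sum_e₀ (pullback.fst _ _) (pullback.snd _ _) pullback.condition
      | true => d.sum_e₁ (pullback.fst _ _) (pullback.snd _ _) pullback.condition)
    (fun i => match i with
      | false => d.zero_e₀
      | true => d.zero_e₁)

theorem additive₀ : IsAdditiveMorphism d.additiveBundle d.A.str.toAdditiveBundle d.e₀ d.b₀ :=
  have := hasPullbackPowers d.display
  .of_sum d.proj_b₀.symm
    (d.sum_e₀ (pullback.fst _ _) (pullback.snd _ _) pullback.condition) d.zero_e₀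

theorem additive₁ : IsAdditiveMorphism d.additiveBundle d.B.str.toAdditiveBundle d.e₁ d.b₁ :=
  have := hasPullbackPowers d.display
  .of_sum d.proj_b₁.symm
    (d.sum_e₁ (pullback.fst _ _) (pullback.snd _ _) pullback.condition) d.zero_e₁

/-- The differential bundle structure of the pullback. -/
def str : DifferentialBundle X.toTangentStructure d.proj :=
  haveI := preservedByIterates d.display
  haveI := preservedByIterates d.A.display
  haveI := preservedByIterates d.B.display
  have proj₀ : X.T.map d.proj ≫ X.T.map d.b₀ = X.T.map d.e₀ ≫ X.T.map d.A.proj := by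
    simp only [← X.T.map_comp, proj_b₀]
  have proj₁ : X.T.map d.proj ≫ X.T.map d.b₁ = X.T.map d.e₁ ≫ X.T.map d.B.proj := by
    simp only [← X.T.map_comp, proj_b₁]
  have lift_proj : d.lift ≫ X.T.map d.proj = d.proj ≫ X.zero d.N :=
    d.map_base_isPullback.hom_ext
      (by rw [Category.assoc, proj₀, ← Category.assoc, lift_e₀, Category.assoc,
        d.A.str.lift_map_proj, ← Category.assoc, ← proj_b₀, Category.assoc, Category.assoc,
        X.zero_natural])
      (by rw [Category.assoc, proj₁, ← Category.assoc, lift_e₁, Category.assoc,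
        d.B.str.lift_map_proj, ← Category.assoc, ← proj_b₁, Category.assoc, Category.assoc,
        X.zero_natural])
  have lift_p : d.lift ≫ X.p d.W = d.proj ≫ d.zero :=
    d.total_isPullback.hom_ext
      (by rw [Category.assoc, ← X.p_natural, ← Category.assoc, lift_e₀, Category.assoc,
        d.A.str.lift_p, Category.assoc, zero_e₀, ← Category.assoc, ← proj_b₀, Category.assoc])
      (by rw [Category.assoc, ← X.p_natural, ← Category.assoc, lift_e₁, Category.assoc,
        d.B.str.lift_p, Category.assoc, zero_e₁, ← Category.assoc, ← proj_b₁, Category.assoc])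
  .ofDisplay d.display d.additiveBundle d.lift
    (.of_sum lift_proj
      (d.map_total_isPullback.hom_ext
        (by
          rw [Category.assoc, lift_e₀, ← Category.assoc, d.additive₀.add, AdditiveBundle.pair_σ,
            d.A.str.lift_additive_map.sum_comp, (d.additive₀.map X.T).sum_comp]
          exact AdditiveBundle.sum_congr _ (by simp only [Category.assoc, lift_e₀])
            (by simp only [Category.assoc, lift_e₀]) _)
        (by
          rw [Category.assoc, lift_e₁, ← Category.assoc, d.additive₁.add, AdditiveBundle.pair_σ,
            d.B.str.lift_additive_map.sum_comp, (d.additive₁.map X.T).sum_comp]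
          exact AdditiveBundle.sum_congr _ (by simp only [Category.assoc, lift_e₁])
            (by simp only [Category.assoc, lift_e₁]) _))
      (d.map_total_isPullback.hom_ext
        (by
          rw [Category.assoc, lift_e₀, ← Category.assoc, d.additive₀.zero, Category.assoc,
            d.A.str.lift_additive_map.zero, Category.assoc, (d.additive₀.map X.T).zero,
            ← Category.assoc, ← X.zero_natural, Category.assoc])
        (by
          rw [Category.assoc, lift_e₁, ← Category.assoc, d.additive₁.zero, Category.assoc,
            d.B.str.lift_additive_map.zero, Category.assoc, (d.additive₁.map X.T).zero,
            ← Category.assoc, ← X.zero_natural, Category.assoc])))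
    (.of_sum lift_p
      (d.map_total_isPullback.hom_ext
        (by
          rw [Category.assoc, lift_e₀, ← Category.assoc, d.additive₀.add, AdditiveBundle.pair_σ,
            d.A.str.lift_additive_p.sum_comp, (X.natural d.e₀).sum_comp]
          exact AdditiveBundle.sum_congr _ (by simp only [Category.assoc, lift_e₀])
            (by simp only [Category.assoc, lift_e₀]) _)
        (by
          rw [Category.assoc, lift_e₁, ← Category.assoc, d.additive₁.add, AdditiveBundle.pair_σ,
            d.B.str.lift_additive_p.sum_comp, (X.natural d.e₁).sum_comp]
          exact AdditiveBundle.sum_congr _ (by simp only [Category.assoc, lift_e₁])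
            (by simp only [Category.assoc, lift_e₁]) _))
      (d.map_total_isPullback.hom_ext
        (by
          rw [Category.assoc, lift_e₀, ← Category.assoc, d.additive₀.zero, Category.assoc,
            d.A.str.lift_additive_p.zero, Category.assoc, (X.natural d.e₀).zero,
            ← Category.assoc, ← Category.assoc, d.additive₀.zero])
        (by
          rw [Category.assoc, lift_e₁, ← Category.assoc, d.additive₁.zero, Category.assoc,
            d.B.str.lift_additive_p.zero, Category.assoc, (X.natural d.e₁).zero,
            ← Category.assoc, ← Category.assoc, d.additive₁.zero])))
    (by
      intro h
      have key₀ : ∀ {Z : C} (x y : Z ⟶ d.W) (hxy : x ≫ d.proj = y ≫ d.proj), _ := fun x y hxy =>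
        d.additiveBundle.pair_mu_map h d.additive₀ d.lift_e₀ x y hxy
      have key₁ : ∀ {Z : C} (x y : Z ⟶ d.W) (hxy : x ≫ d.proj = y ≫ d.proj), _ := fun x y hxy =>
        d.additiveBundle.pair_mu_map h d.additive₁ d.lift_e₁ x y hxy
      have hpair : ∀ {Z : C} (l : Z ⟶ d.additiveBundle.E₂), l = d.additiveBundle.pair
          (l ≫ d.additiveBundle.π₀) (l ≫ d.additiveBundle.π₁)
          (by simp only [Category.assoc, d.additiveBundle.isPullback.w]) := fun l =>
        d.additiveBundle.E₂_ext (by simp) (by simp)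
      refine isPullback_of_exists ?_ (fun {Z} x y hxy => ?_) (fun l l' h₁ _ => ?_)
      · rw [AdditiveBundle.mu_map_proj, lift_proj, Category.assoc]
      · obtain ⟨a₀, c₀, h₀, ha₀, hx₀⟩ := d.A.str.exists_pair (x ≫ X.T.map d.e₀) (y ≫ d.b₀)
          (by rw [Category.assoc, ← proj₀, ← Category.assoc, hxy, Category.assoc, X.zero_natural,
            Category.assoc])
        obtain ⟨a₁, c₁, h₁, ha₁, hx₁⟩ := d.B.str.exists_pair (x ≫ X.T.map d.e₁) (y ≫ d.b₁)
          (by rw [Category.assoc, ← proj₁, ← Category.assoc, hxy, Category.assoc, X.zero_natural,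
            Category.assoc])
        -- The two projections of `x` decompose through `μ` of `A` and `μ` of `B`. Both
        -- decompositions map to `D`, where they agree because `f` and `g` are linear and `μ` of `D`
        -- is monic, so the components glue to elements of the pullback.
        have e : (x ≫ X.T.map d.e₀) ≫ X.T.map d.f.total =
            (x ≫ X.T.map d.e₁) ≫ X.T.map d.g.total := by
          rw [Category.assoc, d.map_total_isPullback.w, Category.assoc]
        rw [← hx₀, ← hx₁, DifferentialBundle.pair_μ_map (hom_w d.f) d.linear_f,
          DifferentialBundle.pair_μ_map (hom_w d.g) d.linear_g] at e
        obtain ⟨ea, ec⟩ := d.D.str.pair_μ_inj e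
        have hac : d.total_isPullback.lift a₀ a₁ ea ≫ d.proj =
            d.total_isPullback.lift c₀ c₁ ec ≫ d.proj :=
          d.base_isPullback.hom_ext (by simp [proj_b₀, h₀]) (by simp [proj_b₁, h₁])
        refine ⟨d.additiveBundle.pair (d.total_isPullback.lift a₀ a₁ ea)
          (d.total_isPullback.lift c₀ c₁ ec) hac,
          d.map_total_isPullback.hom_ext ?_ ?_, ?_⟩
        · rw [key₀, ← hx₀]
          exact congrArg (fun k => k ≫ _) (AdditiveBundle.pair_congr _ (by simp) (by simp) _)
        · rw [key₁, ← hx₁]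
          exact congrArg (fun k => k ≫ _) (AdditiveBundle.pair_congr _ (by simp) (by simp) _)
        · rw [AdditiveBundle.pair_π₀_assoc]
          exact d.base_isPullback.hom_ext (by simp [proj_b₀, ha₀]) (by simp [proj_b₁, ha₁])
      · rw [hpair l, hpair l'] at h₁
        have e₀ := congrArg (fun k => k ≫ X.T.map d.e₀) h₁
        have e₁ := congrArg (fun k => k ≫ X.T.map d.e₁) h₁
        simp only [key₀] at e₀
        simp only [key₁] at e₁
        obtain ⟨r₀, t₀⟩ := d.A.str.pair_μ_inj e₀
        obtain ⟨r₁, t₁⟩ := d.B.str.pair_μ_inj e₁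
        exact d.additiveBundle.E₂_ext (d.total_isPullback.hom_ext r₀ r₁)
          (d.total_isPullback.hom_ext t₀ t₁))
    (by
      -- Maps to `T² W` are tested on the two factors, since the transverse square is preserved by
      -- `T` twice.
      have hTT : IsPullback (X.T.map (X.T.map d.e₀)) (X.T.map (X.T.map d.e₁))
          (X.T.map (X.T.map d.f.total)) (X.T.map (X.T.map d.g.total)) :=
        (square_map (square_map d.total_square)).isPullback
      refine hTT.hom_ext ?_ ?_
      · rw [Category.assoc, ← X.ell_natural, ← Category.assoc, lift_e₀, Category.assoc,
          d.A.str.lift_ell, Category.assoc, ← X.T.map_comp, lift_e₀, X.T.map_comp, ← Category.assoc,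
          ← Category.assoc, lift_e₀]
      · rw [Category.assoc, ← X.ell_natural, ← Category.assoc, lift_e₁, Category.assoc,
          d.B.str.lift_ell, Category.assoc, ← X.T.map_comp, lift_e₁, X.T.map_comp, ← Category.assoc,
          ← Category.assoc, lift_e₁])

/-- The pullback bundle. -/
def pt : DBun X := ⟨d.N, d.W, d.proj, d.str, d.display⟩

/-- The first projection of the pullback bundle. -/
def fst : d.pt ⟶ d.A := ⟨d.e₀, d.b₀, d.proj_b₀.symm⟩

/-- The second projection of the pullback bundle. -/
def snd : d.pt ⟶ d.B := ⟨d.e₁, d.b₁, d.proj_b₁.symm⟩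

theorem linear_fst : IsLinear d.fst := d.lift_e₀.symm

theorem linear_snd : IsLinear d.snd := d.lift_e₁.symm

end TransverseCospan

/-! ### The identity bundles and the substitution of bundles -/

variable (X) in
/-- The trivial bundle over `M`. -/
def trivial (M : C) : DBun X where
  base := M
  total := M
  proj := 𝟙 M
  display := display_id M
  str :=
    haveI := hasPullbackPowers (display_id (X := X) M)
    haveI := preservedByIterates (display_id (X := X) M)
    -- The reflecting family is empty: a map to the total object of an identity bundle is already
    -- determined by its projection.
    let S : AdditiveBundle (𝟙 M) := .ofJointlyMonic (𝟙 M) (fun i : Empty => i.elim)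
      (E' := fun i => i.elim) (M' := fun i => i.elim) (q' := fun i => i.elim) (C := C)
      (fun i => i.elim)
      (fun i => i.elim) (fun i => i.elim) (fun i => i.elim)
      (fun x y h _ => by simpa using h) (pullback.fst _ _) (𝟙 M) (by simp) (by simp)
      (fun i => i.elim) (fun i => i.elim)
    have ext : ∀ {Z : C} {x y : Z ⟶ X.T.obj M}, x ≫ X.T.map (𝟙 M) = y ≫ X.T.map (𝟙 M) → x = y :=
      fun h => by simpa using h
    .ofDisplay (display_id M) S (X.zero M)
      (.of_sum (by simp) (ext (by
        rw [AdditiveBundle.sum_proj, Category.assoc, Category.assoc, X.T.map_id,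
          Category.comp_id]
        rfl)) (X.zero_natural (𝟙 M)).symm)
      (.of_sum (by simp [S, AdditiveBundle.ofJointlyMonic]) (by
          have e : S.σ = S.π₁ := (by
            have := S.isPullback.w
            simpa using this : S.π₀ = S.π₁)
          rw [e]
          exact ((X.bundle M).zero_sum _ _ _).symm) rfl)
      (fun h => by
        have : Mono (𝟙 M ≫ X.zero M) := by rw [Category.id_comp]; infer_instance
        refine isPullback_of_exists ?_ (fun x y hxy => ⟨S.pair y y rfl, ?_, by simp⟩)
          (fun l l' h₁ h₂ => ?_)
        · rw [AdditiveBundle.mu, Category.assoc, ← X.T.map_comp, S.σ_proj, X.T.map_comp,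
            AdditiveBundle.mapPair_map_π₀_assoc]
          simp
        · rw [AdditiveBundle.pair_mu]
          apply ext
          rw [AdditiveBundle.sum_proj, hxy]
          simp
        · have h₃ : S.π₀ = S.π₁ := by simpa using S.isPullback.w
          exact S.E₂_ext (by simpa using h₂) (by simpa [← h₃] using h₂))
      (X.zero_natural (X.zero M) ▸ (X.ell_additive M).zero)

end DBun


open DisplayTangentStructure

/-! ### Substitution of bundles and Cartesian arrows -/

namespace DBun

variable {C : Type u} [Category.{v} C] {X : DisplayTangentStructure C}

/-- The morphism of trivial bundles induced by a morphism of bases. -/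
def trivialMap {N M : C} (f : N ⟶ M) : trivial X N ⟶ trivial X M :=
  ⟨f, f, (Category.comp_id f).trans (Category.id_comp f).symm⟩

theorem linear_trivialMap {N M : C} (f : N ⟶ M) : IsLinear (trivialMap (X := X) f) :=
  (X.zero_natural f).symm

/-- The projection of a bundle, as a morphism to the trivial bundle. -/
def toTrivial (q : DBun X) : q ⟶ trivial X q.base := ⟨q.proj, 𝟙 _, rfl⟩

theorem linear_toTrivial (q : DBun X) : IsLinear q.toTrivial := q.str.lift_map_proj.symm

/-- The pullback of a bundle along a morphism to its base. -/
theorem exists_pullback (q : DBun X) {N : C} (f : N ⟶ q.base) :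
    ∃ (r : DBun X) (φ : r ⟶ q) (i : r.base = N), φ.base = eqToHom i ≫ f ∧ IsLinear φ ∧
      IsPullback φ.total r.proj q.proj φ.base := by
  obtain ⟨W, a, b, -, hs⟩ := X.display_quarrable q.proj q.display f
  -- The substituted bundle is the pullback, in the category of bundles, of `q` mapping to the
  -- trivial bundle on its base along the map of trivial bundles induced by `f`. Both legs are
  -- linear, so the resulting Cartesian arrow is linear too.
  let d : TransverseCospan X :=
    { linear_f := q.linear_toTrivial
      linear_g := linear_trivialMap f
      total_square := hs
      base_square := (square_id_id f).flip }
  have e : b = d.proj := by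
    have : d.proj ≫ 𝟙 N = b ≫ 𝟙 N := d.proj_b₁
    exact ((Category.comp_id _).symm.trans this.symm).trans (Category.comp_id _)
  exact ⟨d.pt, d.fst, rfl, (Category.id_comp _).symm, d.linear_fst,
    (congrArg (fun k => IsPullback a k q.proj f) e).mp hs.isPullback⟩

theorem isHomLift_base {q q' : DBun X} (φ : q ⟶ q') : (P X).IsHomLift φ.base φ :=
  IsHomLift.map (P X) φ

theorem isHomLift_iff {q q' : DBun X} (f : q.base ⟶ q'.base) (φ : q ⟶ q') :
    (P X).IsHomLift f φ ↔ φ.base = f :=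
  ⟨fun h => (@IsHomLift.eq_of_isHomLift _ _ _ _ (P X) q q' f φ h).symm,
    fun h => h ▸ isHomLift_base φ⟩

/-- Since bases are strict here, the lifting relation is an equality of maps of bases, and the
universal property loses all its casts. -/
theorem isStronglyCartesian_iff {q q' : DBun X} (f : q.base ⟶ q'.base) (φ : q ⟶ q') :
    (P X).IsStronglyCartesian f φ ↔ φ.base = f ∧ ∀ (r : DBun X) (g : r.base ⟶ q.base)
      (φ' : r ⟶ q'), φ'.base = g ≫ f → ∃! χ : r ⟶ q, χ.base = g ∧ χ ≫ φ = φ' := by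
  constructor
  · intro h
    refine ⟨(isHomLift_iff _ _).1 h.toIsHomLift, fun r g φ' e => ?_⟩
    obtain ⟨χ, ⟨h₁, h₂⟩, hu⟩ := @Functor.IsStronglyCartesian.universal_property' _ _ _ _ _ _ _ _ _
      _ _ h r g φ' ((isHomLift_iff _ _).2 e)
    exact ⟨χ, ⟨(isHomLift_iff _ _).1 h₁, h₂⟩, fun y hy => hu y ⟨(isHomLift_iff _ _).2 hy.1, hy.2⟩⟩
  · rintro ⟨h, h'⟩
    have := (isHomLift_iff _ _).2 h
    refine ⟨fun {r} g φ' hφ => ?_⟩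
    obtain ⟨χ, ⟨h₁, h₂⟩, hu⟩ := h' r g φ' ((isHomLift_iff (q := r) (q' := q') (g ≫ f) φ').1 hφ)
    exact ⟨χ, ⟨(isHomLift_iff _ _).2 h₁, h₂⟩, fun y hy => hu y ⟨(isHomLift_iff _ _).1 hy.1, hy.2⟩⟩

theorem isStronglyCartesian_of_isPullback {q q' : DBun X} {φ : q ⟶ q'}
    (h : IsPullback φ.total q.proj q'.proj φ.base) : (P X).IsStronglyCartesian φ.base φ := by
  refine (isStronglyCartesian_iff _ _).2 ⟨rfl, fun r g φ' e => ?_⟩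
  have w : φ'.total ≫ q'.proj = (r.proj ≫ g) ≫ φ.base := by
    rw [hom_w, e, Category.assoc]
  refine ⟨⟨h.lift φ'.total (r.proj ≫ g) w, g, h.lift_snd _ _ _⟩,
    ⟨rfl, hom_ext (h.lift_fst _ _ _)⟩, ?_⟩
  rintro χ ⟨rfl, hχ⟩
  refine hom_ext (h.hom_ext ?_ ?_)
  · exact (congrArg Hom.total hχ).trans (h.lift_fst _ _ _).symm
  · exact (hom_w χ).trans (h.lift_snd _ _ _).symm

/-- Cartesian arrows over a fixed map are unique up to isomorphism over the base. One of them comes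
from a pullback square, hence all of them do. -/
theorem isPullback_of_isStronglyCartesian {q q' : DBun X} {f : q.base ⟶ q'.base} {φ : q ⟶ q'}
    (h : (P X).IsStronglyCartesian f φ) : IsPullback φ.total q.proj q'.proj φ.base := by
  obtain ⟨rfl, h⟩ := (isStronglyCartesian_iff _ _).1 h
  obtain ⟨r, ψ, i, hψ, -, hp⟩ := q'.exists_pullback φ.base
  obtain ⟨-, hs⟩ := (isStronglyCartesian_iff _ _).1 (isStronglyCartesian_of_isPullback hp)
  obtain ⟨χ, ⟨b₁, h₁⟩, -⟩ := h r (eqToHom i) ψ hψ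
  obtain ⟨χ', ⟨b₂, h₂⟩, -⟩ := hs q (eqToHom i.symm) φ (by rw [hψ]; simp)
  have e₁ : χ' ≫ χ = 𝟙 q :=
    (h q (𝟙 q.base) φ (Category.id_comp _).symm).unique
      ⟨by rw [comp_base, b₁, b₂]; simp, by rw [Category.assoc, h₁, h₂]⟩ ⟨rfl, Category.id_comp _⟩
  have e₂ : χ ≫ χ' = 𝟙 r :=
    (hs r (𝟙 r.base) ψ (Category.id_comp _).symm).unique
      ⟨by rw [comp_base, b₁, b₂]; simp, by rw [Category.assoc, h₂, h₁]⟩ ⟨rfl, Category.id_comp _⟩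
  exact hp.of_iso ⟨χ.total, χ'.total, congrArg Hom.total e₂, congrArg Hom.total e₁⟩ (Iso.refl _)
    (eqToIso i) (Iso.refl _) ((Category.comp_id _).trans (congrArg Hom.total h₁).symm)
    (by rw [eqToIso.hom, ← b₁]; exact (hom_w χ).symm) (by simp) (by simp [hψ])

instance : (P X).IsFibered :=
  .of_exists_isStronglyCartesian fun q _ f => by
    obtain ⟨r, φ, rfl, hφ, -, hp⟩ := q.exists_pullback f
    replace hφ : φ.base = f := hφ.trans (Category.id_comp _)
    exact ⟨r, φ, hφ ▸ isStronglyCartesian_of_isPullback hp⟩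

theorem exists_linear_cleavage : ∃ κ : Cleavage (P X), IsLinearCleavage κ := by
  have key : ∀ {N M : C} (f : N ⟶ M) (q : (P X).Fiber M),
      ∃ (r : (P X).Fiber N) (φ : r.1 ⟶ q.1), IsLinear φ ∧ (P X).IsStronglyCartesian f φ := by
    rintro N _ f ⟨q, rfl⟩
    obtain ⟨r, φ, rfl, hφ, hl, hp⟩ := q.exists_pullback f
    replace hφ : φ.base = f := hφ.trans (Category.id_comp _)
    exact ⟨⟨r, rfl⟩, φ, hl, hφ ▸ isStronglyCartesian_of_isPullback hp⟩
  choose r φ hl hc using @key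
  exact ⟨⟨r, φ, hc⟩, fun f q => hl f q⟩

end DBun


/-! ### Tangent structures reflected by a faithful functor -/

section Over

variable {F : Type u₁} [Category.{v₁} F] {C : Type u} [Category.{v} C]

theorem functor_comm_of_comm {U : F ⥤ C} {E M : F} {q : E ⟶ M} {E₀ M₀ : C} {q₀ : E₀ ⟶ M₀}
    {e : U.obj E ⟶ E₀} {b : U.obj M ⟶ M₀} (comm : e ≫ q₀ = U.map q ≫ b) {Z : F} {x y : Z ⟶ E}
    (h : x ≫ q = y ≫ q) : (U.map x ≫ e) ≫ q₀ = (U.map y ≫ e) ≫ q₀ := by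
  rw [Category.assoc, comm, ← Category.assoc, ← U.map_comp, h, U.map_comp, Category.assoc,
    Category.assoc, comm]

/-- `(e, b)` carries the addition of `S` to that of `S₀`, over the functor `U`. -/
structure IsAdditiveOver (U : F ⥤ C) {E M : F} {q : E ⟶ M} {E₀ M₀ : C} {q₀ : E₀ ⟶ M₀}
    (S : AdditiveBundle q) (S₀ : AdditiveBundle q₀) (e : U.obj E ⟶ E₀) (b : U.obj M ⟶ M₀) :
    Prop where
  comm : e ≫ q₀ = U.map q ≫ b
  add : U.map S.σ ≫ e = S₀.sum (U.map S.π₀ ≫ e) (U.map S.π₁ ≫ e)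
    (functor_comm_of_comm comm S.isPullback.w)

namespace IsAdditiveOver

variable {U : F ⥤ C} {E M : F} {q : E ⟶ M} {E₀ M₀ : C} {q₀ : E₀ ⟶ M₀}
    {S : AdditiveBundle q} {S₀ : AdditiveBundle q₀} {e : U.obj E ⟶ E₀} {b : U.obj M ⟶ M₀}

theorem map_sum (h : IsAdditiveOver U S S₀ e b) {Z : F} (x y : Z ⟶ E) (hxy : x ≫ q = y ≫ q) :
    U.map (S.sum x y hxy) ≫ e = S₀.sum (U.map x ≫ e) (U.map y ≫ e)
      (functor_comm_of_comm h.comm hxy) := by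
  rw [AdditiveBundle.sum, U.map_comp, Category.assoc, h.add, AdditiveBundle.comp_sum']
  exact S₀.sum_congr (by rw [← Category.assoc, ← U.map_comp, S.pair_π₀])
    (by rw [← Category.assoc, ← U.map_comp, S.pair_π₁]) _

/-- Provides compatibility with the addition `T(+)`, which occurs in the additivity of `ell` and
`flip` and in universality. -/
theorem map (h : IsAdditiveOver U S S₀ e b) {T' : F ⥤ F} {T : C ⥤ C}
    [PreservesPullbackPowers T' q] [PreservesPullbackPowers T q₀]
    (ι : ∀ A, U.obj (T'.obj A) ⟶ T.obj (U.obj A))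
    (hι : ∀ {A B : F} (f : A ⟶ B), U.map (T'.map f) ≫ ι B = ι A ≫ T.map (U.map f)) :
    IsAdditiveOver U (S.map T') (S₀.map T) (ι E ≫ T.map e) (ι M ≫ T.map b) := by
  have comm : (ι E ≫ T.map e) ≫ T.map q₀ = U.map (T'.map q) ≫ ι M ≫ T.map b := by
    rw [Category.assoc, ← T.map_comp, h.comm, T.map_comp, ← Category.assoc, ← hι, Category.assoc]
  refine ⟨comm, ?_⟩
  rw [← (S.map T').sum_π₀_π₁, AdditiveBundle.map_sum, U.map_comp, Category.assoc,
    ← Category.assoc (U.map (T'.map S.σ)), hι, Category.assoc, ← T.map_comp, h.add,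
    ← Category.assoc, AdditiveBundle.comp_map_sum]
  refine AdditiveBundle.sum_congr _ ?_ ?_ _
  · rw [T.map_comp, Category.assoc, ← Category.assoc (ι _), ← hι, ← Category.assoc,
      ← Category.assoc, ← U.map_comp, AdditiveBundle.mapPair_map_π₀, Category.assoc]
  · rw [T.map_comp, Category.assoc, ← Category.assoc (ι _), ← hι, ← Category.assoc,
      ← Category.assoc, ← U.map_comp, AdditiveBundle.mapPair_map_π₁, Category.assoc]

end IsAdditiveOver

end Over

/-- The data of a tangent structure, without its equations. -/
structure PreTangent (F : Type u₁) [Category.{v₁} F] where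
  /-- The tangent functor. -/
  T : F ⥤ F
  /-- The projection. -/
  p : ∀ A : F, T.obj A ⟶ A
  [powers : ∀ A : F, HasPullbackPowers (p A)]
  [preserved : ∀ A : F, PreservedByIterates T (p A)]
  /-- The zero. -/
  zero : ∀ A : F, A ⟶ T.obj A
  /-- The addition. -/
  add : ∀ A : F, pullback (p A) (p A) ⟶ T.obj A
  /-- The vertical lift. -/
  ell : ∀ A : F, T.obj A ⟶ T.obj (T.obj A)
  /-- The canonical flip. -/
  flip : ∀ A : F, T.obj (T.obj A) ⟶ T.obj (T.obj A)

namespace PreTangent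

attribute [instance] PreTangent.powers PreTangent.preserved

variable {F : Type u} [Category.{v} F] {C : Type u₁} [Category.{v} C]

/-- A functor `U` with a transformation `ι : U T ⟶ T U` which is compatible with the tangent
data. -/
structure Map (R : PreTangent F) (𝕋 : TangentStructure C) (U : F ⥤ C) where
  /-- The comparison. -/
  ι : ∀ A : F, U.obj (R.T.obj A) ⟶ 𝕋.T.obj (U.obj A)
  naturality : ∀ {A B : F} (f : A ⟶ B),
    U.map (R.T.map f) ≫ ι B = ι A ≫ 𝕋.T.map (U.map f)
  p : ∀ A : F, ι A ≫ 𝕋.p (U.obj A) = U.map (R.p A)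
  zero : ∀ A : F, U.map (R.zero A) ≫ ι A = 𝕋.zero (U.obj A)
  add : ∀ A : F, U.map (R.add A) ≫ ι A = (𝕋.bundle (U.obj A)).sum
    (U.map (pullback.fst (R.p A) (R.p A)) ≫ ι A) (U.map (pullback.snd (R.p A) (R.p A)) ≫ ι A)
    (functor_comm_of_comm ((p A).trans (Category.comp_id _).symm) pullback.condition)
  ell : ∀ A : F, U.map (R.ell A) ≫ ι (R.T.obj A) ≫ 𝕋.T.map (ι A) = ι A ≫ 𝕋.ell (U.obj A)
  flip : ∀ A : F, U.map (R.flip A) ≫ ι (R.T.obj A) ≫ 𝕋.T.map (ι A) =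
    (ι (R.T.obj A) ≫ 𝕋.T.map (ι A)) ≫ 𝕋.flip (U.obj A)

namespace Map

variable {R : PreTangent F} {𝕋 : TangentStructure C} {U : F ⥤ C} (m : R.Map 𝕋 U)

theorem isAdditiveOver {A : F} (S : AdditiveBundle (R.p A)) (hS : S.add = R.add A) :
    IsAdditiveOver U S (𝕋.bundle (U.obj A)) (m.ι A) (𝟙 _) := by
  refine ⟨(m.p A).trans (Category.comp_id _).symm, ?_⟩
  refine Eq.trans ?_ (m.add A)
  rw [← hS]
  rfl

/-- The comparison of the maps `v` in the universality of the vertical lift. -/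
theorem map_mu {A : F} (S : AdditiveBundle (R.p A)) (hS : S.add = R.add A)
    (h : S.π₀ ≫ R.ell A ≫ R.T.map (R.p A) = S.π₁ ≫ R.zero (R.T.obj A) ≫ R.T.map (R.p A)) :
    U.map (S.mu R.T (R.ell A) (R.zero (R.T.obj A)) h) ≫ m.ι (R.T.obj A) ≫ 𝕋.T.map (m.ι A) =
      (𝕋.bundle (U.obj A)).pair (U.map S.π₀ ≫ m.ι A) (U.map S.π₁ ≫ m.ι A)
        (functor_comm_of_comm ((m.p A).trans (Category.comp_id _).symm) S.isPullback.w) ≫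
      𝕋.vert (U.obj A) := by
  have hm := (m.isAdditiveOver S hS).map m.ι m.naturality
  have e : S.mu R.T (R.ell A) (R.zero (R.T.obj A)) h = (S.map R.T).sum (S.π₀ ≫ R.ell A)
      (S.π₁ ≫ R.zero (R.T.obj A)) (by simpa using h) := by
    rw [← S.pair_mu R.T (R.ell A) (R.zero (R.T.obj A)) h _ _ S.isPullback.w, S.pair_π₀_π₁,
      Category.id_comp]
  rw [e, hm.map_sum, TangentStructure.vert, AdditiveBundle.pair_mu]
  refine AdditiveBundle.sum_congr _ ?_ ?_ _
  · rw [U.map_comp, Category.assoc, m.ell, Category.assoc]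
  · rw [U.map_comp, Category.assoc, ← Category.assoc (U.map (R.zero _)), m.zero, Category.assoc,
      𝕋.zero_natural]

/-- The conditions under which a tangent structure is reflected. -/
structure IsReflecting : Prop where
  faithful : U.Faithful
  mono₁ : ∀ A : F, Mono (m.ι A)
  mono₂ : ∀ A : F, Mono (𝕋.T.map (m.ι A))
  mono₃ : ∀ A : F, Mono (𝕋.T.map (𝕋.T.map (m.ι A)))

variable {m} (hm : m.IsReflecting)

namespace IsReflecting

include hm

theorem ext₀ {Z A : F} {x y : Z ⟶ A} (h : U.map x = U.map y) : x = y :=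
  have := hm.faithful
  U.map_injective h

theorem ext₁ {Z A : F} {x y : Z ⟶ R.T.obj A} (h : U.map x ≫ m.ι A = U.map y ≫ m.ι A) : x = y :=
  have := hm.mono₁ A
  hm.ext₀ ((cancel_mono _).1 h)

/-- The composite `U T² ⟶ T² U` of comparisons is monic, so axioms between maps to `T²` may be
checked in `C`. -/
theorem ext₂ {Z A : F} {x y : Z ⟶ R.T.obj (R.T.obj A)}
    (h : U.map x ≫ m.ι (R.T.obj A) ≫ 𝕋.T.map (m.ι A) =
      U.map y ≫ m.ι (R.T.obj A) ≫ 𝕋.T.map (m.ι A)) : x = y :=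
  have := hm.mono₂ A
  hm.ext₁ ((cancel_mono (𝕋.T.map (m.ι A))).1 (by simpa using h))

theorem ext₃ {Z A : F} {x y : Z ⟶ R.T.obj (R.T.obj (R.T.obj A))}
    (h : U.map x ≫ m.ι (R.T.obj (R.T.obj A)) ≫ 𝕋.T.map (m.ι (R.T.obj A)) ≫
        𝕋.T.map (𝕋.T.map (m.ι A)) =
      U.map y ≫ m.ι (R.T.obj (R.T.obj A)) ≫ 𝕋.T.map (m.ι (R.T.obj A)) ≫
        𝕋.T.map (𝕋.T.map (m.ι A))) : x = y :=
  have := hm.mono₃ A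
  hm.ext₂ ((cancel_mono (𝕋.T.map (𝕋.T.map (m.ι A)))).1 (by simpa using h))

/-- The additive bundle structure on the projection. -/
def bundle (A : F) : AdditiveBundle (R.p A) :=
  .ofJointlyMonic (R.p A) (fun _ : Unit => U) (fun _ => 𝕋.bundle (U.obj A)) (fun _ => m.ι A)
    (fun _ => 𝟙 _) (fun _ => (m.p A).trans (Category.comp_id _).symm)
    (fun _ _ _ h => hm.ext₁ (h ())) (R.add A) (R.zero A)
    (hm.ext₀ (by
      rw [U.map_comp, ← m.p, ← Category.assoc, m.add, AdditiveBundle.sum_proj, Category.assoc,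
        m.p, U.map_comp]))
    (hm.ext₀ (by
      rw [U.map_comp, ← m.p, ← Category.assoc, m.zero, 𝕋.zero_p, U.map_id]))
    (fun _ => m.add A) (fun _ => (m.zero A).trans (Category.id_comp _).symm)

theorem bundle_isAdditiveOver (A : F) :
    IsAdditiveOver U (hm.bundle A) (𝕋.bundle (U.obj A)) (m.ι A) (𝟙 _) :=
  m.isAdditiveOver _ rfl

theorem natural {A B : F} (f : A ⟶ B) :
    IsAdditiveMorphism (hm.bundle A) (hm.bundle B) (R.T.map f) f := by
  have comm : R.T.map f ≫ R.p B = R.p A ≫ f := hm.ext₀ (by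
    rw [U.map_comp, ← m.p, ← Category.assoc, m.naturality, Category.assoc, 𝕋.p_natural,
      ← Category.assoc, m.p, U.map_comp])
  refine .of_sum comm (hm.ext₁ ?_) (hm.ext₁ ?_)
  · rw [U.map_comp, Category.assoc, m.naturality, ← Category.assoc,
      (hm.bundle_isAdditiveOver A).add, (𝕋.natural _).sum_comp,
      (hm.bundle_isAdditiveOver B).map_sum]
    exact AdditiveBundle.sum_congr _
      (by rw [U.map_comp, Category.assoc, Category.assoc, m.naturality])
      (by rw [U.map_comp, Category.assoc, Category.assoc, m.naturality]) _
  · change U.map (R.zero A ≫ _) ≫ _ = U.map (f ≫ R.zero B) ≫ _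
    rw [U.map_comp, Category.assoc, m.naturality, ← Category.assoc, m.zero, 𝕋.zero_natural,
      U.map_comp, Category.assoc, m.zero]

theorem ell_natural {A B : F} (f : A ⟶ B) :
    R.T.map f ≫ R.ell B = R.ell A ≫ R.T.map (R.T.map f) := by
  refine hm.ext₂ ?_
  rw [U.map_comp, Category.assoc, m.ell, ← Category.assoc, m.naturality, Category.assoc,
    𝕋.ell_natural, U.map_comp, Category.assoc, ← Category.assoc (U.map (R.T.map _)), m.naturality,
    Category.assoc, ← 𝕋.T.map_comp, m.naturality, 𝕋.T.map_comp, ← Category.assoc, ← m.ell]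
  simp only [Category.assoc]

theorem flip_natural {A B : F} (f : A ⟶ B) :
    R.T.map (R.T.map f) ≫ R.flip B = R.flip A ≫ R.T.map (R.T.map f) := by
  have e : ∀ {Z : F} (x : Z ⟶ R.T.obj (R.T.obj A)),
      U.map (x ≫ R.T.map (R.T.map f)) ≫ m.ι (R.T.obj B) ≫ 𝕋.T.map (m.ι B) =
      (U.map x ≫ m.ι (R.T.obj A) ≫ 𝕋.T.map (m.ι A)) ≫ 𝕋.T.map (𝕋.T.map (U.map f)) := by
    intro Z x
    rw [U.map_comp, Category.assoc, ← Category.assoc (U.map (R.T.map _)), m.naturality,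
      Category.assoc, ← 𝕋.T.map_comp, m.naturality, 𝕋.T.map_comp]
    simp only [Category.assoc]
  refine hm.ext₂ ?_
  have e' := e (𝟙 _)
  rw [Category.id_comp, U.map_id, Category.id_comp] at e'
  rw [e, m.flip, U.map_comp, Category.assoc, m.flip, ← Category.assoc, e', Category.assoc,
    𝕋.flip_natural]
  simp only [Category.assoc]

omit hm in
theorem map_comp_ι₂ {Z A B : F} (f : A ⟶ R.T.obj B) (x : Z ⟶ R.T.obj A) :
    U.map (x ≫ R.T.map f) ≫ m.ι (R.T.obj B) ≫ 𝕋.T.map (m.ι B) =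
      U.map x ≫ m.ι A ≫ 𝕋.T.map (U.map f ≫ m.ι B) := by
  rw [U.map_comp, Category.assoc, ← Category.assoc (U.map (R.T.map _)), m.naturality,
    𝕋.T.map_comp]
  simp only [Category.assoc]

theorem ell_additive (A : F) :
    IsAdditiveMorphism (hm.bundle A) ((hm.bundle A).map R.T) (R.ell A) (hm.bundle A).zero := by
  have h := (hm.bundle_isAdditiveOver A).map m.ι m.naturality
  have comm : R.ell A ≫ R.T.map (R.p A) = R.p A ≫ R.zero A := hm.ext₁ (by
    rw [U.map_comp, Category.assoc, m.naturality, ← m.p A, 𝕋.T.map_comp, U.map_comp,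
      Category.assoc (U.map (R.p A)), m.zero, ← Category.assoc, ← Category.assoc,
      Category.assoc (U.map _), m.ell, Category.assoc, (𝕋.ell_additive _).comm, ← m.p,
      Category.assoc]
    rfl)
  refine .of_sum comm (hm.ext₂ ?_) (hm.ext₂ ?_)
  · rw [h.map_sum, U.map_comp, Category.assoc, m.ell, ← Category.assoc,
      (hm.bundle_isAdditiveOver A).add, (𝕋.ell_additive _).sum_comp]
    exact AdditiveBundle.sum_congr _ (by rw [U.map_comp, Category.assoc, Category.assoc, m.ell])
      (by rw [U.map_comp, Category.assoc, Category.assoc, m.ell]) _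
  · change U.map (R.zero A ≫ _) ≫ _ = U.map (R.zero A ≫ R.T.map (R.zero A)) ≫ _
    rw [U.map_comp, Category.assoc, m.ell, ← Category.assoc, m.zero, map_comp_ι₂, m.zero,
      ← Category.assoc, m.zero]
    exact (𝕋.ell_additive _).zero

theorem flip_additive (A : F) :
    IsAdditiveMorphism ((hm.bundle A).map R.T) (hm.bundle (R.T.obj A)) (R.flip A) (𝟙 _) := by
  have h := (hm.bundle_isAdditiveOver A).map m.ι m.naturality
  have hp : R.flip A ≫ R.p (R.T.obj A) = R.T.map (R.p A) := hm.ext₁ (by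
    rw [U.map_comp, ← m.p, Category.assoc, Category.assoc, ← 𝕋.p_natural,
      ← Category.assoc (m.ι _), ← Category.assoc, m.flip, m.naturality, ← m.p, Category.assoc,
      𝕋.flip_p, 𝕋.T.map_comp, Category.assoc])
  have comm : R.flip A ≫ R.p (R.T.obj A) = R.T.map (R.p A) ≫ 𝟙 _ :=
    hp.trans (Category.comp_id _).symm
  have h' := (hm.bundle_isAdditiveOver (R.T.obj A)).map_sum (((hm.bundle A).map R.T).π₀ ≫ R.flip A)
    (((hm.bundle A).map R.T).π₁ ≫ R.flip A)
    (IsAdditiveMorphism.comm_of_comm comm ((hm.bundle A).map R.T).isPullback.w)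
  refine .of_sum comm (hm.ext₂ ?_) (hm.ext₂ ?_)
  · rw [U.map_comp, Category.assoc, m.flip, ← Category.assoc, h.add, (𝕋.flip_additive _).sum_comp]
    refine Eq.trans ?_ ((congrArg (fun k => k ≫ 𝕋.T.map (m.ι A)) h').symm.trans
      (Category.assoc _ _ _))
    rw [(𝕋.natural (m.ι A)).sum_comp]
    exact AdditiveBundle.sum_congr _
      (by simp only [U.map_comp, Category.assoc, m.flip])
      (by simp only [U.map_comp, Category.assoc, m.flip]) _
  · change U.map (R.T.map (R.zero A) ≫ _) ≫ _ = U.map (𝟙 _ ≫ R.zero (R.T.obj A)) ≫ _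
    have e := map_comp_ι₂ (m := m) (R.zero A) (𝟙 _)
    rw [Category.id_comp, U.map_id, Category.id_comp] at e
    rw [Category.id_comp, U.map_comp, Category.assoc, m.flip, ← Category.assoc, e, m.zero,
      Category.assoc, 𝕋.zero_flip, ← Category.assoc (U.map (R.zero _)), m.zero, 𝕋.zero_natural]

theorem flip_flip (A : F) : R.flip A ≫ R.flip A = 𝟙 _ := hm.ext₂ (by
  rw [U.map_comp, Category.assoc, m.flip, ← Category.assoc, m.flip, Category.assoc, 𝕋.flip_flip,
    U.map_id, Category.comp_id, Category.id_comp])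

theorem ell_flip (A : F) : R.ell A ≫ R.flip A = R.ell A := hm.ext₂ (by
  rw [U.map_comp, Category.assoc, m.flip, ← Category.assoc, m.ell, Category.assoc, 𝕋.ell_flip])

/-- The composite `U T³ ⟶ T³ U`. -/
def ι₃ (_ : m.IsReflecting) (A : F) :
    U.obj (R.T.obj (R.T.obj (R.T.obj A))) ⟶ 𝕋.T.obj (𝕋.T.obj (𝕋.T.obj (U.obj A))) :=
  m.ι (R.T.obj (R.T.obj A)) ≫ 𝕋.T.map (m.ι (R.T.obj A)) ≫ 𝕋.T.map (𝕋.T.map (m.ι A))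

/-- With the next three lemmas, this moves the two flips and the two lifts valued in `T³` across the
threefold comparison. The coherence axioms of `𝕋` can then be applied directly. -/
theorem map_flip_ι₃ (A : F) : U.map (R.flip (R.T.obj A)) ≫ hm.ι₃ A =
    hm.ι₃ A ≫ 𝕋.flip (𝕋.T.obj (U.obj A)) := by
  rw [ι₃, ← Category.assoc (m.ι _), ← Category.assoc, m.flip, Category.assoc,
    ← 𝕋.flip_natural]
  simp only [Category.assoc]

theorem map_map_flip_ι₃ (A : F) : U.map (R.T.map (R.flip A)) ≫ hm.ι₃ A =
    hm.ι₃ A ≫ 𝕋.T.map (𝕋.flip (U.obj A)) := by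
  rw [ι₃, ← Category.assoc, m.naturality, ← 𝕋.T.map_comp, Category.assoc, ← 𝕋.T.map_comp, m.flip,
    𝕋.T.map_comp, Category.assoc]

theorem map_ell_ι₃ (A : F) : U.map (R.ell (R.T.obj A)) ≫ hm.ι₃ A =
    (m.ι (R.T.obj A) ≫ 𝕋.T.map (m.ι A)) ≫ 𝕋.ell (𝕋.T.obj (U.obj A)) := by
  rw [ι₃, ← Category.assoc (m.ι _), ← Category.assoc, m.ell, Category.assoc, ← 𝕋.ell_natural]
  simp only [Category.assoc]

theorem map_map_ell_ι₃ (A : F) : U.map (R.T.map (R.ell A)) ≫ hm.ι₃ A =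
    (m.ι (R.T.obj A) ≫ 𝕋.T.map (m.ι A)) ≫ 𝕋.T.map (𝕋.ell (U.obj A)) := by
  rw [ι₃, ← Category.assoc, m.naturality, ← 𝕋.T.map_comp, Category.assoc, ← 𝕋.T.map_comp, m.ell,
    𝕋.T.map_comp, Category.assoc]

theorem ext₃' {Z A : F} {x y : Z ⟶ R.T.obj (R.T.obj (R.T.obj A))}
    (h : U.map x ≫ hm.ι₃ A = U.map y ≫ hm.ι₃ A) : x = y := hm.ext₃ h

theorem ell_map_ell (A : F) :
    R.ell A ≫ R.T.map (R.ell A) = R.ell A ≫ R.ell (R.T.obj A) := hm.ext₃' (by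
  rw [U.map_comp, U.map_comp, Category.assoc, Category.assoc, map_map_ell_ι₃, map_ell_ι₃,
    ← Category.assoc, m.ell, Category.assoc, ← Category.assoc (U.map _), m.ell, Category.assoc,
    𝕋.ell_map_ell])

theorem flip_hexagon (A : F) : R.T.map (R.flip A) ≫ R.flip (R.T.obj A) ≫ R.T.map (R.flip A) =
    R.flip (R.T.obj A) ≫ R.T.map (R.flip A) ≫ R.flip (R.T.obj A) := hm.ext₃' (by
  have e₁ : ∀ {Z : C} (k : _ ⟶ Z), U.map (R.flip (R.T.obj A)) ≫ hm.ι₃ A ≫ k =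
      hm.ι₃ A ≫ 𝕋.flip (𝕋.T.obj (U.obj A)) ≫ k := fun k => by
    rw [← Category.assoc, map_flip_ι₃, Category.assoc]
  have e₂ : ∀ {Z : C} (k : _ ⟶ Z), U.map (R.T.map (R.flip A)) ≫ hm.ι₃ A ≫ k =
      hm.ι₃ A ≫ 𝕋.T.map (𝕋.flip (U.obj A)) ≫ k := fun k => by
    rw [← Category.assoc, map_map_flip_ι₃, Category.assoc]
  simp only [U.map_comp, Category.assoc, map_flip_ι₃, map_map_flip_ι₃, e₁, e₂, 𝕋.flip_hexagon])

theorem ell_flip_flip (A : F) : R.ell (R.T.obj A) ≫ R.T.map (R.flip A) ≫ R.flip (R.T.obj A) =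
    R.flip A ≫ R.T.map (R.ell A) := hm.ext₃' (by
  have e₂ : ∀ {Z : C} (k : _ ⟶ Z), U.map (R.T.map (R.flip A)) ≫ hm.ι₃ A ≫ k =
      hm.ι₃ A ≫ 𝕋.T.map (𝕋.flip (U.obj A)) ≫ k := fun k => by
    rw [← Category.assoc, map_map_flip_ι₃, Category.assoc]
  have e₃ : ∀ {Z : C} (k : _ ⟶ Z), U.map (R.ell (R.T.obj A)) ≫ hm.ι₃ A ≫ k =
      (m.ι (R.T.obj A) ≫ 𝕋.T.map (m.ι A)) ≫ 𝕋.ell (𝕋.T.obj (U.obj A)) ≫ k := fun k => by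
    rw [← Category.assoc, map_ell_ι₃, Category.assoc]
  rw [U.map_comp, U.map_comp, U.map_comp, Category.assoc, Category.assoc, Category.assoc,
    map_flip_ι₃, e₂, e₃, map_map_ell_ι₃, 𝕋.ell_flip_flip, ← Category.assoc (U.map (R.flip A)),
    m.flip]
  simp only [Category.assoc])

/-- The tangent structure reflected by `U`. -/
def tangentStructure
    (universal : ∀ (A : F) (k : ℕ) (h : (hm.bundle A).π₀ ≫ R.ell A ≫ R.T.map (R.p A) =
      (hm.bundle A).π₁ ≫ R.zero (R.T.obj A) ≫ R.T.map (R.p A)), IsPullback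
        ((iter R.T k).map ((hm.bundle A).mu R.T (R.ell A) (R.zero (R.T.obj A)) h))
        ((iter R.T k).map ((hm.bundle A).π₀ ≫ R.p A))
        ((iter R.T k).map (R.T.map (R.p A))) ((iter R.T k).map (R.zero A))) :
    TangentStructure F where
  T := R.T
  p := R.p
  bundle := hm.bundle
  natural := hm.natural
  ell := R.ell
  ell_natural := hm.ell_natural
  ell_additive := hm.ell_additive
  flip := R.flip
  flip_natural := hm.flip_natural
  flip_additive := hm.flip_additive
  flip_flip := hm.flip_flip
  ell_flip := hm.ell_flip
  ell_map_ell := hm.ell_map_ell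
  flip_hexagon := hm.flip_hexagon
  ell_flip_flip := hm.ell_flip_flip
  -- Universality is a statement about limits, which monic comparisons do not reflect; it is
  -- supplied separately in each application.
  universal A k := universal A k _

end IsReflecting

end Map

end PreTangent


open DisplayTangentStructure

/-! ### Universality of the vertical lift along invertible comparisons -/

namespace PreTangent.Map

variable {F : Type u} [Category.{v} F] {C : Type u₁} [Category.{v} C] {R : PreTangent F}
  {𝕋 : TangentStructure C} {U : F ⥤ C} (m : R.Map 𝕋 U)

/-- When `ι` is invertible and `U` preserves the second power of `p`, the image of the universality
square is isomorphic to the one in `C`, whose images under the iterates of `T` are pullbacks. -/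
theorem isPullback_iter_map_mu [∀ A, IsIso (m.ι A)] {A : F} [PreservesPullbackPowers U (R.p A)]
    (S : AdditiveBundle (R.p A)) (hS : S.add = R.add A)
    (h : S.π₀ ≫ R.ell A ≫ R.T.map (R.p A) = S.π₁ ≫ R.zero (R.T.obj A) ≫ R.T.map (R.p A))
    (k : ℕ) : IsPullback
      ((iter 𝕋.T k).map (U.map (S.mu R.T (R.ell A) (R.zero (R.T.obj A)) h)))
      ((iter 𝕋.T k).map (U.map (S.π₀ ≫ R.p A)))
      ((iter 𝕋.T k).map (U.map (R.T.map (R.p A)))) ((iter 𝕋.T k).map (U.map (R.zero A))) := by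
  have hp : IsPullback (U.map S.π₀ ≫ m.ι A) (U.map S.π₁ ≫ m.ι A) (𝕋.p (U.obj A))
      (𝕋.p (U.obj A)) :=
    (S.isPullback_map U).of_iso (Iso.refl _) (asIso (m.ι A)) (asIso (m.ι A)) (Iso.refl _)
      (by simp) (by simp) (by simp [m.p]) (by simp [m.p])
  let e : U.obj S.E₂ ≅ (𝕋.bundle (U.obj A)).E₂ :=
    hp.isoIsPullback _ _ (𝕋.bundle (U.obj A)).isPullback
  have he : e.hom = (𝕋.bundle (U.obj A)).pair (U.map S.π₀ ≫ m.ι A) (U.map S.π₁ ≫ m.ι A) hp.w := by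
    apply (𝕋.bundle (U.obj A)).E₂_ext
    · rw [AdditiveBundle.pair_π₀]
      exact IsPullback.isoIsPullback_hom_fst _ _ _ _
    · rw [AdditiveBundle.pair_π₁]
      exact IsPullback.isoIsPullback_hom_snd _ _ _ _
  have h₁ : U.map (S.mu R.T (R.ell A) (R.zero (R.T.obj A)) h) ≫ m.ι (R.T.obj A) ≫
      𝕋.T.map (m.ι A) = e.hom ≫ 𝕋.vert (U.obj A) := by rw [he]; exact m.map_mu S hS h
  have h₂ : U.map (S.π₀ ≫ R.p A) = e.hom ≫ (𝕋.bundle (U.obj A)).π₀ ≫ 𝕋.p _ := by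
    rw [he, AdditiveBundle.pair_π₀_assoc, U.map_comp, Category.assoc, m.p]
  refine (𝕋.universal (U.obj A) k).of_iso ((iter 𝕋.T k).mapIso e.symm)
    ((iter 𝕋.T k).mapIso (asIso (m.ι (R.T.obj A) ≫ 𝕋.T.map (m.ι A))).symm) (Iso.refl _)
    ((iter 𝕋.T k).mapIso (asIso (m.ι A)).symm) ?_ ?_ ?_ ?_
  · have h₁' : 𝕋.vert (U.obj A) ≫ (asIso (m.ι (R.T.obj A) ≫ 𝕋.T.map (m.ι A))).symm.hom =
        e.symm.hom ≫ U.map (S.mu R.T (R.ell A) (R.zero (R.T.obj A)) h) := by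
      rw [Iso.symm_hom, Iso.comp_inv_eq, Iso.symm_hom, Category.assoc, Iso.eq_inv_comp]
      exact h₁.symm
    exact ((iter 𝕋.T k).map_comp _ _).symm.trans ((congrArg (iter 𝕋.T k).map h₁').trans
      ((iter 𝕋.T k).map_comp _ _))
  · simp only [Functor.mapIso_hom, ← Functor.map_comp, Iso.refl_hom, Category.comp_id]
    congr 1
    rw [h₂, Iso.symm_hom, Iso.inv_hom_id_assoc]
  · simp only [Functor.mapIso_hom, ← Functor.map_comp]
    congr 1
    rw [Iso.symm_hom, Iso.comp_inv_eq, Iso.symm_hom, Category.assoc, Iso.eq_inv_comp, asIso_hom,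
      asIso_hom, m.naturality, Category.assoc, ← 𝕋.T.map_comp, m.p]
  · simp only [Functor.mapIso_hom, ← Functor.map_comp, Iso.refl_hom, Category.id_comp]
    congr 1
    rw [Iso.symm_hom, Iso.comp_inv_eq, asIso_hom, m.zero]
    rfl

theorem IsReflecting.vert_condition {m : R.Map 𝕋 U} (hm : m.IsReflecting) (A : F) :
    (hm.bundle A).π₀ ≫ R.ell A ≫ R.T.map (R.p A) =
      (hm.bundle A).π₁ ≫ R.zero (R.T.obj A) ≫ R.T.map (R.p A) := by
  have h₀ := (hm.ell_additive A).comm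
  have h₁ : R.zero (R.T.obj A) ≫ R.T.map (R.p A) = R.p A ≫ R.zero A := (hm.natural (R.p A)).zero
  rw [h₀, h₁, ← Category.assoc, ← Category.assoc, (hm.bundle A).isPullback.w]
  rfl

end PreTangent.Map

/-! ### The pointwise tangent structure on bundles and the tangent fibration -/

namespace DBun

variable {C : Type u} [Category.{v} C] (X : DisplayTangentStructure C)

/-- The tangent functor of bundles. -/
def tangentFunctor : DBun X ⥤ DBun X where
  obj q := ⟨_, _, X.T.map q.proj, q.str.tangent q.display, X.map_display _ q.display⟩
  map f := ⟨X.T.map f.total, X.T.map f.base, by rw [← X.T.map_comp, hom_w, X.T.map_comp]⟩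
  map_id q := hom_ext (X.T.map_id _)
  map_comp f g := hom_ext (X.T.map_comp _ _)

/-- The projection of tangent bundles. -/
def tangentProj (q : DBun X) : (tangentFunctor X).obj q ⟶ q :=
  ⟨X.p _, X.p _, (X.p_natural _).symm⟩

variable {X}

theorem linear_id (q : DBun X) : IsLinear (𝟙 q) := by
  change 𝟙 _ ≫ _ = _ ≫ X.T.map (𝟙 _)
  simp

theorem IsLinear.comp {q q' q'' : DBun X} {f : q ⟶ q'} {g : q' ⟶ q''} (hf : IsLinear f)
    (hg : IsLinear g) : IsLinear (f ≫ g) := by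
  change (f.total ≫ g.total) ≫ _ = _ ≫ X.T.map (f.total ≫ g.total)
  rw [Category.assoc, hg, ← Category.assoc, hf, Category.assoc, X.T.map_comp]

/-- The flip turns `T(p)` into `p`, after which the claim is naturality of `p` at the lift.
Linearity is what permits pullbacks of bundles along tangent projections. -/
theorem linear_tangentProj (q : DBun X) : IsLinear (tangentProj X q) := by
  change X.p _ ≫ _ = (X.T.map q.str.lift ≫ X.flip _) ≫ X.T.map (X.p _)
  rw [Category.assoc, X.flip_map_p, X.p_natural]

/-- Each further factor is a pullback of linear morphisms, transverse on total objects and on bases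
because powers of `p` are transverse there. Linearity of `w` is carried along so that the induction
can continue. -/
theorem exists_isPower (q : DBun X) (n : ℕ) : ∃ (W : DBun X) (w : W ⟶ q)
    (π : Fin n → (W ⟶ (tangentFunctor X).obj q)), IsLinear w ∧
      IsPower (X.p q.total) w.total (fun i => (π i).total) ∧
      IsPower (X.p q.base) w.base (fun i => (π i).base) := by
  induction n with
  | zero =>
    exact ⟨q, 𝟙 q, fun i => i.elim0, linear_id q, (IsPower.zero (X.p q.total) _).congr rfl fun _ => rfl,
      (IsPower.zero (X.p q.base) _).congr rfl fun _ => rfl⟩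
  | succ n ih =>
    obtain ⟨W, w, π, hl, ht, hb⟩ := ih
    obtain ⟨_, _, _, st⟩ := exists_square_of_isPower ht
    obtain ⟨_, _, _, sb⟩ := exists_square_of_isPower hb
    let d : TransverseCospan X :=
      { linear_f := linear_tangentProj q
        linear_g := hl
        total_square := st
        base_square := sb }
    refine ⟨d.pt, d.snd ≫ w, Fin.cons d.fst (fun i => d.snd ≫ π i), d.linear_snd.comp hl,
      (ht.succ st.isPullback).congr rfl fun i => ?_, (hb.succ sb.isPullback).congr rfl fun i => ?_⟩
    · refine Fin.cases ?_ (fun j => ?_) i <;> rfl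
    · refine Fin.cases ?_ (fun j => ?_) i <;> rfl

/-- The total objects of iterated tangent bundles. -/
def iterTotal (k : ℕ) : iter (tangentFunctor X) k ⋙ totalFunctor X ≅ totalFunctor X ⋙ iter X.T k :=
  iterIso (tangentFunctor X) X.T (totalFunctor X)
    (NatIso.ofComponents (fun q => Iso.refl (X.T.obj q.total)) fun f =>
      (Category.comp_id (X.T.map f.total)).trans (Category.id_comp (X.T.map f.total)).symm) k

/-- The bases of iterated tangent bundles. -/
def iterBase (k : ℕ) : iter (tangentFunctor X) k ⋙ P X ≅ P X ⋙ iter X.T k :=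
  iterIso (tangentFunctor X) X.T (P X)
    (NatIso.ofComponents (fun q => Iso.refl (X.T.obj q.base)) fun f =>
      (Category.comp_id (X.T.map f.base)).trans (Category.id_comp (X.T.map f.base)).symm) k

instance (q : DBun X) : HasPullbackPowers (tangentProj X q) := ⟨fun n => by
  obtain ⟨W, w, π, -, ht, hb⟩ := q.exists_isPower n
  exact (isPower_of_total_of_base (p := tangentProj X q) ht hb).hasLimit⟩

instance (q : DBun X) : PreservesPullbackPowers (totalFunctor X) (tangentProj X q) := ⟨fun n => by
  obtain ⟨W, w, π, -, ht, hb⟩ := q.exists_isPower n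
  exact (isPower_of_total_of_base (p := tangentProj X q) ht hb).preservesLimit _ ht⟩

instance (q : DBun X) : PreservesPullbackPowers (P X) (tangentProj X q) := ⟨fun n => by
  obtain ⟨W, w, π, -, ht, hb⟩ := q.exists_isPower n
  exact (isPower_of_total_of_base (p := tangentProj X q) ht hb).preservesLimit _ hb⟩

instance (q : DBun X) : PreservedByIterates (tangentFunctor X) (tangentProj X q) :=
  ⟨fun k => ⟨fun n => by
    have hpt := (X.preserved q.total).preserves k
    have hpb := (X.preserved q.base).preserves k
    obtain ⟨W, w, π, -, ht, hb⟩ := q.exists_isPower n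
    refine (isPower_of_total_of_base (p := tangentProj X q) ht hb).preservesLimit _
      (isPower_of_total_of_base ?_ ?_)
    · exact IsPower.of_natIso (iterTotal k).symm (p := tangentProj X q) (w := w) (π := π)
        (ht.map (iter X.T k))
    · exact IsPower.of_natIso (iterBase k).symm (p := tangentProj X q) (w := w) (π := π)
        (hb.map (iter X.T k))⟩⟩

theorem isPullback_iter_of_total_of_base {A B D E : DBun X} {f : A ⟶ B} {g : A ⟶ D} {h : B ⟶ E}
    {k : D ⟶ E} (n : ℕ)
    (ht : IsPullback ((iter X.T n).map f.total) ((iter X.T n).map g.total)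
      ((iter X.T n).map h.total) ((iter X.T n).map k.total))
    (hb : IsPullback ((iter X.T n).map f.base) ((iter X.T n).map g.base)
      ((iter X.T n).map h.base) ((iter X.T n).map k.base)) :
    IsPullback ((iter (tangentFunctor X) n).map f) ((iter (tangentFunctor X) n).map g)
      ((iter (tangentFunctor X) n).map h) ((iter (tangentFunctor X) n).map k) :=
  isPullback_of_total_of_base (isPullback_of_natIso (iterTotal n).symm ht)
    (isPullback_of_natIso (iterBase n).symm hb)

variable (X) in
/-- The pointwise tangent data. -/
def preTangent : PreTangent (DBun X) where
  T := tangentFunctor X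
  p := tangentProj X
  zero q := ⟨X.zero _, X.zero _, X.zero_natural _⟩
  add q := ⟨(X.bundle q.total).sum (pullback.fst (tangentProj X q) (tangentProj X q)).total
      (pullback.snd (tangentProj X q) (tangentProj X q)).total
      (congrArg Hom.total (pullback.condition (f := tangentProj X q) (g := tangentProj X q))),
    (X.bundle q.base).sum (pullback.fst (tangentProj X q) (tangentProj X q)).base
      (pullback.snd (tangentProj X q) (tangentProj X q)).base
      (congrArg Hom.base (pullback.condition (f := tangentProj X q) (g := tangentProj X q))), by
    refine ((X.natural q.proj).sum_comp _ _ _).trans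
      (((X.bundle q.base).sum_congr ?_ ?_ _).trans ((X.bundle q.base).comp_sum' _ _ _ _).symm)
    · exact hom_w (pullback.fst (tangentProj X q) (tangentProj X q))
    · exact hom_w (pullback.snd (tangentProj X q) (tangentProj X q))⟩
  ell q := ⟨X.ell _, X.ell _, (X.ell_natural _).symm⟩
  flip q := ⟨X.flip _, X.flip _, (X.flip_natural _).symm⟩

variable (X) in
/-- The tangent data on total objects. -/
def totalMap : (preTangent X).Map X.toTangentStructure (totalFunctor X) where
  ι q := 𝟙 (X.T.obj q.total)
  naturality f := (Category.comp_id _).trans (Category.id_comp _).symm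
  p q := Category.id_comp _
  zero q := Category.comp_id _
  add q := (Category.comp_id _).trans
    ((X.bundle q.total).sum_congr (Category.comp_id _).symm (Category.comp_id _).symm _)
  ell q := by
    change X.ell q.total ≫ 𝟙 (X.T.obj (X.T.obj q.total)) ≫ X.T.map (𝟙 (X.T.obj q.total)) =
      𝟙 (X.T.obj q.total) ≫ X.ell q.total
    simp
  flip q := by
    change X.flip q.total ≫ 𝟙 (X.T.obj (X.T.obj q.total)) ≫ X.T.map (𝟙 (X.T.obj q.total)) =
      (𝟙 (X.T.obj (X.T.obj q.total)) ≫ X.T.map (𝟙 (X.T.obj q.total))) ≫ X.flip q.total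
    simp

variable (X) in
/-- The tangent data on bases. -/
def baseMap : (preTangent X).Map X.toTangentStructure (P X) where
  ι q := 𝟙 (X.T.obj q.base)
  naturality f := (Category.comp_id _).trans (Category.id_comp _).symm
  p q := Category.id_comp _
  zero q := Category.comp_id _
  add q := (Category.comp_id _).trans
    ((X.bundle q.base).sum_congr (Category.comp_id _).symm (Category.comp_id _).symm _)
  ell q := by
    change X.ell q.base ≫ 𝟙 (X.T.obj (X.T.obj q.base)) ≫ X.T.map (𝟙 (X.T.obj q.base)) =
      𝟙 (X.T.obj q.base) ≫ X.ell q.base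
    simp
  flip q := by
    change X.flip q.base ≫ 𝟙 (X.T.obj (X.T.obj q.base)) ≫ X.T.map (𝟙 (X.T.obj q.base)) =
      (𝟙 (X.T.obj (X.T.obj q.base)) ≫ X.T.map (𝟙 (X.T.obj q.base))) ≫ X.flip q.base
    simp

instance (q : DBun X) : IsIso ((totalMap X).ι q) := inferInstanceAs (IsIso (𝟙 (X.T.obj q.total)))

instance (q : DBun X) : IsIso ((baseMap X).ι q) := inferInstanceAs (IsIso (𝟙 (X.T.obj q.base)))

theorem isReflecting_totalMap : (totalMap X).IsReflecting where
  faithful := inferInstance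
  mono₁ _ := inferInstance
  mono₂ _ := inferInstance
  mono₃ _ := inferInstance

variable (X) in
/-- The pointwise tangent structure on bundles. -/
def tangentStructure : TangentStructure (DBun X) :=
  -- Total objects alone detect equations, since `totalFunctor` is faithful. The universality square
  -- must be checked on bases as well.
  isReflecting_totalMap.tangentStructure (R := preTangent X) fun q k h =>
    have : PreservesPullbackPowers (totalFunctor X) ((preTangent X).p q) :=
      inferInstanceAs (PreservesPullbackPowers (totalFunctor X) (tangentProj X q))
    have : PreservesPullbackPowers (P X) ((preTangent X).p q) :=
      inferInstanceAs (PreservesPullbackPowers (P X) (tangentProj X q))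
    isPullback_iter_of_total_of_base k ((totalMap X).isPullback_iter_map_mu _ rfl h k)
      ((baseMap X).isPullback_iter_map_mu _ rfl h k)

theorem isStrictTangentMorphism_P :
    IsStrictTangentMorphism (tangentStructure X) X.toTangentStructure (P X) where
  obj _ := rfl
  map f := IsHomLift.map (P X) ((tangentFunctor X).map f)
  p q := IsHomLift.map (P X) ((preTangent X).p q)
  zero q := IsHomLift.map (P X) ((preTangent X).zero q)
  ell q := IsHomLift.map (P X) ((preTangent X).ell q)
  flip q := IsHomLift.map (P X) ((preTangent X).flip q)
  preserves_powers q := inferInstanceAs (PreservesPullbackPowers (P X) (tangentProj X q))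
  preserves_universal q :=
    have : PreservesPullbackPowers (P X) ((preTangent X).p q) :=
      inferInstanceAs (PreservesPullbackPowers (P X) (tangentProj X q))
    (baseMap X).isPullback_iter_map_mu (isReflecting_totalMap.bundle q) rfl
      (isReflecting_totalMap.vert_condition q) 0
  add {Z q} a b h a' b' h' ha hb := by
    have ea : a' = a.base := (@IsHomLift.eq_of_isHomLift _ _ _ _ (P X) Z ((tangentFunctor X).obj q) a' a ha)
    have eb : b' = b.base := (@IsHomLift.eq_of_isHomLift _ _ _ _ (P X) Z ((tangentFunctor X).obj q) b' b hb)
    subst ea eb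
    have e := ((baseMap X).isAdditiveOver (isReflecting_totalMap.bundle q) rfl).map_sum a b h
    have e' : ((isReflecting_totalMap.bundle q).sum a b h).base =
        (X.bundle q.base).sum a.base b.base h' :=
      (Category.comp_id _).symm.trans (e.trans ((X.bundle q.base).sum_congr (Category.comp_id _)
        (Category.comp_id _) _))
    exact e' ▸ IsHomLift.map (P X) ((isReflecting_totalMap.bundle q).sum a b h)

theorem isStrictTangentMorphism_totalFunctor :
    IsStrictTangentMorphism (tangentStructure X) X.toTangentStructure (totalFunctor X) where
  obj _ := rfl
  map f := IsHomLift.map (totalFunctor X) ((tangentFunctor X).map f)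
  p q := IsHomLift.map (totalFunctor X) ((preTangent X).p q)
  zero q := IsHomLift.map (totalFunctor X) ((preTangent X).zero q)
  ell q := IsHomLift.map (totalFunctor X) ((preTangent X).ell q)
  flip q := IsHomLift.map (totalFunctor X) ((preTangent X).flip q)
  preserves_powers q := inferInstanceAs (PreservesPullbackPowers (totalFunctor X) (tangentProj X q))
  preserves_universal q :=
    have : PreservesPullbackPowers (totalFunctor X) ((preTangent X).p q) :=
      inferInstanceAs (PreservesPullbackPowers (totalFunctor X) (tangentProj X q))
    (totalMap X).isPullback_iter_map_mu (isReflecting_totalMap.bundle q) rfl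
      (isReflecting_totalMap.vert_condition q) 0
  add {Z q} a b h a' b' h' ha hb := by
    have ea : a' = a.total := (@IsHomLift.eq_of_isHomLift _ _ _ _ (totalFunctor X) Z ((tangentFunctor X).obj q) a' a ha)
    have eb : b' = b.total := (@IsHomLift.eq_of_isHomLift _ _ _ _ (totalFunctor X) Z ((tangentFunctor X).obj q) b' b hb)
    subst ea eb
    have e := ((totalMap X).isAdditiveOver (isReflecting_totalMap.bundle q) rfl).map_sum a b h
    have e' : ((isReflecting_totalMap.bundle q).sum a b h).total =
        (X.bundle q.total).sum a.total b.total h' :=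
      (Category.comp_id _).symm.trans (e.trans ((X.bundle q.total).sum_congr (Category.comp_id _)
        (Category.comp_id _) _))
    exact e' ▸ IsHomLift.map (totalFunctor X) ((isReflecting_totalMap.bundle q).sum a b h)

theorem isPointwise_tangentStructure : IsPointwise X (tangentStructure X) where
  obj q := ⟨_, _, q.str.tangent_isTangentOf q.display, rfl⟩
  base := isStrictTangentMorphism_P
  total := isStrictTangentMorphism_totalFunctor

/-- Cartesian arrows are pullback squares along display maps, and these are preserved by `T`. -/
theorem isTangentFibration_P :
    IsTangentFibration (tangentStructure X) X.toTangentStructure (P X) where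
  isFibered := inferInstance
  strict := isStrictTangentMorphism_P
  cartesian f φ h := by
    obtain ⟨⟩ := h.toIsHomLift
    have hp := isPullback_of_isStronglyCartesian h
    refine isStronglyCartesian_of_isPullback (φ := (tangentFunctor X).map φ) ?_
    exact (isPullback_iter (DBun.display _) hp.flip.flip 1)

end DBun


/-! ### Product projections -/

section Product

variable {C : Type u₁} [Category.{v₁} C] {B : Type u₂} [Category.{v₂} B]

/-- `a` and `b` exhibit their domain as a binary product. -/
structure IsProduct {P X Y : C} (a : P ⟶ X) (b : P ⟶ Y) : Prop where
  exists_lift : ∀ {Z : C} (x : Z ⟶ X) (y : Z ⟶ Y), ∃ l : Z ⟶ P, l ≫ a = x ∧ l ≫ b = y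
  hom_ext : ∀ {Z : C} {l l' : Z ⟶ P}, l ≫ a = l' ≫ a → l ≫ b = l' ≫ b → l = l'

namespace IsProduct

/-- The limit cone of a binary product. -/
def isLimit {P X Y : C} {a : P ⟶ X} {b : P ⟶ Y} (h : IsProduct a b) :
    IsLimit (BinaryFan.mk a b) :=
  BinaryFan.isLimitMk (fun s => (h.exists_lift s.fst s.snd).choose)
    (fun s => (h.exists_lift s.fst s.snd).choose_spec.1)
    (fun s => (h.exists_lift s.fst s.snd).choose_spec.2)
    (fun s _ h₁ h₂ => h.hom_ext (h₁.trans (h.exists_lift s.fst s.snd).choose_spec.1.symm)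
      (h₂.trans (h.exists_lift s.fst s.snd).choose_spec.2.symm))

theorem of_isLimit {P X Y : C} {a : P ⟶ X} {b : P ⟶ Y} (h : IsLimit (BinaryFan.mk a b)) :
    IsProduct a b where
  exists_lift x y := by
    obtain ⟨l, hl⟩ := BinaryFan.IsLimit.lift' h x y
    exact ⟨l, hl.1, hl.2⟩
  hom_ext h₁ h₂ := BinaryFan.IsLimit.hom_ext h h₁ h₂

theorem map {P X Y : C} {a : P ⟶ X} {b : P ⟶ Y} (h : IsProduct a b) (G : C ⥤ B)
    [PreservesLimitsOfShape (Discrete WalkingPair) G] : IsProduct (G.map a) (G.map b) :=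
  of_isLimit (mapIsLimitOfPreservesOfIsLimit G a b h.isLimit)

variable {E M H : C} {p : E ⟶ M} {h : E ⟶ H} (hp : IsProduct p h)

include hp

/-- The base change of `M × H ⟶ M` along `g : Z ⟶ M` is `Z × H ⟶ Z`; the lemma after it is the
converse. -/
theorem isPullback {P Z : C} {a : P ⟶ E} {b : P ⟶ Z} {g : Z ⟶ M} (w : a ≫ p = b ≫ g)
    (hb : IsProduct b (a ≫ h)) : IsPullback a b p g :=
  isPullback_of_exists w
    (fun x y hxy => by
      obtain ⟨l, h₁, h₂⟩ := hb.exists_lift y (x ≫ h)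
      exact ⟨l, hp.hom_ext (by rw [Category.assoc, w, ← Category.assoc, h₁, hxy])
        ((Category.assoc _ _ _).trans h₂), h₁⟩)
    (fun l l' h₁ h₂ => hb.hom_ext h₂ (by rw [← Category.assoc, h₁, Category.assoc]))

theorem of_isPullback {P Z : C} {a : P ⟶ E} {b : P ⟶ Z} {g : Z ⟶ M} (hP : IsPullback a b p g) :
    IsProduct b (a ≫ h) where
  exists_lift x y := by
    obtain ⟨l, h₁, h₂⟩ := hp.exists_lift (x ≫ g) y
    exact ⟨hP.lift l x h₁, hP.lift_snd _ _ _, by rw [IsPullback.lift_fst_assoc, h₂]⟩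
  hom_ext {_ l l'} h₁ h₂ := hP.hom_ext
    (hp.hom_ext (by rw [Category.assoc, hP.w, ← Category.assoc, h₁, Category.assoc, ← hP.w,
      Category.assoc]) (by simpa using h₂)) h₁

/-- A pullback along a product projection is itself a product, so preserving binary products is
enough. This replaces transversality inside the fibres. -/
theorem map_isPullback {P Z : C} {a : P ⟶ E} {b : P ⟶ Z} {g : Z ⟶ M} (hP : IsPullback a b p g)
    (G : C ⥤ B) [PreservesLimitsOfShape (Discrete WalkingPair) G] :
    IsPullback (G.map a) (G.map b) (G.map p) (G.map g) :=
  (hp.map G).isPullback (by rw [← G.map_comp, hP.w, G.map_comp])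
    (G.map_comp a h ▸ (hp.of_isPullback hP).map G)

theorem preservesPullbacksAlong (G : C ⥤ B) [PreservesLimitsOfShape (Discrete WalkingPair) G]
    (hH : ∀ Z : C, ∃ (P : C) (b : P ⟶ Z) (c : P ⟶ H), IsProduct b c) :
    PreservesPullbacksAlong G p := by
  intro Z g
  obtain ⟨P, b, c, hb⟩ := hH Z
  obtain ⟨a, h₁, h₂⟩ := hp.exists_lift (b ≫ g) c
  have := hp.isPullback h₁ (h₂.symm ▸ hb)
  exact ⟨P, a, b, this, hp.map_isPullback this G⟩

end IsProduct

instance preservesProducts_iter (T : C ⥤ C) [PreservesLimitsOfShape (Discrete WalkingPair) T] :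
    ∀ k : ℕ, PreservesLimitsOfShape (Discrete WalkingPair) (iter T k)
  | 0 => inferInstanceAs (PreservesLimitsOfShape (Discrete WalkingPair) (𝟭 C))
  | k + 1 =>
    have := preservesProducts_iter T k
    inferInstanceAs (PreservesLimitsOfShape (Discrete WalkingPair) (iter T k ⋙ T))

theorem preservesProducts_of_isProduct {T : C ⥤ B}
    (h : ∀ X Y : C, ∃ (P : C) (a : P ⟶ X) (b : P ⟶ Y), IsProduct a b ∧
      IsProduct (T.map a) (T.map b)) : PreservesLimitsOfShape (Discrete WalkingPair) T where
  preservesLimit {K} := by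
    obtain ⟨P, a, b, h₁, h₂⟩ := h (K.obj ⟨.left⟩) (K.obj ⟨.right⟩)
    have : PreservesLimit (pair (K.obj ⟨.left⟩) (K.obj ⟨.right⟩)) T :=
      preservesLimit_of_preserves_limit_cone h₁.isLimit
        ((isLimitMapConeBinaryFanEquiv T a b).symm h₂.isLimit)
    exact preservesLimit_of_iso_diagram T (diagramIsoPair K).symm

end Product

/-! ### The fibres of the category of bundles -/

namespace DBun

open DisplayTangentStructure

variable {C : Type u} [Category.{v} C] {X : DisplayTangentStructure C}

/-- A bundle in the fibre over `M` has a total object. -/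
abbrev fiberTotal (X : DisplayTangentStructure C) (M : C) : (P X).Fiber M ⥤ C :=
  Functor.Fiber.fiberInclusion ⋙ totalFunctor X

namespace Fibre

section Basic

variable {M : C}

/-- The projection of a bundle, with prescribed base. -/
def castProj (q : DBun X) : ∀ {M : C} (_ : q.base = M), q.total ⟶ M
  | _, rfl => q.proj

/-- The structure of a bundle, with prescribed base. -/
def castStr (q : DBun X) : ∀ {M : C} (h : q.base = M),
    DifferentialBundle X.toTangentStructure (castProj q h)
  | _, rfl => q.str

theorem comp_castProj {q r : DBun X} {M : C} (hq : q.base = M) (hr : r.base = M)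
    (e : q.total ⟶ r.total) : e ≫ castProj r hr = castProj q hq ↔
      e ≫ r.proj = q.proj ≫ eqToHom (hq.trans hr.symm) := by
  obtain ⟨base, _, _, _, _⟩ := q
  change base = M at hq
  subst hr hq
  simp [castProj]

/-- The projection to `M` of a bundle in the fibre over `M`. -/
def pr (A : (P X).Fiber M) : (fiberTotal X M).obj A ⟶ M := castProj A.1 A.2

/-- The structure of a bundle in the fibre over `M`. -/
def str (A : (P X).Fiber M) : DifferentialBundle X.toTangentStructure (pr A) := castStr A.1 A.2

theorem display (A : (P X).Fiber M) : X.𝒟 (pr A) := by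
  obtain ⟨q, rfl⟩ := A
  exact q.display

theorem lift_str (A : (P X).Fiber M) : (str A).lift = A.1.str.lift := by
  obtain ⟨q, rfl⟩ := A
  rfl

instance (A : (P X).Fiber M) : PreservesPullbackPowers X.T (pr A) :=
  (preservedByIterates (display A)).preserves 1

/-- A morphism of the fibre is a map of total objects over `M`. The equalities of bases stay hidden
in `castProj`, and later arguments use `pr` instead. -/
theorem map_pr {A B : (P X).Fiber M} (f : A ⟶ B) : (fiberTotal X M).map f ≫ pr B = pr A := by
  have e : f.1.base = eqToHom A.2 ≫ 𝟙 M ≫ eqToHom B.2.symm :=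
    @IsHomLift.fac' _ _ _ _ (P X) _ _ _ _ (𝟙 M) f.1 f.2
  refine (comp_castProj A.2 B.2 f.1.total).2 ((hom_w f.1).trans (congrArg _ (e.trans ?_)))
  rw [Category.id_comp, eqToHom_trans]
  rfl

theorem map_pr_assoc {A B : (P X).Fiber M} (f : A ⟶ B) {Z : C} (k : M ⟶ Z) :
    (fiberTotal X M).map f ≫ pr B ≫ k = pr A ≫ k := by
  rw [← Category.assoc, map_pr]

/-- The morphism of the fibre with given action on total objects. -/
def homMk {A B : (P X).Fiber M} (e : (fiberTotal X M).obj A ⟶ (fiberTotal X M).obj B)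
    (h : e ≫ pr B = pr A) : A ⟶ B :=
  ⟨⟨e, eqToHom (A.2.trans B.2.symm), (comp_castProj A.2 B.2 e).1 h⟩,
    IsHomLift.of_fac' _ _ _ A.2 B.2 (by rw [Category.id_comp, eqToHom_trans]; rfl)⟩

instance : (fiberTotal X M).Faithful := inferInstance

theorem hom_ext {A B : (P X).Fiber M} {f g : A ⟶ B}
    (h : (fiberTotal X M).map f = (fiberTotal X M).map g) : f = g :=
  (fiberTotal X M).map_injective h

theorem isPullback_of_isStronglyCartesian {N : C} {f : N ⟶ M} {A : (P X).Fiber N}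
    {B : (P X).Fiber M} {φ : A.1 ⟶ B.1} (h : (P X).IsStronglyCartesian f φ) :
    IsPullback φ.total (pr A) (pr B) f := by
  obtain ⟨q, rfl⟩ := A
  obtain ⟨r, rfl⟩ := B
  obtain rfl := ((isStronglyCartesian_iff _ _).1 h).1
  exact DBun.isPullback_of_isStronglyCartesian h

theorem additive_of_linear {N : C} {f : N ⟶ M} {A : (P X).Fiber N} {B : (P X).Fiber M}
    {e : (fiberTotal X N).obj A ⟶ (fiberTotal X M).obj B} (comm : e ≫ pr B = pr A ≫ f)
    (h : e ≫ (str B).lift = (str A).lift ≫ X.T.map e) :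
    IsAdditiveMorphism (str A).toAdditiveBundle (str B).toAdditiveBundle e f :=
  DifferentialBundle.additive_of_linear comm h

/-- The bundle with base `M` on the nose. -/
def normalize (A : (P X).Fiber M) : DBun X := ⟨M, A.1.total, pr A, str A, display A⟩

theorem exists_square (A B : (P X).Fiber M) : ∃ (W : C) (a : W ⟶ A.1.total) (b : W ⟶ B.1.total),
    X.𝒬.Square a b (pr A) (pr B) := by
  obtain ⟨W, a, b, -, h⟩ := X.display_quarrable (pr A) (display A) (pr B)
  exact ⟨W, a, b, h⟩

/-- The cospan which defines the product of two bundles over `M`. -/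
def cospan (A B : (P X).Fiber M) : TransverseCospan X where
  A := normalize A
  B := normalize B
  D := trivial X M
  f := (normalize A).toTrivial
  g := (normalize B).toTrivial
  linear_f := (normalize A).linear_toTrivial
  linear_g := (normalize B).linear_toTrivial
  total_square := (exists_square A B).choose_spec.choose_spec.choose_spec
  base_square := square_id_id (𝟙 M)

/-- The product of two bundles over `M`. -/
def prod (A B : (P X).Fiber M) : (P X).Fiber M := ⟨(cospan A B).pt, rfl⟩

/-- The first projection. -/
def fst (A B : (P X).Fiber M) : prod A B ⟶ A :=
  homMk (cospan A B).e₀ ((cospan A B).proj_b₀.symm.trans (Category.comp_id _))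

/-- The second projection. -/
def snd (A B : (P X).Fiber M) : prod A B ⟶ B :=
  homMk (cospan A B).e₁ ((cospan A B).proj_b₁.symm.trans (Category.comp_id _))

theorem isPullback_prod (A B : (P X).Fiber M) : IsPullback ((fiberTotal X M).map (fst A B))
    ((fiberTotal X M).map (snd A B)) (pr A) (pr B) :=
  (cospan A B).total_isPullback

theorem isPullback_map_prod (A B : (P X).Fiber M) :
    IsPullback (X.T.map ((fiberTotal X M).map (fst A B)))
      (X.T.map ((fiberTotal X M).map (snd A B))) (X.T.map (pr A)) (X.T.map (pr B)) :=
  (cospan A B).map_total_isPullback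

theorem linear_fst (A B : (P X).Fiber M) : (fiberTotal X M).map (fst A B) ≫ (str A).lift =
    (str (prod A B)).lift ≫ X.T.map ((fiberTotal X M).map (fst A B)) :=
  (cospan A B).lift_e₀.symm

theorem linear_snd (A B : (P X).Fiber M) : (fiberTotal X M).map (snd A B) ≫ (str B).lift =
    (str (prod A B)).lift ≫ X.T.map ((fiberTotal X M).map (snd A B)) :=
  (cospan A B).lift_e₁.symm

theorem isProduct_prod (A B : (P X).Fiber M) : IsProduct (fst A B) (snd A B) where
  exists_lift x y := by
    have w := (map_pr x).trans (map_pr y).symm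
    refine ⟨homMk ((isPullback_prod A B).lift _ _ w) ?_, hom_ext ?_, hom_ext ?_⟩
    · rw [← map_pr (fst A B), IsPullback.lift_fst_assoc, map_pr]
    · exact (isPullback_prod A B).lift_fst _ _ w
    · exact (isPullback_prod A B).lift_snd _ _ w
  hom_ext h₁ h₂ := hom_ext ((isPullback_prod A B).hom_ext
    (congrArg (fiberTotal X M).map h₁) (congrArg (fiberTotal X M).map h₂))

variable (X M) in
/-- The final bundle over `M`. -/
def unit : (P X).Fiber M := ⟨trivial X M, rfl⟩

/-- The map to the final bundle. -/
def toUnit (A : (P X).Fiber M) : A ⟶ unit X M := homMk (pr A) (Category.comp_id _)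

theorem toUnit_unique {A : (P X).Fiber M} (f g : A ⟶ unit X M) : f = g := by
  have e : ∀ f : A ⟶ unit X M, (fiberTotal X M).map f = pr A := fun f =>
    (Category.comp_id _).symm.trans (map_pr f)
  exact hom_ext ((e f).trans (e g).symm)

variable (X M) in
/-- The fibres have finite products. -/
@[reducible] def cartesianMonoidalCategory : CartesianMonoidalCategory ((P X).Fiber M) :=
  .ofChosenFiniteProducts
    ⟨asEmptyCone (unit X M), IsTerminal.ofUniqueHom toUnit fun _ _ => toUnit_unique _ _⟩
    (fun A B => ⟨BinaryFan.mk (fst A B) (snd A B), (isProduct_prod A B).isLimit⟩)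

end Basic

end Fibre

end DBun


namespace DBun

open DisplayTangentStructure

variable {C : Type u} [Category.{v} C] {X : DisplayTangentStructure C}

namespace Fibre

/-! ### The vertical tangent functor -/

variable {M : C}

/-- The tangent bundle of a bundle over `M`, as a bundle over `T M`. -/
abbrev tangent (A : (P X).Fiber M) : (P X).Fiber (X.T.obj M) :=
  (isStrictTangentMorphism_P (X := X)).fiberT A

theorem pr_tangent (A : (P X).Fiber M) : pr (tangent A) = X.T.map (pr A) := by
  obtain ⟨q, rfl⟩ := A
  rfl

theorem lift_tangent (A : (P X).Fiber M) :
    (str (tangent A)).lift = X.T.map (str A).lift ≫ X.flip _ := by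
  obtain ⟨q, rfl⟩ := A
  rfl

/-- Once the base equality of `B` is eliminated, the projection of `T(B)` is `T` of that of `B` by
definition, so the general lemma applies. -/
theorem additive_of_linear_tangent {N : C} {f : N ⟶ X.T.obj M} {A : (P X).Fiber N}
    {B : (P X).Fiber M} {e : (fiberTotal X N).obj A ⟶ X.T.obj ((fiberTotal X M).obj B)}
    (comm : e ≫ X.T.map (pr B) = pr A ≫ f)
    (h : e ≫ X.T.map (str B).lift ≫ X.flip _ = (str A).lift ≫ X.T.map e) :
    IsAdditiveMorphism (str A).toAdditiveBundle ((str B).toAdditiveBundle.map X.T) e f := by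
  obtain ⟨q, rfl⟩ := B
  exact additive_of_linear (B := tangent ⟨q, rfl⟩) comm h

variable (κ : Cleavage (P X))

/-- The Cartesian arrow over the zero section, on total objects. -/
def cleavageMap (A : (P X).Fiber M) : (fiberTotal X M).obj (κ.obj (X.zero M) (tangent A)) ⟶
    X.T.obj ((fiberTotal X M).obj A) :=
  (κ.map (X.zero M) (tangent A)).total

/-- For an arbitrary choice of Cartesian arrows, `T_M A` is the pullback of `T(q)` along `0_M`. The
vertical tangent structure uses no more than this. -/
theorem isPullback_cleavage (A : (P X).Fiber M) :
    IsPullback (cleavageMap κ A) (pr (κ.obj (X.zero M) (tangent A)))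
      (X.T.map (pr A)) (X.zero M) :=
  pr_tangent A ▸ isPullback_of_isStronglyCartesian (κ.cartesian (X.zero M) (tangent A))

instance (A : (P X).Fiber M) : Mono (cleavageMap κ A) :=
  mono_fst_of_isPullback (isPullback_cleavage κ A)

/-- The action of the vertical tangent functor on morphisms. -/
def tMap {A B : (P X).Fiber M} (f : A ⟶ B) :
    κ.obj (X.zero M) (tangent A) ⟶ κ.obj (X.zero M) (tangent B) :=
  have h : (cleavageMap κ A ≫ X.T.map ((fiberTotal X M).map f)) ≫ X.T.map (pr B) =
      pr _ ≫ X.zero M := by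
    rw [Category.assoc, ← X.T.map_comp, map_pr, (isPullback_cleavage κ A).w]
  homMk ((isPullback_cleavage κ B).lift _ _ h) ((isPullback_cleavage κ B).lift_snd _ _ _)

theorem map_tMap {A B : (P X).Fiber M} (f : A ⟶ B) :
    (fiberTotal X M).map (tMap κ f) ≫ cleavageMap κ B =
      cleavageMap κ A ≫ X.T.map ((fiberTotal X M).map f) :=
  (isPullback_cleavage κ B).lift_fst _ _ _

variable (M) in
/-- The vertical tangent functor. -/
def tFunctor : (P X).Fiber M ⥤ (P X).Fiber M where
  obj A := κ.obj (X.zero M) (tangent A)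
  map f := tMap κ f
  map_id A := hom_ext ((cancel_mono (cleavageMap κ A)).1 (by
    rw [map_tMap, (fiberTotal X M).map_id, (fiberTotal X M).map_id, X.T.map_id, Category.comp_id,
      Category.id_comp]))
  map_comp {A B D} f g := hom_ext ((cancel_mono (cleavageMap κ D)).1 (by
    rw [map_tMap, (fiberTotal X M).map_comp, (fiberTotal X M).map_comp, Category.assoc, map_tMap,
      X.T.map_comp, ← Category.assoc, ← Category.assoc, map_tMap]))

/-- The Cartesian arrow `T_M A ⟶ T A`, on total objects. -/
def ι (A : (P X).Fiber M) :
    (fiberTotal X M).obj ((tFunctor M κ).obj A) ⟶ X.T.obj ((fiberTotal X M).obj A) :=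
  cleavageMap κ A

theorem isPullback_ι (A : (P X).Fiber M) :
    IsPullback (ι κ A) (pr ((tFunctor M κ).obj A)) (X.T.map (pr A)) (X.zero M) :=
  isPullback_cleavage κ A

theorem map_tFunctor {A B : (P X).Fiber M} (f : A ⟶ B) :
    (fiberTotal X M).map ((tFunctor M κ).map f) ≫ ι κ B =
      ι κ A ≫ X.T.map ((fiberTotal X M).map f) :=
  (isPullback_cleavage κ B).lift_fst _ _ _

theorem ι_pr (A : (P X).Fiber M) : ι κ A ≫ X.T.map (pr A) = pr ((tFunctor M κ).obj A) ≫ X.zero M :=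
  (isPullback_ι κ A).w

theorem map_ι_pr {Z A : (P X).Fiber M} (f : Z ⟶ (tFunctor M κ).obj A) :
    ((fiberTotal X M).map f ≫ ι κ A) ≫ X.T.map (pr A) = pr Z ≫ X.zero M := by
  rw [Category.assoc, ι_pr, map_pr_assoc]

instance (A : (P X).Fiber M) : Mono (ι κ A) := mono_fst_of_isPullback (isPullback_ι κ A)

instance (A : (P X).Fiber M) : Mono (X.T.map (ι κ A)) := by
  -- The zero is split by `p`, so its image under any functor is monic; `T` preserves the pullback
  -- that defines `ι`, whence `T ι` is monic.
  have : Mono ((iter X.T 1).map (X.zero M)) := ⟨fun x y h => by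
    have e := congrArg (fun k => k ≫ (iter X.T 1).map (X.p M)) h
    simp only [Category.assoc, ← Functor.map_comp, X.zero_p, CategoryTheory.Functor.map_id, Category.comp_id] at e
    exact e⟩
  exact mono_fst_of_isPullback (isPullback_iter (X.map_display _ (display A)) (isPullback_ι κ A) 1)

instance (A : (P X).Fiber M) : Mono (X.T.map (X.T.map (ι κ A))) := by
  have : Mono ((iter X.T 2).map (X.zero M)) := ⟨fun x y h => by
    have e := congrArg (fun k => k ≫ (iter X.T 2).map (X.p M)) h
    simp only [Category.assoc, ← Functor.map_comp, X.zero_p, CategoryTheory.Functor.map_id, Category.comp_id] at e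
    exact e⟩
  exact mono_fst_of_isPullback (isPullback_iter (X.map_display _ (display A)) (isPullback_ι κ A) 2)

variable {κ} in
theorem ext_ι {Z A : (P X).Fiber M} {f g : Z ⟶ (tFunctor M κ).obj A}
    (h : (fiberTotal X M).map f ≫ ι κ A = (fiberTotal X M).map g ≫ ι κ A) : f = g :=
  hom_ext ((cancel_mono _).1 h)

/-- A morphism to `T_M A`, from a morphism to `T A` over the zero section. -/
def liftι {Z A : (P X).Fiber M} (e : (fiberTotal X M).obj Z ⟶ X.T.obj ((fiberTotal X M).obj A))
    (h : e ≫ X.T.map (pr A) = pr Z ≫ X.zero M) : Z ⟶ (tFunctor M κ).obj A :=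
  homMk ((isPullback_ι κ A).lift e (pr Z) h) ((isPullback_ι κ A).lift_snd _ _ _)

@[simp]
theorem map_liftι {Z A : (P X).Fiber M}
    (e : (fiberTotal X M).obj Z ⟶ X.T.obj ((fiberTotal X M).obj A))
    (h : e ≫ X.T.map (pr A) = pr Z ≫ X.zero M) :
    (fiberTotal X M).map (liftι κ e h) ≫ ι κ A = e :=
  (isPullback_ι κ A).lift_fst _ _ _

theorem linear_ι {κ : Cleavage (P X)} (hκ : IsLinearCleavage κ) (A : (P X).Fiber M) :
    ι κ A ≫ X.T.map (str A).lift ≫ X.flip _ = (str ((tFunctor M κ).obj A)).lift ≫ X.T.map (ι κ A) := by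
  rw [← lift_tangent, lift_str, lift_str]
  exact hκ (X.zero M) (tangent A)

theorem additive_ι {κ : Cleavage (P X)} (hκ : IsLinearCleavage κ) (A : (P X).Fiber M) :
    IsAdditiveMorphism (str ((tFunctor M κ).obj A)).toAdditiveBundle ((str A).toAdditiveBundle.map X.T)
      (ι κ A) (X.zero M) :=
  additive_of_linear_tangent (ι_pr κ A) (linear_ι hκ A)

/-- The projection `T_M A ⟶ A`. -/
def tProj (A : (P X).Fiber M) : (tFunctor M κ).obj A ⟶ A := homMk (ι κ A ≫ X.p _) (by
  rw [Category.assoc, ← X.p_natural, ← Category.assoc, ι_pr, Category.assoc, X.zero_p,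
    Category.comp_id])

theorem map_tProj (A : (P X).Fiber M) : (fiberTotal X M).map (tProj κ A) = ι κ A ≫ X.p _ := rfl

/-- Every map to `T_M A` is `μ` of a pair of maps to `A`. -/
theorem exists_vertical {Z A : (P X).Fiber M} (f : Z ⟶ (tFunctor M κ).obj A) : ∃ a b : Z ⟶ A,
    (fiberTotal X M).map f ≫ ι κ A = (str A).pair ((fiberTotal X M).map a)
      ((fiberTotal X M).map b) ((map_pr a).trans (map_pr b).symm) ≫ (str A).μ := by
  obtain ⟨a, b, h, ha, e⟩ := (str A).exists_pair _ _ (map_ι_pr κ f)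
  exact ⟨homMk a ha, homMk b (h.symm.trans ha), e.symm⟩

/-- The complement of the projection `T_M A ⟶ A`. -/
def vertical (A : (P X).Fiber M) : (tFunctor M κ).obj A ⟶ A := (exists_vertical κ (𝟙 ((tFunctor M κ).obj A))).choose

theorem ι_eq (A : (P X).Fiber M) : ι κ A = (str A).pair ((fiberTotal X M).map (vertical κ A))
    ((fiberTotal X M).map (tProj κ A)) ((map_pr _).trans (map_pr _).symm) ≫ (str A).μ := by
  obtain ⟨b, h⟩ := (exists_vertical κ (𝟙 ((tFunctor M κ).obj A))).choose_spec
  replace h := ((Category.id_comp _).symm.trans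
    (congrArg (fun k => k ≫ ι κ A) ((fiberTotal X M).map_id _).symm)).trans h
  have hb := (congrArg (fun k => k ≫ X.p _) h).trans ((str A).pair_μ_p _ _ _)
  exact h.trans (congrArg (fun k => k ≫ (str A).μ) ((str A).pair_congr rfl hb.symm _))

/-- Universality of the lift, read in the fibre: a map to `T_M A` is a tangent vector over `0_M`,
that is `μ` of a unique pair of maps to `A`. -/
theorem isProduct_tProj (A : (P X).Fiber M) : IsProduct (tProj κ A) (vertical κ A) := by
  have key : ∀ {Z : (P X).Fiber M} (l : Z ⟶ (tFunctor M κ).obj A), (fiberTotal X M).map l ≫ ι κ A =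
      (str A).pair ((fiberTotal X M).map (l ≫ vertical κ A))
        ((fiberTotal X M).map (l ≫ tProj κ A)) ((map_pr _).trans (map_pr _).symm) ≫
        (str A).μ := fun l => by
    rw [ι_eq, ← Category.assoc, AdditiveBundle.comp_pair]
    exact congrArg (fun k => k ≫ (str A).μ) ((str A).pair_congr (Functor.map_comp _ _ _).symm
      (Functor.map_comp _ _ _).symm _)
  refine ⟨fun {Z} x y => ?_, fun {Z l l'} h₁ h₂ => ext_ι ?_⟩
  · have w := (map_pr y).trans (map_pr x).symm
    have h : ((str A).pair ((fiberTotal X M).map y) ((fiberTotal X M).map x) w ≫ (str A).μ) ≫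
        X.T.map (pr A) = pr Z ≫ X.zero M := by
      rw [Category.assoc, (str A).isPullback_μ.w, Category.assoc, AdditiveBundle.pair_π₀_assoc,
        map_pr_assoc]
    have e := (key (liftι κ _ h)).symm.trans (map_liftι κ _ h)
    obtain ⟨e₁, e₂⟩ := DifferentialBundle.pair_μ_inj _ e
    exact ⟨liftι κ _ h, hom_ext e₂, hom_ext e₁⟩
  · rw [key, key]
    exact congrArg (fun k => k ≫ (str A).μ) ((str A).pair_congr
      (congrArg (fiberTotal X M).map h₂) (congrArg (fiberTotal X M).map h₁) _)

/-- The product is a transverse pullback over `M`, hence preserved by `T`; restricting to vectors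
over `0_M` keeps the universal property. -/
theorem isProduct_map (A B : (P X).Fiber M) :
    IsProduct ((tFunctor M κ).map (fst A B)) ((tFunctor M κ).map (snd A B)) where
  exists_lift {Z} x y := by
    have w : ((fiberTotal X M).map x ≫ ι κ A) ≫ X.T.map (pr A) =
      ((fiberTotal X M).map y ≫ ι κ B) ≫ X.T.map (pr B) := by rw [map_ι_pr, map_ι_pr]
    have h : (isPullback_map_prod A B).lift _ _ w ≫ X.T.map (pr (prod A B)) = pr Z ≫ X.zero M := by
      rw [← map_pr (fst A B), X.T.map_comp, IsPullback.lift_fst_assoc, map_ι_pr]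
    refine ⟨liftι κ _ h, ext_ι ?_, ext_ι ?_⟩
    · rw [Functor.map_comp, Category.assoc, map_tFunctor, ← Category.assoc, map_liftι]
      exact (isPullback_map_prod A B).lift_fst _ _ w
    · rw [Functor.map_comp, Category.assoc, map_tFunctor, ← Category.assoc, map_liftι]
      exact (isPullback_map_prod A B).lift_snd _ _ w
  hom_ext {Z l l'} h₁ h₂ := ext_ι ((isPullback_map_prod A B).hom_ext
    (by rw [Category.assoc, ← map_tFunctor, ← Category.assoc, ← Functor.map_comp, h₁,
      Functor.map_comp, Category.assoc, map_tFunctor, Category.assoc])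
    (by rw [Category.assoc, ← map_tFunctor, ← Category.assoc, ← Functor.map_comp, h₂,
      Functor.map_comp, Category.assoc, map_tFunctor, Category.assoc]))

instance : PreservesLimitsOfShape (Discrete WalkingPair) (tFunctor M κ) :=
  preservesProducts_of_isProduct fun A B => ⟨_, _, _, isProduct_prod A B, isProduct_map κ A B⟩

/-- The final bundle has an identity as projection, so a vector over `0_M` is that zero vector
itself. -/
theorem toUnit_unique_tangent {Z : (P X).Fiber M} (f g : Z ⟶ (tFunctor M κ).obj (unit X M)) :
    f = g := by
  have e : ∀ f : Z ⟶ (tFunctor M κ).obj (unit X M),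
      (fiberTotal X M).map f ≫ ι κ (unit X M) = pr Z ≫ X.zero M := fun f => by
    have h := map_ι_pr κ f
    have h' : X.T.map (pr (unit X M)) = 𝟙 _ := X.T.map_id M
    rw [h'] at h
    exact (Category.comp_id _).symm.trans h
  exact ext_ι ((e f).trans (e g).symm)

instance : PreservesFiniteProducts (tFunctor M κ) := by
  have : PreservesLimit (Functor.empty.{0} ((P X).Fiber M)) (tFunctor M κ) :=
    preservesLimit_of_preserves_limit_cone
      (IsTerminal.ofUniqueHom toUnit fun _ _ => toUnit_unique _ _ : IsTerminal (unit X M))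
      ((isLimitMapConeEmptyConeEquiv (tFunctor M κ) (unit X M)).symm
        (IsTerminal.ofUniqueHom (fun Z => toUnit Z ≫ liftι κ (X.zero M) (by
          have h' : X.T.map (pr (unit X M)) = 𝟙 _ := X.T.map_id M
          rw [h']
          exact (Category.comp_id _).trans (Category.id_comp _).symm))
          fun _ _ => toUnit_unique_tangent κ _ _))
  have : PreservesLimitsOfShape (Discrete PEmpty.{1}) (tFunctor M κ) :=
    preservesLimitsOfShape_pempty_of_preservesTerminal _
  have := cartesianMonoidalCategory X M
  exact PreservesFiniteProducts.of_preserves_binary_and_terminal _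

/-- The projection of `T_M A` is a product projection and `T_M` preserves products, so no
transversality is needed. -/
theorem preservesPullbacksAlong_tProj (A : (P X).Fiber M) (k : ℕ) :
    PreservesPullbacksAlong (iter (tFunctor M κ) k) (tProj κ A) :=
  (isProduct_tProj κ A).preservesPullbacksAlong _ fun Z => ⟨_, _, _, isProduct_prod Z A⟩

instance (A : (P X).Fiber M) : HasPullbackPowers (tProj κ A) :=
  (preservesPullbacksAlong_tProj κ A 0).hasPullbackPowers

instance (A : (P X).Fiber M) : PreservedByIterates (tFunctor M κ) (tProj κ A) :=
  ⟨fun k => (preservesPullbacksAlong_tProj κ A k).preservesPullbackPowers⟩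

end Fibre

end DBun


theorem TangentStructure.zero_ell {C : Type u} [Category.{v} C] (𝕋 : TangentStructure C) (M : C) :
    𝕋.zero M ≫ 𝕋.ell M = 𝕋.zero M ≫ 𝕋.T.map (𝕋.zero M) :=
  (𝕋.ell_additive M).zero

theorem TangentStructure.pair_vert {C : Type u} [Category.{v} C] (𝕋 : TangentStructure C) {Z M : C}
    (a b : Z ⟶ 𝕋.T.obj M) (h : a ≫ 𝕋.p M = b ≫ 𝕋.p M) :
    (𝕋.bundle M).pair a b h ≫ 𝕋.vert M = ((𝕋.bundle M).map 𝕋.T).sum (a ≫ 𝕋.ell M)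
      (b ≫ 𝕋.zero (𝕋.T.obj M)) (by
        have := (𝕋.natural (𝕋.p M)).zero
        rw [Category.assoc, Category.assoc, (𝕋.ell_additive M).comm, TangentStructure.zero, this,
          ← Category.assoc, ← Category.assoc, h]) :=
  AdditiveBundle.pair_mu _ _ _ _ _ _ _ _

/-! ### Universality of the vertical lift along monic comparisons -/

namespace PreTangent.Map.IsReflecting

variable {F : Type u} [Category.{v} F] {C : Type u₁} [Category.{v} C] {R : PreTangent F}
  {𝕋 : TangentStructure C} {U : F ⥤ C} {m : R.Map 𝕋 U}

/-- With `ι` only monic, the pair obtained from universality in `C` need not come from `F`. The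
hypothesis `factor` says that it does, and monicity of `v` and of `ι` gives uniqueness. -/
theorem isPullback_mu (hm : m.IsReflecting) (A : F)
    (h : (hm.bundle A).π₀ ≫ R.ell A ≫ R.T.map (R.p A) =
      (hm.bundle A).π₁ ≫ R.zero (R.T.obj A) ≫ R.T.map (R.p A))
    (factor : ∀ {Z : F} (x : Z ⟶ R.T.obj (R.T.obj A)) (a b : U.obj Z ⟶ 𝕋.T.obj (U.obj A))
      (hab : a ≫ 𝕋.p _ = b ≫ 𝕋.p _), (𝕋.bundle _).pair a b hab ≫ 𝕋.vert _ =
        U.map x ≫ m.ι (R.T.obj A) ≫ 𝕋.T.map (m.ι A) →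
      ∃ a' b' : Z ⟶ R.T.obj A, U.map a' ≫ m.ι A = a ∧ U.map b' ≫ m.ι A = b) :
    IsPullback ((hm.bundle A).mu R.T (R.ell A) (R.zero (R.T.obj A)) h)
      ((hm.bundle A).π₀ ≫ R.p A) (R.T.map (R.p A)) (R.zero A) := by
  have hmu : ∀ {Z : F} (x y : Z ⟶ R.T.obj A) (hxy : x ≫ R.p A = y ≫ R.p A),
      U.map ((hm.bundle A).pair x y hxy ≫
        (hm.bundle A).mu R.T (R.ell A) (R.zero (R.T.obj A)) h) ≫ m.ι _ ≫ 𝕋.T.map (m.ι A) =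
      (𝕋.bundle (U.obj A)).pair (U.map x ≫ m.ι A) (U.map y ≫ m.ι A)
        (functor_comm_of_comm ((m.p A).trans (Category.comp_id _).symm) hxy) ≫ 𝕋.vert _ := by
    intro Z x y hxy
    rw [U.map_comp, Category.assoc, m.map_mu _ rfl h, ← Category.assoc, AdditiveBundle.comp_pair]
    refine congrArg (fun k => k ≫ 𝕋.vert _) (AdditiveBundle.pair_congr _ ?_ ?_ _)
    · rw [← Category.assoc, ← U.map_comp, AdditiveBundle.pair_π₀]
    · rw [← Category.assoc, ← U.map_comp, AdditiveBundle.pair_π₁]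
  have hpair : ∀ {Z : F} (l : Z ⟶ (hm.bundle A).E₂), l = (hm.bundle A).pair
      (l ≫ (hm.bundle A).π₀) (l ≫ (hm.bundle A).π₁)
      (by simp only [Category.assoc, (hm.bundle A).isPullback.w]) := fun l =>
    (hm.bundle A).E₂_ext (by simp) (by simp)
  refine isPullback_of_exists ?_ (fun {Z} x y hxy => ?_) (fun {Z} l l' h₁ _ => ?_)
  · rw [AdditiveBundle.mu_map_proj, (hm.ell_additive A).comm, Category.assoc]
    rfl
  · have hx : (U.map x ≫ m.ι (R.T.obj A) ≫ 𝕋.T.map (m.ι A)) ≫ 𝕋.T.map (𝕋.p _) =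
        U.map y ≫ 𝕋.zero _ := by
      rw [← m.zero A, ← Category.assoc (U.map y), ← U.map_comp, ← hxy, U.map_comp]
      simp only [Category.assoc, m.naturality, ← 𝕋.T.map_comp, m.p]
    obtain ⟨w, hw₁, hw₂⟩ : ∃ w, w ≫ 𝕋.vert _ = _ ∧ w ≫ (𝕋.bundle _).π₀ ≫ 𝕋.p _ = _ :=
      ⟨(𝕋.isPullback_vert _).lift _ _ hx, (𝕋.isPullback_vert _).lift_fst _ _ hx,
        (𝕋.isPullback_vert _).lift_snd _ _ hx⟩
    have hp : (w ≫ (𝕋.bundle _).π₀) ≫ 𝕋.p _ = (w ≫ (𝕋.bundle _).π₁) ≫ 𝕋.p _ := by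
      rw [Category.assoc, Category.assoc, (𝕋.bundle _).isPullback.w]
    have hw : (𝕋.bundle _).pair _ _ hp ≫ 𝕋.vert _ =
        U.map x ≫ m.ι (R.T.obj A) ≫ 𝕋.T.map (m.ι A) := by
      refine Eq.trans (congrArg (fun k => k ≫ 𝕋.vert _) ?_) hw₁
      exact (𝕋.bundle _).E₂_ext (by simp) (by simp)
    obtain ⟨a, b, ha, hb⟩ := factor x _ _ hp hw
    have hy : (U.map a ≫ m.ι A) ≫ 𝕋.p _ = U.map y := by
      rw [ha, Category.assoc, hw₂]
    have hab : a ≫ R.p A = b ≫ R.p A := hm.ext₀ (by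
      rw [U.map_comp, U.map_comp, ← m.p, ← Category.assoc, ← Category.assoc, ha, hb, hp])
    refine ⟨(hm.bundle A).pair a b hab, hm.ext₂ ?_, hm.ext₀ ?_⟩
    · rw [hmu, ← hw]
      exact congrArg (fun k => k ≫ 𝕋.vert _) (AdditiveBundle.pair_congr _ ha hb _)
    · rw [AdditiveBundle.pair_π₀_assoc, ← hy, U.map_comp, ← m.p, Category.assoc]
  · rw [hpair l, hpair l'] at h₁
    have e := (hmu _ _ _).symm.trans ((congrArg (fun k => U.map k ≫ m.ι (R.T.obj A) ≫
      𝕋.T.map (m.ι A)) h₁).trans (hmu _ _ _))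
    have e' := (cancel_mono (𝕋.vert _)).1 e
    exact (hm.bundle A).E₂_ext (hm.ext₁ (by simpa using congrArg (fun k => k ≫ (𝕋.bundle _).π₀) e'))
      (hm.ext₁ (by simpa using congrArg (fun k => k ≫ (𝕋.bundle _).π₁) e'))

end PreTangent.Map.IsReflecting

namespace DBun

open DisplayTangentStructure

variable {C : Type u} [Category.{v} C] {X : DisplayTangentStructure C}

namespace Fibre

variable {M : C} (κ : Cleavage (P X))

/-! ### The vertical tangent structure -/

/-- Vectors over the zero section are closed under addition because `T` of the projection is
additive and `0 + 0 = 0`. -/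
theorem sum_map_pr {A : (P X).Fiber M} {Z : C} {a b : Z ⟶ X.T.obj ((fiberTotal X M).obj A)}
    {z : Z ⟶ M} (h : a ≫ X.p _ = b ≫ X.p _) (ha : a ≫ X.T.map (pr A) = z ≫ X.zero M)
    (hb : b ≫ X.T.map (pr A) = z ≫ X.zero M) :
    (X.bundle _).sum a b h ≫ X.T.map (pr A) = z ≫ X.zero M := by
  rw [(X.natural (pr A)).sum_comp]
  exact ((X.bundle M).sum_congr ha hb _).trans ((X.bundle M).zero_sum z (z ≫ X.zero M) rfl)

theorem isPullback_map_ι (A : (P X).Fiber M) : IsPullback (X.T.map (ι κ A))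
    (X.T.map (pr ((tFunctor M κ).obj A))) (X.T.map (X.T.map (pr A))) (X.T.map (X.zero M)) :=
  isPullback_iter (X.map_display _ (display A)) (isPullback_ι κ A) 1

/-- A morphism to `T_M T_M A`, from a morphism to `T T A` over the zero section. -/
def liftι₂ {Z A : (P X).Fiber M}
    (e : (fiberTotal X M).obj Z ⟶ X.T.obj (X.T.obj ((fiberTotal X M).obj A)))
    (h : e ≫ X.T.map (X.T.map (pr A)) = (pr Z ≫ X.zero M) ≫ X.T.map (X.zero M)) :
    Z ⟶ (tFunctor M κ).obj ((tFunctor M κ).obj A) :=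
  liftι κ ((isPullback_map_ι κ A).lift e (pr Z ≫ X.zero M) h)
    ((isPullback_map_ι κ A).lift_snd _ _ _)

theorem map_liftι₂ {Z A : (P X).Fiber M}
    (e : (fiberTotal X M).obj Z ⟶ X.T.obj (X.T.obj ((fiberTotal X M).obj A)))
    (h : e ≫ X.T.map (X.T.map (pr A)) = (pr Z ≫ X.zero M) ≫ X.T.map (X.zero M)) :
    (fiberTotal X M).map (liftι₂ κ e h) ≫ ι κ _ ≫ X.T.map (ι κ A) = e := by
  rw [← Category.assoc, liftι₂, map_liftι, IsPullback.lift_fst]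

theorem ι_ι_pr (A : (P X).Fiber M) :
    ((ι κ ((tFunctor M κ).obj A) ≫ X.T.map (ι κ A)) ≫ X.T.map (X.T.map (pr A))) =
      (pr _ ≫ X.zero M) ≫ X.T.map (X.zero M) := by
  rw [Category.assoc, ← X.T.map_comp, ι_pr, X.T.map_comp, ← Category.assoc, ι_pr]

variable (M) in
/-- The vertical tangent data. -/
def preTangent : PreTangent ((P X).Fiber M) where
  T := tFunctor M κ
  p := tProj κ
  zero A := liftι κ (X.zero _) (X.zero_natural _)
  add A := liftι κ ((X.bundle _).sum
    ((fiberTotal X M).map (pullback.fst (tProj κ A) (tProj κ A)) ≫ ι κ A)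
    ((fiberTotal X M).map (pullback.snd (tProj κ A) (tProj κ A)) ≫ ι κ A)
    (by rw [Category.assoc, Category.assoc, ← map_tProj, ← Functor.map_comp, pullback.condition,
      Functor.map_comp])) (sum_map_pr _ (map_ι_pr _ _) (map_ι_pr _ _))
  ell A := liftι₂ κ (ι κ A ≫ X.ell _) (by
    rw [Category.assoc, ← X.ell_natural, ← Category.assoc, ι_pr, Category.assoc, X.zero_ell,
      Category.assoc])
  flip A := liftι₂ κ ((ι κ ((tFunctor M κ).obj A) ≫ X.T.map (ι κ A)) ≫ X.flip _) (by
    rw [Category.assoc, ← X.flip_natural, ← Category.assoc, ι_ι_pr, Category.assoc, X.zero_flip,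
      Category.assoc, Category.assoc, X.zero_natural])

variable (M) in
/-- The comparison of the vertical tangent data with the tangent structure of the base. -/
def preTangentMap : (preTangent M κ).Map X.toTangentStructure (fiberTotal X M) where
  ι := ι κ
  naturality f := map_tFunctor κ f
  p A := (map_tProj κ A).symm
  zero _ := map_liftι κ _ _
  add _ := map_liftι κ _ _
  ell _ := map_liftι₂ κ _ _
  flip _ := map_liftι₂ κ _ _

theorem isReflecting_preTangentMap : (preTangentMap M κ).IsReflecting where
  faithful := inferInstance
  mono₁ A := inferInstanceAs (Mono (ι κ A))
  mono₂ A := inferInstanceAs (Mono (X.T.map (ι κ A)))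
  mono₃ A := inferInstanceAs (Mono (X.T.map (X.T.map (ι κ A))))

/-- Elements of `T T A` over the zero section which come from `T₂ A` come from elements of `T A` over
the zero section. -/
theorem map_pr_of_vert {A : (P X).Fiber M} {Z : C} {z : Z ⟶ M}
    {a b : Z ⟶ X.T.obj ((fiberTotal X M).obj A)} (h : a ≫ X.p _ = b ≫ X.p _)
    (e : ((X.bundle _).pair a b h ≫ X.vert _) ≫ X.T.map (X.T.map (pr A)) =
      (z ≫ X.zero M) ≫ X.T.map (X.zero M)) :
    a ≫ X.T.map (pr A) = z ≫ X.zero M ∧ b ≫ X.T.map (pr A) = z ≫ X.zero M := by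
  have h' : (a ≫ X.T.map (pr A)) ≫ X.p M = (b ≫ X.T.map (pr A)) ≫ X.p M := by
    rw [Category.assoc, X.p_natural, ← Category.assoc, h, Category.assoc, Category.assoc,
      X.p_natural]
  have e₁ : (X.bundle M).pair (a ≫ X.T.map (pr A)) (b ≫ X.T.map (pr A)) h' ≫ X.vert M =
      (z ≫ X.zero M) ≫ X.T.map (X.zero M) := by
    rw [← e, X.pair_vert, X.pair_vert, ((X.natural (pr A)).map X.T).sum_comp]
    exact AdditiveBundle.sum_congr _
      (by rw [Category.assoc, Category.assoc, X.ell_natural])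
      (by rw [Category.assoc, Category.assoc, X.zero_natural]) _
  -- The pair of zero vectors has the same image under `v` as the projected pair, and `v` is monic.
  have e₂ : (X.bundle M).pair (z ≫ X.zero M) (z ≫ X.zero M) rfl ≫ X.vert M =
      (z ≫ X.zero M) ≫ X.T.map (X.zero M) := by
    rw [X.pair_vert]
    refine (AdditiveBundle.sum_congr _ (a' := (z ≫ X.zero M) ≫ X.T.map (X.zero M))
      (b' := (z ≫ X.zero M) ≫ X.T.map (X.zero M)) ?_ ?_ _).trans
      (((X.bundle M).map X.T).zero_sum (z ≫ X.zero M) _ rfl)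
    · rw [Category.assoc, X.zero_ell, Category.assoc]
    · rw [Category.assoc, Category.assoc, X.zero_natural]
  have e₃ := (cancel_mono (X.vert M)).1 (e₁.trans e₂.symm)
  exact ⟨by simpa using congrArg (fun k => k ≫ (X.bundle M).π₀) e₃,
    by simpa using congrArg (fun k => k ≫ (X.bundle M).π₁) e₃⟩

theorem exists_map_ι_of_vert {Z A : (P X).Fiber M}
    (x : Z ⟶ (preTangent M κ).T.obj ((preTangent M κ).T.obj A))
    (a b : (fiberTotal X M).obj Z ⟶ X.T.obj ((fiberTotal X M).obj A))
    (h : a ≫ X.p _ = b ≫ X.p _) (e : (X.bundle _).pair a b h ≫ X.vert _ = (fiberTotal X M).map x ≫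
      (preTangentMap M κ).ι _ ≫ X.T.map ((preTangentMap M κ).ι A)) :
    ∃ a' b' : Z ⟶ (preTangent M κ).T.obj A,
      (fiberTotal X M).map a' ≫ (preTangentMap M κ).ι A = a ∧
      (fiberTotal X M).map b' ≫ (preTangentMap M κ).ι A = b := by
  have e' : ((X.bundle _).pair a b h ≫ X.vert _) ≫ X.T.map (X.T.map (pr A)) =
      (pr Z ≫ X.zero M) ≫ X.T.map (X.zero M) := by
    refine (congrArg (fun k => k ≫ _) e).trans ((Category.assoc _ _ _).trans
      ((congrArg (fun k => _ ≫ k) (ι_ι_pr κ A)).trans ?_))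
    exact (Category.assoc _ _ _).symm.trans (congrArg (fun k => k ≫ X.T.map (X.zero M))
      ((Category.assoc _ _ _).symm.trans (congrArg (fun k => k ≫ X.zero M) (map_pr x))))
  obtain ⟨ha, hb⟩ := map_pr_of_vert h e'
  exact ⟨liftι κ a ha, liftι κ b hb, map_liftι κ a ha, map_liftι κ b hb⟩

variable (M) in
/-- The vertical tangent structure. -/
def verticalTangent : TangentStructure ((P X).Fiber M) :=
  (isReflecting_preTangentMap κ).tangentStructure fun A k h =>
    -- The universality square is a pullback along `T_M(p)`, again a product projection, so all
    -- iterates of `T_M` preserve it.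
    ((isProduct_tProj κ A).map (tFunctor M κ)).map_isPullback
      ((isReflecting_preTangentMap κ).isPullback_mu A h (exists_map_ι_of_vert κ))
      (iter (tFunctor M κ) k)

theorem total_sum {Z q : DBun X} (a b : Z ⟶ (tangentStructure X).T.obj q)
    (h : a ≫ (tangentStructure X).p q = b ≫ (tangentStructure X).p q)
    (h' : a.total ≫ X.p q.total = b.total ≫ X.p q.total) :
    (((tangentStructure X).bundle q).sum a b h).total =
      (X.bundle q.total).sum a.total b.total h' :=
  (Category.comp_id _).symm.trans
    (((totalMap X).isAdditiveOver (isReflecting_totalMap.bundle q) rfl).map_sum a b h |>.trans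
      ((X.bundle q.total).sum_congr (Category.comp_id _) (Category.comp_id _) _))

theorem isSubstituted_verticalTangent : IsSubstituted (P := P X) (tangentStructure X)
    (verticalTangent M κ) (fun A => show Functor.Fiber.fiberInclusion.obj
      ((verticalTangent M κ).T.obj A) ⟶ (tangentStructure X).T.obj
        (Functor.Fiber.fiberInclusion.obj A) from κ.map (X.zero M) (tangent A)) where
  map f := DBun.hom_ext (map_tFunctor κ f)
  p A := DBun.hom_ext (map_tProj κ A)
  zero A := DBun.hom_ext ((preTangentMap M κ).zero A)
  add {Z A} a b h := DBun.hom_ext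
    (((isReflecting_preTangentMap κ).bundle_isAdditiveOver A).map_sum a b h |>.trans
      (total_sum (Z := Z.1) (q := A.1) (a.1 ≫ κ.map (X.zero M) (tangent A))
        (b.1 ≫ κ.map (X.zero M) (tangent A)) _ _).symm)
  ell A := DBun.hom_ext ((preTangentMap M κ).ell A)
  flip A := DBun.hom_ext ((preTangentMap M κ).flip A)

theorem isVertical_verticalTangent :
    IsVertical (isStrictTangentMorphism_P (X := X)) κ M (verticalTangent M κ) :=
  -- The value of `T_M` was defined to be the chosen substituted object, so the cast in `IsVertical`
  -- is an identity.
  ⟨fun _ => rfl, (congrArg (IsSubstituted (P := P X) (tangentStructure X) (verticalTangent M κ))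
    (funext fun _ => Category.id_comp _)).mpr (isSubstituted_verticalTangent κ)⟩

end Fibre

end DBun


namespace IsAdditiveOver

variable {F : Type u} [Category.{v} F] {C : Type u₁} [Category.{v} C]
  {U : F ⥤ C} {A B : F} {q : A ⟶ B} {M : C} {q₀ : U.obj A ⟶ M} {s : AdditiveBundle q₀}
  {S : AdditiveBundle q} {b : U.obj B ⟶ M} (hS : IsAdditiveOver U S s (𝟙 _) b)

include hS

theorem map_sum_id {Z : F} (x y : Z ⟶ A) (h : x ≫ q = y ≫ q)
    (h' : U.map x ≫ q₀ = U.map y ≫ q₀) : U.map (S.sum x y h) = s.sum (U.map x) (U.map y) h' :=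
  (Category.comp_id _).symm.trans ((hS.map_sum x y h).trans
    (s.sum_congr (Category.comp_id _) (Category.comp_id _) _))

theorem map_comm_id : U.map q ≫ b = q₀ :=
  hS.comm.symm.trans (Category.id_comp _)

end IsAdditiveOver

/-! ### Differential bundles reflected along a comparison -/

namespace PreTangent.Map.IsReflecting

variable {F : Type u} [Category.{v} F] {C : Type u₁} [Category.{v} C] {R : PreTangent F}
  {𝕋 : TangentStructure C} {U : F ⥤ C} {m : R.Map 𝕋 U} (hm : m.IsReflecting)
  {A B : F} {q : A ⟶ B} {M : C} {q₀ : U.obj A ⟶ M} {s : DifferentialBundle 𝕋 q₀}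
  {S : AdditiveBundle q} {b : U.obj B ⟶ M}
  (hS : IsAdditiveOver U S s.toAdditiveBundle (𝟙 _) b)
  (hz : U.map S.zero = b ≫ s.zero) {lam : A ⟶ R.T.obj A} (hl : U.map lam ≫ m.ι A = s.lift)

section Additive

include hS m

theorem map_additiveOver [PreservesPullbackPowers R.T q] [PreservesPullbackPowers 𝕋.T q₀] :
    IsAdditiveOver U (S.map R.T) (s.toAdditiveBundle.map 𝕋.T) (m.ι A) (m.ι B ≫ 𝕋.T.map b) := by
  have h := hS.map m.ι m.naturality
  rwa [𝕋.T.map_id, Category.comp_id] at h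

end Additive

include hm hS hz hl

theorem lift_additive_p : IsAdditiveMorphism S (hm.bundle A) lam S.zero := by
  have comm : lam ≫ R.p A = q ≫ S.zero := hm.ext₀ (by
    rw [U.map_comp, ← m.p, ← Category.assoc, hl, s.lift_p, U.map_comp, hz, ← Category.assoc,
      hS.map_comm_id])
  refine .of_sum comm (hm.ext₁ ?_) (hm.ext₁ ?_)
  · rw [(hm.bundle_isAdditiveOver A).map_sum, U.map_comp, Category.assoc, hl, ← S.sum_π₀_π₁,
      hS.map_sum_id _ _ _ (by rw [← hS.map_comm_id, ← Category.assoc, ← Category.assoc,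
        ← U.map_comp, ← U.map_comp, S.isPullback.w]), s.lift_additive_p.sum_comp]
    exact AdditiveBundle.sum_congr _ (by rw [U.map_comp, Category.assoc, hl])
      (by rw [U.map_comp, Category.assoc, hl]) _
  · have e : U.map (R.zero A) ≫ m.ι A = _ := m.zero A
    change U.map (S.zero ≫ lam) ≫ _ = U.map (S.zero ≫ R.zero A) ≫ _
    rw [U.map_comp, Category.assoc, hl, U.map_comp, Category.assoc, m.zero, hz, Category.assoc,
      s.lift_additive_p.zero, Category.assoc]
    rfl

variable [PreservesPullbackPowers R.T q] (hTB : ∀ {Z : F} (f g : Z ⟶ R.T.obj B), f = g)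

include hTB

theorem lift_additive_map : IsAdditiveMorphism S (S.map R.T) lam (R.zero B) := by
  have := s.preserved
  refine .of_sum (hTB _ _) (hm.ext₁ ?_) (hm.ext₁ ?_)
  · rw [(map_additiveOver (m := m) hS).map_sum, U.map_comp, Category.assoc, hl, ← S.sum_π₀_π₁,
      hS.map_sum_id _ _ _ (by rw [← hS.map_comm_id, ← Category.assoc, ← Category.assoc,
        ← U.map_comp, ← U.map_comp, S.isPullback.w]), s.lift_additive_map.sum_comp]
    exact AdditiveBundle.sum_congr _ (by rw [U.map_comp, Category.assoc, hl])
      (by rw [U.map_comp, Category.assoc, hl]) _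
  · change U.map (S.zero ≫ lam) ≫ _ = U.map (R.zero B ≫ R.T.map S.zero) ≫ _
    rw [U.map_comp, Category.assoc, hl, U.map_comp, Category.assoc, m.naturality, hz,
      ← Category.assoc, m.zero, 𝕋.zero_natural, Category.assoc, s.lift_additive_map.zero, Category.assoc,
      ← 𝕋.zero_natural]
    rfl

omit hz in
-- The image of the candidate `μ` is the `μ` of `s`, which decomposes the given vector. The
-- hypothesis `full` brings the two components back to `F`, and the conditions over `B` and `T B`
-- are void since parallel maps there are equal.
theorem isPullback_differential_mu (hB : ∀ {Z : F} (f g : Z ⟶ B), f = g)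
    (full : ∀ {Z : F} (y : Z ⟶ B) (a : U.obj Z ⟶ U.obj A), a ≫ q₀ = U.map y ≫ b →
      ∃ a' : Z ⟶ A, U.map a' = a)
    (h : S.π₀ ≫ lam ≫ R.T.map q = S.π₁ ≫ R.zero A ≫ R.T.map q) :
    IsPullback (S.mu R.T lam (R.zero A) h) (S.π₀ ≫ q) (R.T.map q) (R.zero B) := by
  have := s.preserved
  have hmu : ∀ {Z : F} (x y : Z ⟶ A) (hxy : x ≫ q = y ≫ q)
      (h' : U.map x ≫ q₀ = U.map y ≫ q₀),
      U.map (S.pair x y hxy ≫ S.mu R.T lam (R.zero A) h) ≫ m.ι A =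
        s.pair (U.map x) (U.map y) h' ≫ s.μ := by
    intro Z x y hxy h'
    rw [AdditiveBundle.pair_mu, (map_additiveOver (m := m) hS).map_sum, s.pair_μ]
    exact AdditiveBundle.sum_congr _ (by rw [U.map_comp, Category.assoc, hl])
      (by rw [U.map_comp, Category.assoc, m.zero]) _
  have hw : ∀ {Z : F} (x y : Z ⟶ A), U.map x ≫ q₀ = U.map y ≫ q₀ := fun x y => by
    rw [← hS.map_comm_id, ← Category.assoc, ← Category.assoc, ← U.map_comp, ← U.map_comp,
      hB (x ≫ q) (y ≫ q)]
  have hpair : ∀ {Z : F} (l : Z ⟶ S.E₂), l = S.pair (l ≫ S.π₀) (l ≫ S.π₁) (hB _ _) := fun l =>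
    S.E₂_ext (by simp) (by simp)
  refine isPullback_of_exists (hTB _ _) (fun {Z} x y hxy => ?_) (fun {Z} l l' h₁ _ => ?_)
  · have hx : (U.map x ≫ m.ι A) ≫ 𝕋.T.map q₀ = (U.map y ≫ b) ≫ 𝕋.zero M := by
      rw [← hS.map_comm_id, 𝕋.T.map_comp, Category.assoc, ← Category.assoc (m.ι A),
        ← m.naturality, ← Category.assoc, ← Category.assoc, ← U.map_comp, hxy, U.map_comp,
        Category.assoc (U.map y), m.zero, Category.assoc, 𝕋.zero_natural, Category.assoc]
    obtain ⟨a, c, hac, ha, e⟩ := s.exists_pair _ _ hx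
    obtain ⟨a', rfl⟩ := full y a ha
    obtain ⟨c', rfl⟩ := full y c (hac.symm.trans ha)
    exact ⟨S.pair a' c' (hB _ _), hm.ext₁ ((hmu _ _ _ hac).trans e), hB _ _⟩
  · rw [hpair l, hpair l'] at h₁
    have e := (hmu _ _ _ (hw _ _)).symm.trans ((congrArg (fun k => U.map k ≫ m.ι A) h₁).trans
      (hmu _ _ _ (hw _ _)))
    obtain ⟨e₁, e₂⟩ := s.pair_μ_inj e
    exact S.E₂_ext (hm.ext₀ e₁) (hm.ext₀ e₂)

omit hS hz hTB in
theorem lift_ell : lam ≫ R.ell A = lam ≫ R.T.map lam := hm.ext₂ (by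
  rw [map_comp_ι₂, U.map_comp, Category.assoc, m.ell, ← Category.assoc, ← Category.assoc, hl,
    s.lift_ell])

end PreTangent.Map.IsReflecting


namespace DBun

open DisplayTangentStructure

variable {C : Type u} [Category.{v} C] {X : DisplayTangentStructure C}

namespace Fibre

variable {M : C}

/-! ### The differential structure of the fibres -/

/-- The object `A` is the product of the final object with itself, so the results on product
projections cover differential bundles over the final object. -/
theorem isProduct_toUnit {A : (P X).Fiber M} (q : A ⟶ unit X M) : IsProduct q (𝟙 A) where
  exists_lift _ y := ⟨y, toUnit_unique _ _, Category.comp_id y⟩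
  hom_ext _ h := by simpa using h

theorem preservesPullbacksAlong_toUnit {A : (P X).Fiber M} (q : A ⟶ unit X M)
    (T : (P X).Fiber M ⥤ (P X).Fiber M) [PreservesLimitsOfShape (Discrete WalkingPair) T] :
    PreservesPullbacksAlong T q :=
  (isProduct_toUnit q).preservesPullbacksAlong _ fun Z => ⟨_, _, _, isProduct_prod Z A⟩

instance {A : (P X).Fiber M} (q : A ⟶ unit X M) : HasPullbackPowers q :=
  (preservesPullbacksAlong_toUnit q (𝟭 _)).hasPullbackPowers

instance (κ : Cleavage (P X)) {A : (P X).Fiber M} (q : A ⟶ unit X M) :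
    PreservedByIterates (tFunctor M κ) q :=
  ⟨fun k => (preservesPullbacksAlong_toUnit q (iter (tFunctor M κ) k)).preservesPullbackPowers⟩

theorem map_toUnit_pr {A : (P X).Fiber M} (q : A ⟶ unit X M) :
    𝟙 ((fiberTotal X M).obj A) ≫ pr A = (fiberTotal X M).map q ≫ pr (unit X M) :=
  (Category.id_comp _).trans (map_pr q).symm

/-- The additive structure of a bundle, in the fibre. -/
def additiveBundle (A : (P X).Fiber M) (q : A ⟶ unit X M) : AdditiveBundle q :=
  have h : (fiberTotal X M).map (pullback.fst q q) ≫ pr A =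
    (fiberTotal X M).map (pullback.snd q q) ≫ pr A := (map_pr _).trans (map_pr _).symm
  .ofJointlyMonic q (fun _ : Unit => fiberTotal X M) (fun _ => (str A).toAdditiveBundle)
    (fun _ => 𝟙 _) (fun _ => pr (unit X M)) (fun _ => map_toUnit_pr q)
    (fun _ _ _ e => hom_ext (by simpa only [Category.comp_id] using e ()))
    (homMk ((str A).sum _ _ h) (by rw [AdditiveBundle.sum_proj, map_pr]))
    (homMk (pr (unit X M) ≫ (str A).zero) (by
      rw [Category.assoc, (str A).zero_proj, Category.comp_id]))
    (toUnit_unique _ _) (toUnit_unique _ _)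
    (fun _ => (Category.comp_id _).trans ((str A).sum_congr (Category.comp_id _).symm
      (Category.comp_id _).symm _)) (fun _ => Category.comp_id _)

theorem isAdditiveOver_additiveBundle (A : (P X).Fiber M) (q : A ⟶ unit X M) :
    IsAdditiveOver (fiberTotal X M) (additiveBundle A q) (str A).toAdditiveBundle (𝟙 _)
      (pr (unit X M)) :=
  ⟨map_toUnit_pr q, (Category.comp_id _).trans ((str A).sum_congr (Category.comp_id _).symm
      (Category.comp_id _).symm _)⟩

theorem map_sum {A : (P X).Fiber M} (q : A ⟶ unit X M) {Z : (P X).Fiber M} (x y : Z ⟶ A)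
    (h : x ≫ q = y ≫ q) : (fiberTotal X M).map ((additiveBundle A q).sum x y h) =
      (str A).sum ((fiberTotal X M).map x) ((fiberTotal X M).map y)
        ((map_pr _).trans (map_pr _).symm) :=
  (isAdditiveOver_additiveBundle A q).map_sum_id x y h _

theorem map_σ {A : (P X).Fiber M} (q : A ⟶ unit X M) :
    (fiberTotal X M).map (additiveBundle A q).σ =
      (str A).sum ((fiberTotal X M).map (additiveBundle A q).π₀)
        ((fiberTotal X M).map (additiveBundle A q).π₁) ((map_pr _).trans (map_pr _).symm) := by
  rw [← AdditiveBundle.sum_π₀_π₁, map_sum]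

theorem map_zero {A : (P X).Fiber M} (q : A ⟶ unit X M) :
    (fiberTotal X M).map (additiveBundle A q).zero = pr (unit X M) ≫ (str A).zero := rfl

variable (κ : Cleavage (P X))

/-- The lift of a bundle, in the fibre. -/
def lam (A : (P X).Fiber M) : A ⟶ (tFunctor M κ).obj A :=
  liftι κ (str A).lift (str A).lift_map_proj

theorem map_lam (A : (P X).Fiber M) : (fiberTotal X M).map (lam κ A) ≫ ι κ A = (str A).lift :=
  map_liftι κ _ _

theorem lam_natural {A B : (P X).Fiber M} {f : A ⟶ B} (h : (fiberTotal X M).map f ≫ (str B).lift =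
    (str A).lift ≫ X.T.map ((fiberTotal X M).map f)) :
    lam κ A ≫ (tFunctor M κ).map f = f ≫ lam κ B := ext_ι (by
  rw [Functor.map_comp, Category.assoc, map_tFunctor, ← Category.assoc, map_lam, Functor.map_comp,
    Category.assoc, map_lam, h])

/-- Linear maps are additive. Applied to the two projections of a product, which are linear, this
gives componentwise addition. -/
theorem additiveBundle_map_add {A B : (P X).Fiber M} {f : A ⟶ B} (q : A ⟶ unit X M)
    (q' : B ⟶ unit X M) (h : (fiberTotal X M).map f ≫ (str B).lift =
      (str A).lift ≫ X.T.map ((fiberTotal X M).map f)) :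
    (additiveBundle A q).σ ≫ f = (additiveBundle B q').sum ((additiveBundle A q).π₀ ≫ f)
      ((additiveBundle A q).π₁ ≫ f) (toUnit_unique _ _) := hom_ext (by
  have hf := additive_of_linear (f := 𝟙 M) ((map_pr f).trans (Category.comp_id _).symm) h
  rw [Functor.map_comp, map_σ, map_sum, hf.sum_comp]
  exact AdditiveBundle.sum_congr _ (Functor.map_comp _ _ _).symm (Functor.map_comp _ _ _).symm _)

theorem additiveBundle_map_zero {A B : (P X).Fiber M} {f : A ⟶ B} (q : A ⟶ unit X M)
    (q' : B ⟶ unit X M) (h : (fiberTotal X M).map f ≫ (str B).lift =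
      (str A).lift ≫ X.T.map ((fiberTotal X M).map f)) :
    (additiveBundle A q).zero ≫ f = (additiveBundle B q').zero := hom_ext (by
  have hf := additive_of_linear (f := 𝟙 M) ((map_pr f).trans (Category.comp_id _).symm) h
  rw [Functor.map_comp, map_zero, map_zero, Category.assoc, hf.zero, Category.id_comp])

variable {κ}

/-- Linearity of the cleavage makes `ι` additive from the structure of `T_M A` to `T` of the
structure of `A`. Restricting along the monic `ι` then compares the two zeros here and the two
additions next. -/
theorem tFunctor_zero (hκ : IsLinearCleavage κ) (A : (P X).Fiber M) (q : A ⟶ unit X M)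
    (q' : (tFunctor M κ).obj A ⟶ unit X M) (t : (tFunctor M κ).obj (unit X M) ⟶ unit X M) :
    t ≫ (additiveBundle _ q').zero = (tFunctor M κ).map (additiveBundle A q).zero := ext_ι (by
  rw [Functor.map_comp, map_zero, Category.assoc, Category.assoc, (additive_ι hκ A).zero,
    map_tFunctor, map_zero, map_pr_assoc, X.T.map_comp, ← Category.assoc (ι _ _), ι_pr,
    Category.assoc, AdditiveBundle.map_zero])

theorem tFunctor_add (hκ : IsLinearCleavage κ) (A : (P X).Fiber M) (q : A ⟶ unit X M)
    (q' : (tFunctor M κ).obj A ⟶ unit X M) :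
    (additiveBundle _ q').sum ((tFunctor M κ).map (additiveBundle A q).π₀)
      ((tFunctor M κ).map (additiveBundle A q).π₁) (toUnit_unique _ _) =
      (tFunctor M κ).map (additiveBundle A q).σ := ext_ι (by
  rw [map_sum, (additive_ι hκ A).sum_comp]
  refine Eq.trans ?_ (map_tFunctor κ _).symm
  rw [map_σ, AdditiveBundle.comp_map_sum]
  exact AdditiveBundle.sum_congr _ (map_tFunctor κ _) (map_tFunctor κ _) _)

/-- By linearity of the Cartesian arrow, the lift of `T_M A` is the restriction of the lift `T(λ) c`
of the tangent bundle. The vertical flip is the restriction of `c`. -/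
theorem lam_tFunctor (hκ : IsLinearCleavage κ) (A : (P X).Fiber M) :
    lam κ ((tFunctor M κ).obj A) = (tFunctor M κ).map (lam κ A) ≫ (preTangent M κ).flip A := by
  refine (isReflecting_preTangentMap κ).ext₂ ?_
  have h₁ := (preTangentMap M κ).flip A
  have h₂ : (fiberTotal X M).map (lam κ ((tFunctor M κ).obj A)) ≫ ι κ _ ≫ X.T.map (ι κ A) = _ :=
    (Category.assoc _ _ _).symm.trans ((congrArg (fun k => k ≫ X.T.map (ι κ A))
      (map_lam κ _)).trans (linear_ι hκ A).symm)
  have h₃ : (fiberTotal X M).map ((tFunctor M κ).map (lam κ A)) ≫ ι κ _ ≫ X.T.map (ι κ A) =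
      ι κ A ≫ X.T.map (str A).lift := by
    rw [← Category.assoc, map_tFunctor, Category.assoc, ← X.T.map_comp, map_lam]
  refine h₂.trans ((Eq.trans ?_ (congrArg (fun k => k ≫ X.flip _) h₃.symm)).trans
    (Eq.trans ?_ (congrArg (fun k => (fiberTotal X M).map ((tFunctor M κ).map (lam κ A)) ≫ k)
      h₁.symm))) |>.trans ?_
  · rw [Category.assoc]
  · exact Category.assoc _ _ _
  · exact (Category.assoc _ _ _).symm.trans (congrArg (fun k => k ≫ _)
      ((fiberTotal X M).map_comp _ _).symm)

variable (κ) in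
/-- The differential bundle structure of a bundle, in the fibre. -/
def differentialBundle (A : (P X).Fiber M) (q : A ⟶ unit X M) :
    DifferentialBundle (verticalTangent M κ) q :=
  haveI : PreservedByIterates (preTangent M κ).T q :=
    inferInstanceAs (PreservedByIterates (tFunctor M κ) q)
  haveI : PreservedByIterates (verticalTangent M κ).T q :=
    inferInstanceAs (PreservedByIterates (tFunctor M κ) q)
  { toAdditiveBundle := additiveBundle A q
    lift := lam κ A
    lift_additive_map := (isReflecting_preTangentMap κ).lift_additive_map
      (isAdditiveOver_additiveBundle A q) (map_zero q) (map_lam κ A)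
      (toUnit_unique_tangent κ)
    lift_additive_p := (isReflecting_preTangentMap κ).lift_additive_p
      (isAdditiveOver_additiveBundle A q) (map_zero q) (map_lam κ A)
    -- As for the vertical lift: `T_M(q)` is a product projection, so only the case `k = 0` has
    -- content.
    universal := fun k => ((isProduct_toUnit q).map (tFunctor M κ)).map_isPullback
      ((isReflecting_preTangentMap κ).isPullback_differential_mu
        (isAdditiveOver_additiveBundle A q) (map_lam κ A)
        (toUnit_unique_tangent κ) toUnit_unique
        (fun y a h => ⟨homMk a (h.trans (map_pr y)), rfl⟩) _) (iter (tFunctor M κ) k)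
    lift_ell := (isReflecting_preTangentMap κ).lift_ell (map_lam κ A) }

section Coherent

open MonoidalCategory CartesianMonoidalCategory

/-- The coherent differential structure of the fibres. -/
def coherentDifferentialStructure (hκ : IsLinearCleavage κ) (M : C) :
    letI := cartesianMonoidalCategory X M
    haveI : PreservesFiniteProducts (verticalTangent M κ).T :=
      inferInstanceAs (PreservesFiniteProducts (tFunctor M κ))
    CoherentDifferentialStructure (verticalTangent M κ) :=
  letI := cartesianMonoidalCategory X M
  haveI : PreservesFiniteProducts (verticalTangent M κ).T :=
    inferInstanceAs (PreservesFiniteProducts (tFunctor M κ))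
  { str := fun A => differentialBundle κ A (CartesianMonoidalCategory.toUnit A)
    zero_prod := fun A B => CartesianMonoidalCategory.hom_ext _ _
      ((additiveBundle_map_zero _ _ (linear_fst A B)).trans (lift_fst _ _).symm)
      ((additiveBundle_map_zero _ _ (linear_snd A B)).trans (lift_snd _ _).symm)
    add_prod := fun A B => CartesianMonoidalCategory.hom_ext _ _
      ((additiveBundle_map_add _ _ (linear_fst A B)).trans (lift_fst _ _).symm)
      ((additiveBundle_map_add _ _ (linear_snd A B)).trans (lift_snd _ _).symm)
    lift_prod_fst := fun A B => lam_natural κ (linear_fst A B)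
    lift_prod_snd := fun A B => lam_natural κ (linear_snd A B)
    zero_tangent := fun A => tFunctor_zero hκ A _ _ _
    add_tangent := fun A => tFunctor_add hκ A _ _
    lift_tangent := fun A => lam_tFunctor hκ A }

end Coherent

end Fibre

theorem isDifferentialTangentFibration {κ : Cleavage (P X)} (hκ : IsLinearCleavage κ) :
    IsDifferentialTangentFibration (tangentStructure X) X.toTangentStructure (P X) κ where
  toIsTangentFibration := isTangentFibration_P
  fibre M := ⟨Fibre.verticalTangent M κ, Fibre.isVertical_verticalTangent κ,
    Fibre.cartesianMonoidalCategory X M,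
    inferInstanceAs (PreservesFiniteProducts (Fibre.tFunctor M κ)),
    ⟨Fibre.coherentDifferentialStructure hκ M⟩⟩

end DBun


/-! ### Cartesian differential structure from coherent differential structure -/

namespace CoherentDifferentialStructure

open MonoidalCategory CartesianMonoidalCategory

variable {F : Type u} [Category.{v} F] {V : TangentStructure F} [CartesianMonoidalCategory F]
  [PreservesFiniteProducts V.T] (S : CoherentDifferentialStructure V)

/-- The sum of two maps. -/
def add {A B : F} (f g : A ⟶ B) : A ⟶ B := (S.str B).sum f g (toUnit_unique _ _)

/-- The zero map. -/
def zero (A B : F) : A ⟶ B := toUnit A ≫ (S.str B).zero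

theorem comp_add {A B C : F} (f : A ⟶ B) (g h : B ⟶ C) :
    f ≫ S.add g h = S.add (f ≫ g) (f ≫ h) :=
  (S.str C).comp_sum' f g h _

theorem comp_zero {A B : F} (f : A ⟶ B) (C : F) : f ≫ S.zero B C = S.zero A C := by
  rw [zero, ← Category.assoc, toUnit_unique (f ≫ toUnit B) (toUnit A), zero]

theorem add_comm {A B : F} (f g : A ⟶ B) : S.add f g = S.add g f :=
  (S.str B).sum_comm _ _ _

theorem add_assoc {A B : F} (f g h : A ⟶ B) : S.add (S.add f g) h = S.add f (S.add g h) :=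
  (S.str B).sum_assoc _ _ _ _ (toUnit_unique _ _)

theorem zero_add {A B : F} (f : A ⟶ B) : S.add (S.zero A B) f = f :=
  (S.str B).zero_sum _ _ _

theorem add_zero {A B : F} (f : A ⟶ B) : S.add f (S.zero A B) = f :=
  (S.str B).sum_zero _ _ _

theorem add_add_add_comm {A B : F} (f g h k : A ⟶ B) :
    S.add (S.add f g) (S.add h k) = S.add (S.add f h) (S.add g k) :=
  (S.str B).sum_sum_sum_comm _ _ _ _ _ (toUnit_unique _ _) _

/-- The commutative monoid of maps from `A` to `B`. -/
abbrev homAddCommMonoid (A B : F) : AddCommMonoid (A ⟶ B) where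
  add := S.add
  zero := S.zero A B
  add_assoc := S.add_assoc
  zero_add := S.zero_add
  add_zero := S.add_zero
  add_comm := S.add_comm
  nsmul n f := Nat.rec (S.zero A B) (fun _ g => S.add g f) n

/-- A map is linear if it preserves the lifts. -/
def IsLinear {A B : F} (f : A ⟶ B) : Prop := f ≫ (S.str B).lift = (S.str A).lift ≫ V.T.map f

variable {S}

theorem IsLinear.isAdditiveMorphism {A B : F} {f : A ⟶ B} (h : S.IsLinear f) :
    IsAdditiveMorphism (S.str A).toAdditiveBundle (S.str B).toAdditiveBundle f (𝟙 (𝟙_ F)) :=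
  DifferentialBundle.additive_of_linear (toUnit_unique _ _) h

theorem IsLinear.add_comp {A B : F} {f : A ⟶ B} (h : S.IsLinear f) {Z : F} (x y : Z ⟶ A) :
    S.add x y ≫ f = S.add (x ≫ f) (y ≫ f) :=
  h.isAdditiveMorphism.sum_comp _ _ _

theorem IsLinear.zero_comp {A B : F} {f : A ⟶ B} (h : S.IsLinear f) (Z : F) :
    S.zero Z A ≫ f = S.zero Z B := by
  rw [zero, Category.assoc, h.isAdditiveMorphism.zero, Category.id_comp, zero]

theorem IsLinear.comp {A B C : F} {f : A ⟶ B} {g : B ⟶ C} (hf : S.IsLinear f)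
    (hg : S.IsLinear g) : S.IsLinear (f ≫ g) := by
  rw [IsLinear, Category.assoc, hg, ← Category.assoc, hf, Category.assoc, V.T.map_comp]

theorem isLinear_id (A : F) : S.IsLinear (𝟙 A) := by
  rw [IsLinear, V.T.map_id, Category.id_comp, Category.comp_id]

theorem isLinear_fst (A B : F) : S.IsLinear (fst A B) := (S.lift_prod_fst A B).symm

theorem isLinear_snd (A B : F) : S.IsLinear (snd A B) := (S.lift_prod_snd A B).symm

-- Two successive lifts agree with `λ ℓ`, which the flip fixes.
variable (S) in
theorem lift_lift_flip (A : F) : ((S.str A).lift ≫ V.T.map (S.str A).lift) ≫ V.flip A =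
    (S.str A).lift ≫ V.T.map (S.str A).lift := by
  rw [← (S.str A).lift_ell, Category.assoc, V.ell_flip]

/-- Because the lift of `T A` is `T(λ) c`, linearity of `λ`, `0`, `ℓ`, `c` and of `T f` for linear
`f` are coherence axioms in disguise. Linear maps are additive, so all of these maps distribute over
sums. -/
theorem isLinear_lift (A : F) : S.IsLinear (S.str A).lift := by
  rw [IsLinear, S.lift_tangent, ← Category.assoc, S.lift_lift_flip]

theorem isLinear_zero (A : F) : S.IsLinear (V.zero A) := by
  rw [IsLinear, S.lift_tangent, ← Category.assoc, V.zero_natural, Category.assoc, V.zero_flip']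

theorem IsLinear.map {A B : F} {f : A ⟶ B} (h : S.IsLinear f) : S.IsLinear (V.T.map f) := by
  rw [IsLinear, S.lift_tangent, S.lift_tangent, ← Category.assoc, ← V.T.map_comp, h,
    V.T.map_comp, Category.assoc, Category.assoc, V.flip_natural]

theorem isLinear_ell (A : F) : S.IsLinear (V.ell A) := by
  rw [IsLinear, S.lift_tangent, S.lift_tangent, Category.assoc,
    ← V.ell_flip_flip, ← Category.assoc, ← Category.assoc, V.ell_natural, V.T.map_comp]
  simp only [Category.assoc]

theorem isLinear_flip (A : F) : S.IsLinear (V.flip A) := by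
  rw [IsLinear, S.lift_tangent, S.lift_tangent, V.T.map_comp]
  simp only [Category.assoc]
  rw [← Category.assoc (V.flip A), ← V.flip_natural, Category.assoc, ← V.flip_hexagon]

variable (S)

/-- Coherence identifies the addition of `T(σ)` with the canonical addition of `T A`, so one
notation serves for both. -/
theorem tangent_sum {Z A : F} (x y : Z ⟶ V.T.obj A)
    (h : x ≫ V.T.map (toUnit A) = y ≫ V.T.map (toUnit A)) :
    haveI := (S.str A).preserved
    ((S.str A).map V.T).sum x y h = S.add x y := by
  have := (S.str A).preserved
  rw [AdditiveBundle.map_sum, ← S.add_tangent, AdditiveBundle.comp_sum']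
  exact AdditiveBundle.sum_congr _ (AdditiveBundle.mapPair_map_π₀ _ _ _ _ _)
    (AdditiveBundle.mapPair_map_π₁ _ _ _ _ _) _

theorem map_add {A B : F} (f g : A ⟶ B) :
    V.T.map (S.add f g) = S.add (V.T.map f) (V.T.map g) := by
  have := (S.str B).preserved
  rw [add, AdditiveBundle.map_map_sum, S.tangent_sum]

theorem map_zero (A B : F) : V.T.map (S.zero A B) = S.zero (V.T.obj A) (V.T.obj B) := by
  rw [zero, V.T.map_comp, ← S.zero_tangent, ← Category.assoc,
    toUnit_unique (V.T.map (toUnit A) ≫ toUnit _) (toUnit _), zero]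

variable {S} in
theorem IsLinear.add {A B : F} {f g : A ⟶ B} (hf : S.IsLinear f) (hg : S.IsLinear g) :
    S.IsLinear (S.add f g) := by
  rw [IsLinear, S.map_add, S.comp_add, (isLinear_lift B).add_comp, hf, hg]

/-- The tangent vector `v` at the point `x`: the map `⟨v, x⟩ ≫ μ`. -/
def vec {Z A : F} (v x : Z ⟶ A) : Z ⟶ V.T.obj A := S.add (v ≫ (S.str A).lift) (x ≫ V.zero A)

theorem pair_μ {Z A : F} (v x : Z ⟶ A) :
    (S.str A).pair v x (toUnit_unique _ _) ≫ (S.str A).μ = S.vec v x := by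
  rw [DifferentialBundle.pair_μ, S.tangent_sum, vec]

theorem vec_p {Z A : F} (v x : Z ⟶ A) : S.vec v x ≫ V.p A = x := by
  rw [← S.pair_μ, DifferentialBundle.pair_μ_p]

variable {S} in
theorem vec_inj {Z A : F} {v x v' x' : Z ⟶ A} (h : S.vec v x = S.vec v' x') :
    v = v' ∧ x = x' := by
  rw [← S.pair_μ, ← S.pair_μ] at h
  exact DifferentialBundle.pair_μ_inj _ h

/-- As `T 1` is final, every tangent vector lies over the zero section, and universality of the lift
decomposes it. -/
theorem exists_vec {Z A : F} (t : Z ⟶ V.T.obj A) : ∃ v, S.vec v (t ≫ V.p A) = t := by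
  obtain ⟨v, x, h, -, e⟩ := (S.str A).exists_pair t (toUnit Z)
    ((isTerminalTensorUnit.isTerminalObj V.T _).hom_ext _ _)
  have e' := (S.pair_μ v x).symm.trans e
  exact ⟨v, by rw [← e', S.vec_p]⟩

theorem comp_vec {W Z A : F} (f : W ⟶ Z) (v x : Z ⟶ A) :
    f ≫ S.vec v x = S.vec (f ≫ v) (f ≫ x) := by
  rw [vec, S.comp_add, vec, Category.assoc, Category.assoc]

theorem vec_add {Z A : F} (v w x y : Z ⟶ A) :
    S.vec (S.add v w) (S.add x y) = S.add (S.vec v x) (S.vec w y) := by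
  rw [vec, vec, vec, (isLinear_lift A).add_comp, (isLinear_zero A).add_comp, S.add_add_add_comm]

theorem zero_vec {Z A : F} (x : Z ⟶ A) : S.vec (S.zero Z A) x = x ≫ V.zero A := by
  rw [vec, (isLinear_lift A).zero_comp, S.zero_add]

theorem vec_zero {Z A : F} (v : Z ⟶ A) : S.vec v (S.zero Z A) = v ≫ (S.str A).lift := by
  rw [vec, (isLinear_zero A).zero_comp, S.add_zero]

variable {S} in
theorem IsLinear.vec_map {A B : F} {f : A ⟶ B} (h : S.IsLinear f) {Z : F} (v x : Z ⟶ A) :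
    S.vec v x ≫ V.T.map f = S.vec (v ≫ f) (x ≫ f) := by
  rw [vec, h.map.add_comp, vec, Category.assoc, Category.assoc, Category.assoc, Category.assoc,
    V.zero_natural, h]

/-- Relates the addition of `p` to that of `A`. A vector is `T(σ)` of `λ(v)` and `0(x)`, and
naturality of `+` at `σ` allows adding componentwise: `λ` is additive into `p`, and `0(x) + 0(x) =
0(x)`. -/
theorem bundle_sum_vec {Z A : F} (v w x : Z ⟶ A) :
    (V.bundle A).sum (S.vec v x) (S.vec w x) (by rw [S.vec_p, S.vec_p]) = S.vec (S.add v w) x := by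
  have := (S.str A).preserved
  have hc : ∀ v : Z ⟶ A, (v ≫ (S.str A).lift) ≫ V.T.map (toUnit A) =
      (x ≫ V.zero A) ≫ V.T.map (toUnit A) := fun v =>
    (S.str A).lift_zero_comm (toUnit_unique _ _)
  have h : ∀ v : Z ⟶ A, S.vec v x =
      (S.str A).mapPair V.T (v ≫ (S.str A).lift) (x ≫ V.zero A) (hc v) ≫
        V.T.map (S.str A).σ := fun v => by
    rw [vec, ← S.tangent_sum _ _ (hc v), AdditiveBundle.map_sum]
  have hp : ∀ v : Z ⟶ A, (S.str A).mapPair V.T (v ≫ (S.str A).lift) (x ≫ V.zero A) (hc v) ≫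
      V.p _ = (S.str A).pair (S.zero Z A) x (toUnit_unique _ _) := fun v => by
    apply (S.str A).E₂_ext
    · rw [Category.assoc, ← V.p_natural, AdditiveBundle.mapPair_map_π₀_assoc, Category.assoc,
        (S.str A).lift_p, ← Category.assoc, toUnit_unique (v ≫ _) (toUnit Z),
        AdditiveBundle.pair_π₀, zero]
    · rw [Category.assoc, ← V.p_natural, AdditiveBundle.mapPair_map_π₁_assoc, Category.assoc,
        V.zero_p, Category.comp_id, AdditiveBundle.pair_π₁]
  refine ((V.bundle A).sum_congr (h v) (h w) _).trans (((V.natural _).sum_comp _ _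
    ((hp v).trans (hp w).symm)).symm.trans ?_)
  rw [h]
  congr 1
  apply (S.str A).map_E₂_ext V.T
  · refine ((V.natural _).sum_comp _ _ _).trans (Eq.trans ?_
      (AdditiveBundle.mapPair_map_π₀ _ _ _ _ _).symm)
    rw [add, (S.str A).lift_additive_p.sum_comp]
    exact (V.bundle A).sum_congr (AdditiveBundle.mapPair_map_π₀ _ _ _ _ _)
      (AdditiveBundle.mapPair_map_π₀ _ _ _ _ _) _
  · refine ((V.natural _).sum_comp _ _ _).trans (Eq.trans ?_
      (AdditiveBundle.mapPair_map_π₁ _ _ _ _ _).symm)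
    exact ((V.bundle A).sum_congr (AdditiveBundle.mapPair_map_π₁ _ _ _ _ _)
      (AdditiveBundle.mapPair_map_π₁ _ _ _ _ _) _).trans ((V.bundle A).zero_sum _ _ _)

/-- Naturality of `p` fixes the base point of the image vector; the remaining component is the
derivative. -/
theorem exists_derivative {A B : F} (f : A ⟶ B) :
    ∃ d : A ⊗ A ⟶ B, S.vec (fst A A) (snd A A) ≫ V.T.map f = S.vec d (snd A A ≫ f) := by
  obtain ⟨d, hd⟩ := S.exists_vec (S.vec (fst A A) (snd A A) ≫ V.T.map f)
  refine ⟨d, ?_⟩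
  rw [← hd, Category.assoc, V.p_natural, ← Category.assoc, S.vec_p]

/-- The differential combinator. -/
def derivative {A B : F} (f : A ⟶ B) : A ⊗ A ⟶ B := (S.exists_derivative f).choose

theorem derivative_spec {A B : F} (f : A ⟶ B) :
    S.vec (fst A A) (snd A A) ≫ V.T.map f = S.vec (S.derivative f) (snd A A ≫ f) :=
  (S.exists_derivative f).choose_spec

theorem vec_map {A B : F} (f : A ⟶ B) {Z : F} (v x : Z ⟶ A) :
    S.vec v x ≫ V.T.map f = S.vec (lift v x ≫ S.derivative f) (x ≫ f) := by
  have h := congrArg (fun k => lift v x ≫ k) (S.derivative_spec f)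
  rw [← Category.assoc, S.comp_vec, S.comp_vec, ← Category.assoc, lift_fst, lift_snd] at h
  exact h

theorem lift_vec {Z A : F} (v x : Z ⟶ A) : lift v x ≫ S.vec (fst A A) (snd A A) = S.vec v x := by
  rw [S.comp_vec, lift_fst, lift_snd]

theorem isLinear_vec (A : F) : S.IsLinear (S.vec (fst A A) (snd A A)) :=
  ((isLinear_fst A A).comp (isLinear_lift A)).add ((isLinear_snd A A).comp (isLinear_zero A))

variable {S} in
theorem derivative_eq {A B : F} {f : A ⟶ B} {d : A ⊗ A ⟶ B} {x : A ⊗ A ⟶ B}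
    (h : S.vec (fst A A) (snd A A) ≫ V.T.map f = S.vec d x) : S.derivative f = d :=
  (vec_inj ((S.derivative_spec f).symm.trans h)).1

theorem derivative_add {A B : F} (f g : A ⟶ B) :
    S.derivative (S.add f g) = S.add (S.derivative f) (S.derivative g) := derivative_eq (by
  rw [S.map_add, S.comp_add, S.derivative_spec, S.derivative_spec, ← S.vec_add])

theorem derivative_zero (A B : F) : S.derivative (S.zero A B) = S.zero (A ⊗ A) B :=
  derivative_eq (x := S.zero _ B) (by
    rw [S.map_zero, S.comp_zero, S.zero_vec, (isLinear_zero B).zero_comp])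

/-- Two vectors over one base point are added by `+`, and `T f` is additive for `+` by naturality.
Injectivity of `vec` then extracts the vector parts. -/
theorem add_derivative {Z A B : F} (v w x : Z ⟶ A) (f : A ⟶ B) :
    lift (S.add v w) x ≫ S.derivative f =
      S.add (lift v x ≫ S.derivative f) (lift w x ≫ S.derivative f) :=
  (vec_inj (x := x ≫ f) (x' := x ≫ f) (by
    rw [← S.vec_map, ← S.bundle_sum_vec, ← S.bundle_sum_vec, (V.natural f).sum_comp]
    exact AdditiveBundle.sum_congr _ (S.vec_map _ _ _) (S.vec_map _ _ _) _)).1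

theorem zero_derivative {Z A B : F} (x : Z ⟶ A) (f : A ⟶ B) :
    lift (S.zero Z A) x ≫ S.derivative f = S.zero Z B :=
  (vec_inj (x := x ≫ f) (x' := x ≫ f) (by
    rw [← S.vec_map, S.zero_vec, S.zero_vec, Category.assoc, V.zero_natural, Category.assoc])).1

variable {S} in
theorem IsLinear.derivative_eq {A B : F} {f : A ⟶ B} (h : S.IsLinear f) :
    S.derivative f = fst A A ≫ f :=
  CoherentDifferentialStructure.derivative_eq (h.vec_map _ _)

/-- The chain rule is functoriality of `T`. -/
theorem derivative_comp {A B C : F} (f : A ⟶ B) (g : B ⟶ C) :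
    S.derivative (f ≫ g) = lift (S.derivative f) (snd A A ≫ f) ≫ S.derivative g :=
  derivative_eq (by rw [V.T.map_comp, ← Category.assoc, S.derivative_spec, S.vec_map])

theorem derivative_lift {Z A B : F} (f : Z ⟶ A) (g : Z ⟶ B) :
    S.derivative (lift f g) = lift (S.derivative f) (S.derivative g) := by
  apply CartesianMonoidalCategory.hom_ext
  · rw [lift_fst, ← lift_fst f g, S.derivative_comp, (isLinear_fst A B).derivative_eq,
      ← Category.assoc, lift_fst, lift_fst]
  · rw [lift_snd, ← lift_snd f g, S.derivative_comp, (isLinear_snd A B).derivative_eq,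
      ← Category.assoc, lift_fst, lift_snd]

/-- The second derivative is the top coefficient of `T² f` on a vector of vectors. The other three
coefficients play no role below and are left existential. -/
theorem vec_vec_map_map {Z A B : F} (a b c d : Z ⟶ A) (f : A ⟶ B) :
    ∃ y z w : Z ⟶ B, S.vec (S.vec a b) (S.vec c d) ≫ V.T.map (V.T.map f) =
      S.vec (S.vec (lift (lift a b) (lift c d) ≫ S.derivative (S.derivative f)) y)
        (S.vec z w) := by
  refine ⟨lift (lift a b) (lift c d) ≫ S.derivative (snd A A ≫ f),
    lift c d ≫ S.derivative f, lift c d ≫ snd A A ≫ f, ?_⟩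
  rw [← S.lift_vec a b, ← S.lift_vec c d, ← (S.isLinear_vec A).vec_map, Category.assoc,
    ← V.T.map_comp, S.derivative_spec, ← S.lift_vec (S.derivative f), V.T.map_comp,
    ← Category.assoc, S.vec_map, (S.isLinear_vec B).vec_map, S.derivative_lift]
  simp only [S.lift_vec, CartesianMonoidalCategory.comp_lift]

theorem vec_vec {Z A : F} (a b c d : Z ⟶ A) : S.vec (S.vec a b) (S.vec c d) =
    S.add (S.add (a ≫ (S.str A).lift ≫ (S.str _).lift) (b ≫ V.zero A ≫ (S.str _).lift))
      (S.add (c ≫ (S.str A).lift ≫ V.zero _) (d ≫ V.zero A ≫ V.zero _)) := by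
  rw [vec, vec, vec, (isLinear_lift _).add_comp, (isLinear_zero _).add_comp]
  simp only [Category.assoc]

/-- A vector of vectors is a sum of four terms, obtained from `λ` or `0` at each of the two levels.
The flip fixes the two unmixed terms and exchanges the two mixed ones. -/
theorem vec_vec_flip {Z A : F} (a b c d : Z ⟶ A) :
    S.vec (S.vec a b) (S.vec c d) ≫ V.flip A = S.vec (S.vec a c) (S.vec b d) := by
  have h₁ : ((S.str A).lift ≫ (S.str _).lift) ≫ V.flip A = (S.str A).lift ≫ (S.str _).lift := by
    rw [isLinear_lift A, S.lift_lift_flip]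
  have h₂ : (V.zero A ≫ (S.str _).lift) ≫ V.flip A = (S.str A).lift ≫ V.zero _ := by
    rw [S.lift_tangent, Category.assoc, Category.assoc, V.flip_flip, Category.comp_id,
      V.zero_natural]
  have h₃ : ((S.str A).lift ≫ V.zero _) ≫ V.flip A = V.zero A ≫ (S.str _).lift := by
    rw [Category.assoc, V.zero_flip', isLinear_zero A]
  have h₄ : (V.zero A ≫ V.zero _) ≫ V.flip A = V.zero A ≫ V.zero _ := by
    rw [Category.assoc, V.zero_flip', V.zero_natural]
  rw [S.vec_vec, S.vec_vec, (isLinear_flip A).add_comp, (isLinear_flip A).add_comp,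
    (isLinear_flip A).add_comp, S.add_add_add_comm]
  simp only [Category.assoc] at h₁ h₂ h₃ h₄ ⊢
  rw [h₁, h₂, h₃, h₄]

theorem vec_ell {Z A : F} (a d : Z ⟶ A) :
    S.vec a d ≫ V.ell A = S.vec (S.vec a (S.zero Z A)) (S.vec (S.zero Z A) d) := by
  rw [vec, (isLinear_ell A).add_comp, S.zero_vec, S.vec_zero, vec, Category.assoc, Category.assoc,
    (S.str A).lift_ell, V.zero_ell, V.zero_natural, Category.assoc, Category.assoc,
    isLinear_lift A]

/-- Naturality of `ell` at `f`, with top coefficients compared by means of `vec_ell`. -/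
theorem derivative_derivative_linear {Z A B : F} (a d : Z ⟶ A) (f : A ⟶ B) :
    lift (lift a (S.zero Z A)) (lift (S.zero Z A) d) ≫ S.derivative (S.derivative f) =
      lift a d ≫ S.derivative f := by
  obtain ⟨y, z, w, h⟩ := S.vec_vec_map_map a (S.zero Z A) (S.zero Z A) d f
  rw [← S.vec_ell, Category.assoc, ← V.ell_natural, ← Category.assoc, S.vec_map, S.vec_ell] at h
  exact (vec_inj (vec_inj h).1).1.symm

/-- Naturality of `flip` at `f`, with top coefficients compared by means of `vec_vec_flip`. -/
theorem derivative_derivative_symm {Z A B : F} (a b c d : Z ⟶ A) (f : A ⟶ B) :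
    lift (lift a b) (lift c d) ≫ S.derivative (S.derivative f) =
      lift (lift a c) (lift b d) ≫ S.derivative (S.derivative f) := by
  obtain ⟨y, z, w, h⟩ := S.vec_vec_map_map a b c d f
  obtain ⟨y', z', w', h'⟩ := S.vec_vec_map_map a c b d f
  rw [← S.vec_vec_flip, Category.assoc, ← V.flip_natural, ← Category.assoc, h,
    S.vec_vec_flip] at h'
  exact (vec_inj (vec_inj h').1).1

/-- The Cartesian differential structure determined by coherent differential structure. -/
def cartesianDifferentialStructure : CartesianDifferentialStructure F where
  homAdd := S.homAddCommMonoid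
  comp_add := S.comp_add
  comp_zero f := S.comp_zero f _
  add_fst := (isLinear_fst _ _).add_comp
  add_snd := (isLinear_snd _ _).add_comp
  zero_fst := (isLinear_fst _ _).zero_comp _
  zero_snd := (isLinear_snd _ _).zero_comp _
  D := S.derivative
  D_add := S.derivative_add
  D_zero := S.derivative_zero _ _
  add_D := S.add_derivative
  zero_D := S.zero_derivative
  D_id A := (isLinear_id A).derivative_eq.trans (Category.comp_id _)
  D_fst A B := (isLinear_fst A B).derivative_eq
  D_snd A B := (isLinear_snd A B).derivative_eq
  D_lift := S.derivative_lift
  D_comp := S.derivative_comp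
  D_D_linear := S.derivative_derivative_linear
  D_D_symm := S.derivative_derivative_symm

theorem cartesianDifferentialStructure_isInducedBy :
    S.cartesianDifferentialStructure.IsInducedBy S where
  add _ _ := rfl
  zero _ _ := rfl
  D f := by
    rw [S.pair_μ, ← Category.assoc, S.pair_μ, S.derivative_spec]
    rfl

end CoherentDifferentialStructure

end

end TangentCat

/-- The fibre condition in `IsDifferentialTangentFibration` only asserts existence, so `V` and `S`
are exhibited again in order to say that `D` is induced by them. -/
theorem theorem4 {C : Type u} [Category.{v} C] (X : DisplayTangentStructure C) :
    ∃ 𝕋 : TangentStructure (DBun X), IsPointwise X 𝕋 ∧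
      (∃ κ : Cleavage (DBun.P X), IsLinearCleavage κ) ∧
      ∀ κ : Cleavage (DBun.P X), IsLinearCleavage κ →
        ∃ hP : IsDifferentialTangentFibration 𝕋 X.toTangentStructure (DBun.P X) κ,
          ∀ M : C, ∃ V : TangentStructure ((DBun.P X).Fiber M), IsVertical hP.strict κ M V ∧
            ∃ (_ : CartesianMonoidalCategory ((DBun.P X).Fiber M))
              (_ : PreservesFiniteProducts V.T) (S : CoherentDifferentialStructure V)
              (D : CartesianDifferentialStructure ((DBun.P X).Fiber M)), D.IsInducedBy S := by
  refine ⟨DBun.tangentStructure X, DBun.isPointwise_tangentStructure,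
    DBun.exists_linear_cleavage, fun κ hκ => ⟨DBun.isDifferentialTangentFibration hκ, fun M => ?_⟩⟩
  let _ := DBun.Fibre.cartesianMonoidalCategory X M
  have h : PreservesFiniteProducts (DBun.Fibre.verticalTangent M κ).T :=
    inferInstanceAs (PreservesFiniteProducts (DBun.Fibre.tFunctor M κ))
  exact ⟨DBun.Fibre.verticalTangent M κ, DBun.Fibre.isVertical_verticalTangent κ,
    DBun.Fibre.cartesianMonoidalCategory X M, h, DBun.Fibre.coherentDifferentialStructure hκ M,
    CoherentDifferentialStructure.cartesianDifferentialStructure _,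
    CoherentDifferentialStructure.cartesianDifferentialStructure_isInducedBy _⟩
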